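/- **Setting.** Let $\Gamma$ be the dual graph of the minimal log resolution of a normal surface singularity: a finite connected multigraph (loops and multiple edges allowed) with vertices $v$ decorated by genera $g_v\ge 0$ and Euler numbers $e_v\in\mathbb Z$ (for a nodal component, of the normal bundle of its normalization), with negative definite intersection form $I_{uu}=e_u+2\cdot\#\{\text{loops at }u\}$, $I_{uw}=\#\{\text{edges }uw\}$ $(u\neq w)$, and such that no vertex with $g_v=0$ and valency $\le 2$ has $e_v=-1$. A *node* is a vertex with $g_v>0$ or valency $\ge 3$. Assume that $\Gamma$ has at least one maximal chain whose two ends are nodes (possibly the same node) and whose interior vertices are not nodes; i.e. $\Gamma$ has a node and the link $L$ is not a Seifert manifold. Choose one edge on each such chain (the JSJ tori) and cut $\Gamma$ along these edges, replacing each by two arrowheads, one supported at either end. The resulting pieces $L_N$ are indexed by the nodes $N$. Order the oriented edges arbitrarily. The vertex group $G(N)=\pi_1(L_N)$ is generated by elements $\gamma_y$, for all vertices and arrowheads $y$ of the piece, and $a_i,b_i$ $(1\le i\le g_N)$, subject to: $h_N:=\gamma_N$ is central; $\gamma_x$ and $\gamma_y$ commute for every edge $(x,y)$ of the piece; $\gamma_x^{-e_x}=\prod_y\gamma_y$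 for every vertex $x\neq N$, and $\gamma_N^{-e_N}=\prod_i[a_i,b_i]\cdot\prod_y\gamma_y$, where $y$ runs over the other ends of the edges of the piece at $x$, resp. $N$, in the chosen order. The JSJ graph $\mathfrak G$ has the nodes as vertices and the oriented cutting edges $e$ as edges. For $e$ running from a vertex $u$ in the piece of $N$ to a vertex $w$ in the piece of $N'$, with arrowheads $a$ at $u$ and $a'$ at $w$, put $G(e)=\mathbb Z^2$ and $\phi_e^-(m,n)=\gamma_u^m\gamma_a^n\in G(N)$, $\phi_e^+(m,n)=\gamma_{a'}^m\gamma_w^n\in G(N')$; let $G(e)^\pm$ be the images and $\phi_e=\phi_e^+\circ(\phi_e^-)^{-1}\colon G(e)^-\to G(e)^+$. For a maximal tree $\mathfrak T$ of $\mathfrak G$, $\pi_1=\pi_1(L)$ is the fundamental group of this graph of groups: the quotient of the free product of the groups $G(N)$ and the free group on letters $t_e$ by the relations $t_e\,\phi_e(c)\,t_e^{-1}=c$ $(c\in G(e)^-)$, $t_{\bar e}=t_e^{-1}$, and $t_e=1$ for $e\in\mathfrak T$. A cyclically reduced word of length zero is a pair $(v_0,\mu_0)$ of a node $v_0$ and an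 element $1\ne\mu_0\in G(v_0)$; its label is the image of $\mu_0$ in $\pi_1$. The *m-arc-generators* in $G(N)$ are the elements $\gamma_y^m$ ($y$ a vertex or an arrowhead of the piece, $m\in\mathbb Z$) and $\gamma_x^m\gamma_y^n$ ($(x,y)$ an edge of the piece, $x$ not an arrowhead, $m,n\in\mathbb Z$). Each of them belongs to some $G(e)^-$, $e$ an oriented cutting edge leaving the piece (one type for each $e$), or is a power of some $g_x:=\gamma_x$ with $x$ the end vertex (a non-node of valency one) of a chain without arrowhead (one type for each such chain). An element of a given type is *pure* if it is not of any other type. An *arc-generator* is $\gamma_v^m$ ($v$ a vertex of $\Gamma$, $m>0$), or $\gamma_u^m\gamma_w^n$ ($(u,w)$ an edge of $\Gamma$, $m,n>0$); the latter is the same arc-generator as $\gamma_w^n\gamma_u^m$ for the reversed edge. It is represented by a word at the node of the piece containing $v$, resp. the edge. If the edge $(u,w)$ is cut, it is represented on either side of the torus: by $\gamma_u^m\gamma_a^n$ in the piece of $u$, and by $\gamma_w^n\gamma_{a'}^m$ in the piece of $w$. **Theorem.** Let $(v_0,\mu_0)$ and $(v_0',\mu_0')$ be cyclically reduced words of length zero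 whose labels are conjugate in $\pi_1$. Consider the following cases. * (m=0) $v_0=v_0'$ and $\mu_0=\mu_0'$ in $G(v_0)$. * (m=1) There is an edge $e$ of $\mathfrak G$ from $v_0$ to $v_0'$ with $\mu_0\in G(e)^-$ and $\mu_0'=\phi_e(\mu_0)$, and at least one of $\mu_0\in G(e)^-$ and $\mu_0'\in G(e)^+$ is pure. * (m=2) There are edges $e_0$ of $\mathfrak G$ from $v_0$ to some $v_1$ and $e_1$ from $v_1$ to $v_0'$ with $e_1\ne\overline{e_0}$, and $\mu_1\in G(v_1)$, with $\mu_0=\phi_{e_0}^{-1}(\mu_1)$ and $\mu_0'=\phi_{e_1}(\mu_1)$, and both $\mu_0\in G(e_0)^-$ and $\mu_0'\in G(e_1)^+$ are pure. 1. Assume that no node of $\Gamma$ is of genus $0$ and valency $3$ with two neighbours that have genus $0$, valency $1$ and Euler number $-2$ (such a piece is the twisted interval bundle over the Klein bottle). If $\mu_0$ and $\mu_0'$ are m-arc-generators, then (m=0), (m=1) or (m=2) holds. 2. (No assumption as in 1.) Suppose that the words represent arc-generators $A$ and $A'$. Then (m=2) does not hold. If the two words are not the representatives of one and the same arc-generator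 of a cutting edge on the two opposite sides of its torus, then (m=1) does not hold either, and (m=0) holds. If $A$ and $A'$ are different arc-generators, then moreover each of them is supported by a chain without arrowhead at $v_0$ (the vertex $v_0$ itself being counted as part of such a chain), $\mu_0=\mu_0'$ is a positive power of the corresponding generators $g_x$ of both chains, and either the two chains coincide or $\mu_0=h_{v_0}^n$ for some $n>0$. -/

import Mathlib

/-- The dual graph of a nodal curve on a smooth surface: a finite multigraph (loops and multiple
edges allowed) given by its oriented edges `D`, where `rev` reverses the orientation.
`euler v` is the Euler number of the normal bundle of the normalization of the curve `E_v`
(so `E_v ^ 2 = euler v + 2 * (number of double points of E_v)`), `genus v` its genus. -/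
structure PlumbingGraph (V D : Type*) where
  src : D → V
  rev : D → D
  rev_rev : ∀ d, rev (rev d) = d
  rev_ne : ∀ d, rev d ≠ d
  euler : V → ℤ
  genus : V → ℕ

namespace PlumbingGraph

section Basic

variable {V D : Type*} (Γ : PlumbingGraph V D)

/-- The end point of an oriented edge. -/
def tgt (d : D) : V := Γ.src (Γ.rev d)

/-- Number of edges at a vertex, loops counted twice. -/
noncomputable def valency (v : V) : ℕ := Set.ncard {d : D | Γ.src d = v}

/-- A node has positive genus or valency at least three. -/
def IsNode (v : V) : Prop := 0 < Γ.genus v ∨ 3 ≤ Γ.valency v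

/-- The nodes; they are the vertices of the JSJ graph of groups. -/
abbrev Node : Type _ := {v : V // Γ.IsNode v}

def IsConnected : Prop :=
  ∀ u v : V, Relation.ReflTransGen (fun a b => ∃ d, Γ.src d = a ∧ Γ.tgt d = b) u v

open Classical in
/-- The intersection matrix `(E_u · E_v)` of the irreducible components. -/
noncomputable def intersectionMatrix : Matrix V V ℝ := Matrix.of fun u v =>
  (Set.ncard {d : D | Γ.src d = u ∧ Γ.tgt d = v} : ℝ) + if u = v then (Γ.euler u : ℝ) else 0

/-- No rational `(-1)`-curve meets the rest of the curve in at most two points. -/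
def IsMinimal : Prop := ∀ v, Γ.genus v = 0 → Γ.valency v ≤ 2 → Γ.euler v ≠ -1

/-- `d'` continues `d` through an interior vertex of a chain. -/
def Step (d d' : D) : Prop :=
  ¬ Γ.IsNode (Γ.tgt d) ∧ Γ.src d' = Γ.tgt d ∧ d' ≠ Γ.rev d

/-- A maximal chain with node ends (possibly the same node), as the list of its consecutive
oriented edges; its interior vertices are not nodes. -/
def IsNodeChain (l : List D) : Prop :=
  l ≠ [] ∧ l.IsChain Γ.Step ∧
    (∀ d ∈ l.head?, Γ.IsNode (Γ.src d)) ∧ (∀ d ∈ l.getLast?, Γ.IsNode (Γ.tgt d))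

/-- `l` lists the consecutive oriented edges of a chain without arrow at `v`:
it starts at `v` and ends in the non-node `x` of valency one. -/
def IsLeg (v : V) (l : List D) (x : V) : Prop :=
  l ≠ [] ∧ l.IsChain Γ.Step ∧ (∀ d ∈ l.head?, Γ.src d = v) ∧ (∀ d ∈ l.getLast?, Γ.tgt d = x) ∧
    ¬ Γ.IsNode x ∧ Γ.valency x = 1

/-- A rational node of valency three with two neighbours that are rational `(-2)`-vertices of
valency one. -/
def IsExceptional (v : V) : Prop :=
  Γ.genus v = 0 ∧ Γ.valency v = 3 ∧ ∃ d d' : D, d ≠ d' ∧ ∀ c ∈ ({d, d'} : Set D),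
    Γ.src c = v ∧ Γ.genus (Γ.tgt c) = 0 ∧ Γ.valency (Γ.tgt c) = 1 ∧ Γ.euler (Γ.tgt c) = -2

/-- A choice of the JSJ tori: one edge in every maximal chain with node ends, and no other edge.
`cut` is the set of the oriented cutting edges. -/
structure JSJCut where
  cut : Set D
  rev_mem : ∀ d ∈ cut, Γ.rev d ∈ cut
  existsUnique_mem : ∀ l, Γ.IsNodeChain l → ∃! d, d ∈ l ∧ d ∈ cut
  exists_chain : ∀ d ∈ cut, ∃ l, Γ.IsNodeChain l ∧ d ∈ l

/-- Data of an arc-generator: `γ_x ^ m`, or `γ_u ^ m * γ_w ^ n` for an edge `d` from `u` to `w`,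
with positive exponents. -/
inductive ArcGen (V D : Type*)
  | vertex (x : V) (m : ℕ+)
  | edge (d : D) (m n : ℕ+)

/-- The same arc-generator: equal, or the same edge read in the other direction. -/
def SameArc (A A' : ArcGen V D) : Prop :=
  A = A' ∨ ∃ d m n, A = .edge d m n ∧ A' = .edge (Γ.rev d) n m

/-- The arc-generator lives on the chain without arrow `l` at `v`, the vertex `v` included. -/
def Supported (v : V) (l : List D) : ArcGen V D → Prop
  | .vertex x _ => x = v ∨ ∃ d ∈ l, Γ.tgt d = x
  | .edge d _ _ => d ∈ l ∨ Γ.rev d ∈ l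

end Basic

namespace JSJCut

section Pieces

variable {V D : Type*} {Γ : PlumbingGraph V D} (S : Γ.JSJCut)

/-- The (non-arrowhead) vertices of the piece of the node `N`. -/
def piece (N : Γ.Node) : Set V :=
  {x | Relation.ReflTransGen (fun a b => ∃ d, d ∉ S.cut ∧ Γ.src d = a ∧ Γ.tgt d = b) N.1 x}

theorem tgt_mem {N : Γ.Node} {d : D} (hd : d ∉ S.cut) (h : Γ.src d ∈ S.piece N) :
    Γ.tgt d ∈ S.piece N :=
  Relation.ReflTransGen.tail h ⟨d, hd, rfl, rfl⟩

theorem node_mem (N : Γ.Node) : N.1 ∈ S.piece N := Relation.ReflTransGen.refl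

/-- Generators of the fundamental group of the piece of `N`: the fibres of its vertices, the
fibres of its arrowheads (one for each cutting edge leaving the piece), and the handles of `N`. -/
inductive Gen (N : Γ.Node)
  | vert (x : V) (hx : x ∈ S.piece N)
  | arrow (d : D) (hd : d ∈ S.cut) (hx : Γ.src d ∈ S.piece N)
  | handleA (i : Fin (Γ.genus N.1))
  | handleB (i : Fin (Γ.genus N.1))

open Classical in
/-- The other end of `d` in the plumbing graph of the piece: an arrowhead if `d` is cut. -/
noncomputable def headGen {N : Γ.Node} (d : D) (h : Γ.src d ∈ S.piece N) : S.Gen N :=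
  if hd : d ∈ S.cut then .arrow d hd h else .vert (Γ.tgt d) (S.tgt_mem hd h)

end Pieces

section Groups

variable {V D : Type*} [Fintype D] [LinearOrder D] {Γ : PlumbingGraph V D} (S : Γ.JSJCut)

open Classical in
/-- The oriented edges at `x`, in the chosen order. -/
noncomputable def dartsAt (Γ : PlumbingGraph V D) (x : V) : List D :=
  ((Finset.univ : Finset D).filter fun d => Γ.src d = x).sort (· ≤ ·)

theorem src_mem_of_dartsAt {N : Γ.Node} {x : V} (hx : x ∈ S.piece N) {d : D}
    (hd : d ∈ dartsAt Γ x) : Γ.src d ∈ S.piece N := by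
  have h : Γ.src d = x := by simpa [dartsAt] using hd
  rw [h]; exact hx

/-- The product, in the chosen order, of the fibres adjacent to `x` in the piece. -/
noncomputable def adjProd {N : Γ.Node} (x : V) (hx : x ∈ S.piece N) : FreeGroup (S.Gen N) :=
  ((dartsAt Γ x).attach.map fun d =>
    FreeGroup.of (S.headGen d.1 (S.src_mem_of_dartsAt hx d.2))).prod

/-- The commutator `[a, b] = a b a⁻¹ b⁻¹`. -/
def comm {A : Type*} [Group A] (a b : A) : A := a * b * a⁻¹ * b⁻¹

/-- The product of the commutators of the handles. -/
def handleProd (N : Γ.Node) : FreeGroup (S.Gen N) :=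
  (List.ofFn fun i : Fin (Γ.genus N.1) =>
    comm (FreeGroup.of (Gen.handleA (S := S) (N := N) i)) (FreeGroup.of (Gen.handleB i))).prod

open Classical in
/-- The plumbing presentation of the piece: the fibre of the node is central, adjacent fibres
commute, and `γ_x ^ (-euler x)` is the product of the adjacent fibres, multiplied by the
commutators of the handles when `x` is the node. -/
def rels (N : Γ.Node) : Set (FreeGroup (S.Gen N)) :=
  {r | ∃ y : S.Gen N, r = comm (FreeGroup.of (Gen.vert N.1 (S.node_mem N))) (FreeGroup.of y)} ∪
  {r | ∃ (d : D) (h : Γ.src d ∈ S.piece N),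
    r = comm (FreeGroup.of (Gen.vert (Γ.src d) h)) (FreeGroup.of (S.headGen d h))} ∪
  {r | ∃ (x : V) (hx : x ∈ S.piece N),
    r = (FreeGroup.of (Gen.vert x hx) ^ (-Γ.euler x))⁻¹ *
      ((if x = N.1 then S.handleProd N else 1) * S.adjProd x hx)}

/-- The vertex group `G(N)`: the fundamental group of the piece of `N`. -/
abbrev G (N : Γ.Node) : Type _ := PresentedGroup (S.rels N)

/-- The fibre of a vertex of the piece. -/
def γ {N : Γ.Node} (x : V) (hx : x ∈ S.piece N) : S.G N := PresentedGroup.of (Gen.vert x hx)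

/-- The fibre of the other end of `d` in the piece, possibly an arrowhead. -/
noncomputable def γHead {N : Γ.Node} (d : D) (h : Γ.src d ∈ S.piece N) : S.G N :=
  PresentedGroup.of (S.headGen d h)

theorem commute_γ {N : Γ.Node} (d : D) (h : Γ.src d ∈ S.piece N) :
    Commute (S.γ (Γ.src d) h) (S.γHead d h) := by
  have h1 := PresentedGroup.one_of_mem (rels := S.rels N)
    (x := comm (FreeGroup.of (Gen.vert (Γ.src d) h)) (FreeGroup.of (S.headGen d h)))
    (Or.inl (Or.inr ⟨d, h, rfl⟩))
  simp only [comm, map_mul, map_inv] at h1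
  exact mul_inv_eq_iff_eq_mul.mp (mul_inv_eq_one.mp h1)

/-- An oriented edge of the JSJ graph, from the node `N` to the node `N'`: an oriented cutting
edge whose two ends lie in the pieces of `N` and `N'`. -/
structure Edge (N N' : Γ.Node) where
  dart : D
  mem_cut : dart ∈ S.cut
  src_mem : Γ.src dart ∈ S.piece N
  tgt_mem : Γ.tgt dart ∈ S.piece N'

/-- The edge group, the fundamental group `ℤ ⊕ ℤ` of a JSJ torus; for the edge `d` its basis
consists of the fibres of the two ends of `d`. -/
abbrev EdgeGroup : Type := Multiplicative ℤ × Multiplicative ℤ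

variable {S} in
/-- The inverse edge. -/
def Edge.reverse {N N' : Γ.Node} (e : S.Edge N N') : S.Edge N' N where
  dart := Γ.rev e.dart
  mem_cut := S.rev_mem _ e.mem_cut
  src_mem := e.tgt_mem
  tgt_mem := by
    have h : Γ.tgt (Γ.rev e.dart) = Γ.src e.dart := by simp [tgt, Γ.rev_rev]
    rw [h]; exact e.src_mem

variable {S} in
/-- `φ⁻ : G(e) → G(N)`, sending the basis to the fibre of the vertex supporting the arrowhead and
the fibre of the arrowhead. -/
noncomputable def Edge.φMinus {N N' : Γ.Node} (e : S.Edge N N') : EdgeGroup →* S.G N :=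
  MonoidHom.noncommCoprod (zpowersHom _ (S.γ (Γ.src e.dart) e.src_mem))
    (zpowersHom _ (S.γHead e.dart e.src_mem))
    (fun _ _ => ((S.commute_γ e.dart e.src_mem).zpow_left _).zpow_right _)

variable {S} in
/-- `φ⁺ : G(e) → G(N')`; seen from the other side of the torus, vertex and arrowhead exchange
their roles. -/
noncomputable def Edge.φPlus {N N' : Γ.Node} (e : S.Edge N N') : EdgeGroup →* S.G N' :=
  e.reverse.φMinus.comp (MulEquiv.prodComm : EdgeGroup ≃* EdgeGroup).toMonoidHom

/-- Edge paths in the JSJ graph, as lists of oriented cutting edges. -/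
def IsEdgePath : Γ.Node → List D → Γ.Node → Prop
  | N, [], N' => N = N'
  | N, d :: l, N' => ∃ (M : Γ.Node) (e : S.Edge N M), e.dart = d ∧ IsEdgePath M l N'

/-- A maximal tree of the JSJ graph: a set of edges closed under inversion such that any two
nodes are joined by exactly one path without backtracking in it. -/
structure MaximalTree where
  edges : Set D
  subset : edges ⊆ S.cut
  rev_mem : ∀ d ∈ edges, Γ.rev d ∈ edges
  existsUnique_path : ∀ N N' : Γ.Node, ∃! l : List D,
    S.IsEdgePath N l N' ∧ (∀ d ∈ l, d ∈ edges) ∧ l.IsChain fun d d' => d' ≠ Γ.rev d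

/-- The free product of the vertex groups and the free group on the letters `t_e`. -/
abbrev PreGroup : Type _ :=
  Monoid.Coprod (Monoid.CoprodI fun N : Γ.Node => S.G N) (FreeGroup {d : D // d ∈ S.cut})

/-- A vertex group in the free product. -/
def inG (N : Γ.Node) : S.G N →* S.PreGroup := Monoid.Coprod.inl.comp Monoid.CoprodI.of

/-- The letter `t_e`. -/
def t (d : D) (hd : d ∈ S.cut) : S.PreGroup := Monoid.Coprod.inr (FreeGroup.of ⟨d, hd⟩)

variable {S} in
/-- Relations `t_e φ⁺(c) t_e⁻¹ = φ⁻(c)`, `t_ē = t_e⁻¹`, and `t_e = 1` for `e` in the tree. -/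
def MaximalTree.rels (T : S.MaximalTree) : Set S.PreGroup :=
  {r | ∃ (N N' : Γ.Node) (e : S.Edge N N') (c : EdgeGroup),
    r = S.t e.dart e.mem_cut * S.inG N' (e.φPlus c) * (S.t e.dart e.mem_cut)⁻¹ *
      (S.inG N (e.φMinus c))⁻¹} ∪
  {r | ∃ (d : D) (hd : d ∈ S.cut), r = S.t (Γ.rev d) (S.rev_mem d hd) * S.t d hd} ∪
  {r | ∃ (d : D) (hd : d ∈ T.edges), r = S.t d (T.subset hd)}

variable {S} in
/-- The fundamental group of the graph of groups, that is, the fundamental group of the link. -/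
abbrev MaximalTree.π₁ (T : S.MaximalTree) : Type _ := S.PreGroup ⧸ Subgroup.normalClosure T.rels

/-- A word of length zero: a node `v₀` and an element `μ₀` of `G(v₀)`. -/
abbrev Word₀ : Type _ := Σ N : Γ.Node, S.G N

/-- A word of length zero is (cyclically) reduced if its element is not trivial. -/
def IsCyclicallyReduced (w : S.Word₀) : Prop := w.2 ≠ 1

variable {S} in
/-- The element of the fundamental group defined by a word of length zero. -/
def MaximalTree.label (T : S.MaximalTree) (w : S.Word₀) : T.π₁ :=
  QuotientGroup.mk' (Subgroup.normalClosure T.rels) (S.inG w.1 w.2)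

/-- m-arc-generators: `γ_y ^ m` for a vertex or an arrowhead `y` of the piece, or
`γ_u ^ m * γ_y ^ n` for an edge `(u, y)` of its plumbing graph, with integral exponents. -/
def IsMArcGenerator (w : S.Word₀) : Prop :=
  (∃ (x : V) (hx : x ∈ S.piece w.1) (m : ℤ), w.2 = S.γ x hx ^ m) ∨
  (∃ (d : D) (h : Γ.src d ∈ S.piece w.1), d ∈ S.cut ∧ ∃ m : ℤ, w.2 = S.γHead d h ^ m) ∨
  (∃ (d : D) (h : Γ.src d ∈ S.piece w.1) (m n : ℤ),
    w.2 = S.γ (Γ.src d) h ^ m * S.γHead d h ^ n)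

/-- Types of m-arc-generators of a piece: a boundary torus, or a chain without arrow, the latter
given by its end vertex. -/
inductive MType (N : Γ.Node)
  | torus (d : D) (hd : d ∈ S.cut) (h : Γ.src d ∈ S.piece N)
  | leg (x : V) (hx : x ∈ S.piece N) (hn : ¬ Γ.IsNode x) (h1 : Γ.valency x = 1)

variable {S} in
/-- The subgroup of the elements of a given type: the group of the boundary torus, or the powers
of the fibre of the end vertex. -/
noncomputable def MType.subgroup {N : Γ.Node} : S.MType N → Subgroup (S.G N)
  | .torus d _ h => Subgroup.closure {S.γ (Γ.src d) h, S.γHead d h}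
  | .leg x hx _ _ => Subgroup.zpowers (S.γ x hx)

variable {S} in
/-- `μ`, of type `τ`, is pure: it is not equal to an m-arc-generator of another type. -/
def IsPure {N : Γ.Node} (μ : S.G N) (τ : S.MType N) : Prop :=
  μ ∈ τ.subgroup ∧ ∀ τ' : S.MType N, μ ∈ τ'.subgroup → τ' = τ

variable {S} in
/-- The type of `G(e)⁻` in `G(N)`. -/
def Edge.typeMinus {N N' : Γ.Node} (e : S.Edge N N') : S.MType N :=
  .torus e.dart e.mem_cut e.src_mem

variable {S} in
/-- The type of `G(e)⁺` in `G(N')`. -/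
def Edge.typePlus {N N' : Γ.Node} (e : S.Edge N N') : S.MType N' := e.reverse.typeMinus

/-- The two words are related by `μ₀' = φ_e(μ₀)` for an edge `e = e_{τ₀}`, and at least one of them
is pure. -/
def OneStep (w w' : S.Word₀) : Prop :=
  ∃ (e : S.Edge w.1 w'.1) (c : EdgeGroup), e.φMinus c = w.2 ∧ e.φPlus c = w'.2 ∧
    (IsPure w.2 e.typeMinus ∨ IsPure w'.2 e.typePlus)

/-- There are a path `(v₀, e₀, M, e₁, v₀')` without backtracking and `μ₁ ∈ G(M)` with
`μ₁ = φ_{e₀}(μ₀)` and `μ₀' = φ_{e₁}(μ₁)`, and both words are pure. -/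
def TwoStep (w w' : S.Word₀) : Prop :=
  ∃ (M : Γ.Node) (e₀ : S.Edge w.1 M) (e₁ : S.Edge M w'.1) (μ₁ : S.G M) (c₀ c₁ : EdgeGroup),
    e₁.dart ≠ Γ.rev e₀.dart ∧
    e₀.φMinus c₀ = w.2 ∧ e₀.φPlus c₀ = μ₁ ∧ e₁.φMinus c₁ = μ₁ ∧ e₁.φPlus c₁ = w'.2 ∧
    IsPure w.2 e₀.typeMinus ∧ IsPure w'.2 e₁.typePlus

/-- The word represents the arc-generator: `γ_x ^ m` in the piece of `x`, or
`γ_u ^ m * γ_y ^ n` in the piece of the source `u` of the edge. For a cutting edge `y` is an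
arrowhead, and reading the edge backwards gives the word on the other side of the torus. -/
def Represents (w : S.Word₀) : ArcGen V D → Prop
  | .vertex x m => ∃ hx : x ∈ S.piece w.1, w.2 = S.γ x hx ^ (m : ℕ)
  | .edge d m n => ∃ h : Γ.src d ∈ S.piece w.1,
      w.2 = S.γ (Γ.src d) h ^ (m : ℕ) * S.γHead d h ^ (n : ℕ)

/-- The arc-generator of one and the same cutting edge, seen from the two sides of the torus. -/
def OppositeSides (A A' : ArcGen V D) : Prop :=
  ∃ d ∈ S.cut, ∃ m n, A = .edge d m n ∧ A' = .edge (Γ.rev d) n m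

end Groups

end JSJCut

end PlumbingGraph

/-!
Conjugacy of arc-generators in the fundamental group of a graph manifold.

A piece is Seifert fibred with fibre `h`, the fibre of its node, and every chain at the node carries
a subgroup generated by `h` and the second fibre `y` of the chain: the group of a boundary torus for
a chain which is cut, and a cyclic group, in which `y ^ α = h ^ ω`, for a chain without arrow. The
exponents of the other fibres of a chain, as products of powers of `y` and `h`, obey the recursion of
continued fractions (`JSJCut.Out`), and as interior vertices have Euler number at most `-2`
(`euler_le`) they satisfy the inequalities `Out.bounds` and `Out.later`.

*Conjugacy in a piece* (`chain_conj`). A piece has an arrowhead, so its relation at the node can be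
solved for one generator, and homomorphisms to other groups are easy to construct. Representations in
`PSL₂(ℝ)` with hyperbolic or parabolic boundary, in the Heisenberg group for positive genus, and in
`ℚ` show that conjugate elements of the chain subgroups are equal, and are powers of `h` if they
belong to different chains. The only exception is the boundary torus of the twisted interval bundle
over the Klein bottle, where `y ^ a * h ^ b` is conjugate to `y ^ (-a) * h ^ b'`, with `b'`
computed from the Euler number.

*Conjugacy in the fundamental group* (`ellConj_of_isConj_label`). Elements of vertex groups which
are conjugate in the fundamental group of a graph of groups are related by a sequence of conjugations
in vertex groups and of edge isomorphisms. In place of normal forms, the proof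
constructs a permutation representation which separates the classes of this relation: a set with an
action of each vertex group, such that the sets at the two ends of an edge are isomorphic over the
edge group (`exists_equivariant_equiv`, `exists_fixed_of_isConj_label`).

*m-arc-generators* (`eq_or_oneStep_or_twoStep`). Without exceptional pieces, the conjugations in the
vertex groups are trivial. A sequence that crosses two different tori passes through a power of the
fibre between them. As the fibres on the two sides of a torus are independent
(`Edge.eq_one_of_mem_zpowers`), at most two tori are crossed, and the elements at the ends are pure.

*Arc-generators* (`Represents.eq_or_oppositeSides`). An arc-generator in a boundary torus has
nonnegative exponent of `y` in its piece, and positive exponent on the other side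
(`Represents.torus_coordinates`). Hence it cannot be a power of the fibre on the other side, and a
sequence never leaves the torus first crossed. In the exceptional pieces, crossing this torus back and
forth with a conjugation on each side makes the exponents grow (`TorusState.exponent`), so that the
sequence does not return to an arc-generator. Finally, arc-generators on one chain to a torus are
determined by their two exponents (`ArcData.sameArc_of_torus`), and those on chains without arrow are
positive powers of the fibre of the end vertex.
-/

set_option linter.unusedSectionVars false

/-! ### Chains in the pieces -/

namespace PlumbingGraph

section Combinatorics

variable {V D : Type*} {Γ : PlumbingGraph V D}

theorem src_rev (d : D) : Γ.src (Γ.rev d) = Γ.tgt d := rfl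

theorem tgt_rev (d : D) : Γ.tgt (Γ.rev d) = Γ.src d := by simp [tgt, Γ.rev_rev]

theorem rev_injective : Function.Injective Γ.rev := fun a b h => by
  rw [← Γ.rev_rev a, h, Γ.rev_rev]

/-- A vertex which is not a node has at most two edges. -/
theorem eq_of_not_isNode [Finite D] {x : V} (hx : ¬ Γ.IsNode x) {a b c : D} (ha : Γ.src a = x)
    (hb : Γ.src b = x) (hc : Γ.src c = x) (hab : b ≠ a) (hac : c ≠ a) : b = c := by
  classical
  by_contra hbc
  apply hx
  right
  have h3 : ({a, b, c} : Set D).ncard = 3 := by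
    rw [Set.ncard_eq_toFinset_card']
    simp [Finset.card_insert_of_notMem, Ne.symm hab, Ne.symm hac, hbc]
  rw [← h3]
  apply Set.ncard_le_ncard _ (Set.toFinite _)
  rintro d (rfl | rfl | rfl) <;> simpa

theorem valency_eq_one_iff [Finite D] {d : D} :
    Γ.valency (Γ.tgt d) = 1 ↔ ∀ d', Γ.src d' = Γ.tgt d → d' = Γ.rev d := by
  unfold valency
  rw [Set.ncard_eq_one]
  constructor
  · rintro ⟨a, ha⟩ d' hd'
    have h1 : d' ∈ ({a} : Set D) := ha ▸ hd'
    have h2 : Γ.rev d ∈ ({a} : Set D) := ha ▸ (src_rev d)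
    rw [Set.mem_singleton_iff] at h1 h2
    rw [h1, h2]
  · intro h
    refine ⟨Γ.rev d, Set.ext fun d' => ⟨fun hd => h d' hd, ?_⟩⟩
    rintro rfl
    exact src_rev d

namespace JSJCut

variable (S : Γ.JSJCut)

theorem rev_mem_cut_iff {d : D} : Γ.rev d ∈ S.cut ↔ d ∈ S.cut :=
  ⟨fun h => by simpa [Γ.rev_rev] using S.rev_mem _ h, S.rev_mem d⟩

/-- `d'` continues `d` within a piece. -/
def PieceStep (d d' : D) : Prop := d ∉ S.cut ∧ Γ.Step d d'

/-- `S.Out N d₀ d P P' Q Q'`: the oriented edge `d` points away from the node `N` in its piece, on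
the chain starting with the oriented edge `d₀` at `N`. The integers record the exponents which
express the fibres of the two ends of `d` by the fibre `h` of `N` and the fibre `y` of the second
vertex of the chain: they are `y ^ P * h ^ (-Q)` and `y ^ P' * h ^ (-Q')`. -/
inductive Out (N : Γ.Node) (d₀ : D) : D → ℤ → ℤ → ℤ → ℤ → Prop
  | start : Γ.src d₀ = N.1 → Out N d₀ d₀ 0 1 (-1) 0
  | step {d d' : D} {P P' Q Q' : ℤ} : Out N d₀ d P P' Q Q' → S.PieceStep d d' →
      Out N d₀ d' P' (-Γ.euler (Γ.tgt d) * P' - P) Q' (-Γ.euler (Γ.tgt d) * Q' - Q)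

variable {S}

theorem PieceStep.right_unique [Finite D] {d a b : D} (ha : S.PieceStep d a)
    (hb : S.PieceStep d b) : a = b :=
  eq_of_not_isNode ha.2.1 (src_rev d) ha.2.2.1 hb.2.2.1 ha.2.2.2 hb.2.2.2

theorem PieceStep.left_unique [Finite D] {d a b : D} (ha : S.PieceStep a d)
    (hb : S.PieceStep b d) : a = b := by
  have hab : Γ.tgt b = Γ.tgt a := by rw [← ha.2.2.1, ← hb.2.2.1]
  exact rev_injective (eq_of_not_isNode ha.2.1 ha.2.2.1 (src_rev a) ((src_rev b).trans hab)
    ha.2.2.2.symm hb.2.2.2.symm)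

namespace Out

variable {N N' : Γ.Node} {d₀ d₀' d d' : D} {P P' Q Q' R R' W W' : ℤ}

theorem src_eq (h : S.Out N d₀ d P P' Q Q') : Γ.src d₀ = N.1 := by
  induction h with
  | start h => exact h
  | step _ _ ih => exact ih

theorem src_mem (h : S.Out N d₀ d P P' Q Q') : Γ.src d ∈ S.piece N := by
  induction h with
  | start h => rw [h]; exact S.node_mem N
  | step _ hs ih => rw [hs.2.2.1]; exact S.tgt_mem hs.1 ih

theorem det (h : S.Out N d₀ d P P' Q Q') : P * Q' - P' * Q = 1 := by
  induction h with
  | start h => norm_num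
  | step _ hs ih => linear_combination ih

theorem reflTransGen (h : S.Out N d₀ d P P' Q Q') :
    Relation.ReflTransGen S.PieceStep d₀ d := by
  induction h with
  | start h => exact .refl
  | step _ hs ih => exact ih.tail hs

/-- Without a cut, a chain leaving a node does not reach a node again: otherwise it would be a
maximal chain with node ends which is not cut. -/
theorem not_isNode_tgt (h : S.Out N d₀ d P P' Q Q') (hd : d ∉ S.cut) :
    ¬ Γ.IsNode (Γ.tgt d) := by
  intro hn
  have key : ∃ l : List D, l ≠ [] ∧ l.IsChain Γ.Step ∧ (∀ c ∈ l.head?, Γ.IsNode (Γ.src c)) ∧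
      (l.getLast? = some d) ∧ ∀ c ∈ l, c ∉ S.cut := by
    clear hn
    induction h with
    | start h =>
      refine ⟨[d₀], by simp, by simp, ?_, by simp, by simpa⟩
      simp only [List.head?_cons, Option.mem_def, Option.some.injEq, forall_eq']
      rw [h]; exact N.2
    | @step d d' _ _ _ _ h' hs ih =>
      obtain ⟨l, h1, h2, h3, h4, h5⟩ := ih hs.1
      refine ⟨l ++ [d'], by simp, ?_, ?_, by simp, ?_⟩
      · rw [List.isChain_append]
        refine ⟨h2, by simp, ?_⟩
        intro a ha b hb
        rw [h4] at ha
        simp only [Option.mem_def, Option.some.injEq, List.head?_cons] at ha hb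
        subst ha hb
        exact hs.2
      · rw [List.head?_append_of_ne_nil _ h1]; exact h3
      · intro c hc
        rcases List.mem_append.1 hc with hc | hc
        · exact h5 c hc
        · rw [List.mem_singleton.1 hc]; exact hd
  obtain ⟨l, h1, h2, h3, h4, h5⟩ := key
  obtain ⟨c, ⟨hc, hc'⟩, -⟩ := S.existsUnique_mem l ⟨h1, h2, h3, by
    rw [h4]; simpa using hn⟩
  exact h5 c hc hc'

theorem eq_start (h : S.Out N d₀ d P P' Q Q') (hd : Γ.IsNode (Γ.src d)) :
    d = d₀ ∧ P = 0 ∧ P' = 1 ∧ Q = -1 ∧ Q' = 0 := by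
  cases h with
  | start h => simp
  | step _ hs => exact absurd (hs.2.2.1 ▸ hd) hs.2.1

theorem unique [Finite D] (h : S.Out N d₀ d P P' Q Q') (h' : S.Out N' d₀' d R R' W W') :
    N = N' ∧ d₀ = d₀' ∧ P = R ∧ P' = R' ∧ Q = W ∧ Q' = W' := by
  induction h generalizing R R' W W' with
  | start h =>
    obtain ⟨h1, h2, h3, h4, h5⟩ := h'.eq_start (by rw [h]; exact N.2)
    subst h1
    exact ⟨Subtype.ext (h.symm.trans h'.src_eq), rfl, h2.symm, h3.symm, h4.symm, h5.symm⟩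
  | @step a b _ _ _ _ h1 hs ih =>
    cases h' with
    | start h2 => exact absurd (by rw [← hs.2.2.1, h2]; exact N'.2) hs.2.1
    | step h2 hs' =>
      obtain rfl := hs.left_unique hs'
      obtain ⟨rfl, rfl, rfl, rfl, rfl, rfl⟩ := ih h2
      simp

/-- The two orientations of an edge that is not cut do not both point away from a node. -/
theorem not_out_rev [Finite D] (h : S.Out N d₀ d P P' Q Q') (hd : d ∉ S.cut) :
    ¬ S.Out N' d₀' (Γ.rev d) R R' W W' := by
  induction h generalizing R R' W W' with
  | start h =>
    intro h'
    apply h'.not_isNode_tgt (mt S.rev_mem_cut_iff.1 hd)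
    rw [tgt_rev, h]; exact N.2
  | @step a b _ _ _ _ h1 hs ih =>
    intro h'
    refine ih hs.1 (h'.step (d' := Γ.rev a) ⟨mt S.rev_mem_cut_iff.1 hd, ?_, ?_, ?_⟩)
    · rw [tgt_rev, hs.2.2.1]; exact hs.2.1
    · rw [src_rev, tgt_rev, hs.2.2.1]
    · rw [Γ.rev_rev]; exact hs.2.2.2.symm

theorem eq_of_tgt_eq [Finite D] (h : S.Out N d₀ d P P' Q Q') (hd : d ∉ S.cut)
    (h' : S.Out N' d₀' d' R R' W W') (hd' : d' ∉ S.cut) (ht : Γ.tgt d = Γ.tgt d') : d = d' := by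
  by_contra hne
  refine h'.not_out_rev hd' (h.step (d' := Γ.rev d') ⟨hd, h.not_isNode_tgt hd, ?_, ?_⟩)
  · rw [src_rev, ht]
  · exact fun e => hne (rev_injective e).symm

end Out

variable {N N' : Γ.Node} {d₀ d₀' d d' : D} {P P' Q Q' R R' W W' : ℤ}

theorem mem_piece [Finite D] {x : V} (hx : x ∈ S.piece N) :
    x = N.1 ∨ ∃ d₀ d P P' Q Q', S.Out N d₀ d P P' Q Q' ∧ d ∉ S.cut ∧ Γ.tgt d = x := by
  induction hx with
  | refl => exact Or.inl rfl
  | @tail a b _ hab ih =>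
    obtain ⟨d, hd, rfl, rfl⟩ := hab
    rcases ih with h | ⟨d₀, d₁, P, P', Q, Q', h, hd₁, h1⟩
    · exact Or.inr ⟨_, _, _, _, _, _, .start h, hd, rfl⟩
    · by_cases hr : d = Γ.rev d₁
      · subst hr
        rw [tgt_rev]
        cases h with
        | start h => exact Or.inl h
        | step h hs => exact Or.inr ⟨_, _, _, _, _, _, h, hs.1, hs.2.2.1.symm⟩
      · exact Or.inr ⟨_, _, _, _, _, _, h.step ⟨hd₁, h.not_isNode_tgt hd₁, h1.symm, hr⟩, hd, rfl⟩

/-- The edges of a piece point away from its node in exactly one of their orientations; an edge to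
an arrowhead does so when it points to the arrowhead. -/
theorem out_or_out_rev [Finite D] (h : Γ.src d ∈ S.piece N) :
    (∃ d₀ P P' Q Q', S.Out N d₀ d P P' Q Q') ∨
      (d ∉ S.cut ∧ ∃ d₀ P P' Q Q', S.Out N d₀ (Γ.rev d) P P' Q Q') := by
  rcases mem_piece h with h | ⟨d₀, d₁, P, P', Q, Q', h, hd₁, h1⟩
  · exact Or.inl ⟨_, _, _, _, _, .start h⟩
  · by_cases hr : d = Γ.rev d₁
    · subst hr
      refine Or.inr ⟨mt S.rev_mem_cut_iff.1 hd₁, d₀, P, P', Q, Q', ?_⟩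
      rwa [Γ.rev_rev]
    · exact Or.inl ⟨_, _, _, _, _, h.step ⟨hd₁, h.not_isNode_tgt hd₁, h1.symm, hr⟩⟩

theorem exists_out_of_mem_cut [Finite D] (h : Γ.src d ∈ S.piece N) (hd : d ∈ S.cut) :
    ∃ d₀ P P' Q Q', S.Out N d₀ d P P' Q Q' :=
  (out_or_out_rev h).resolve_right fun h => h.1 hd

theorem eq_of_mem_piece [Finite D] {x : V} (h : x ∈ S.piece N) (h' : x ∈ S.piece N') :
    N = N' := by
  rcases mem_piece h with h1 | ⟨_, _, _, _, _, _, h1, hd, ht⟩ <;>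
  rcases mem_piece h' with h2 | ⟨_, _, _, _, _, _, h2, hd', ht'⟩
  · exact Subtype.ext (h1.symm.trans h2)
  · exact absurd (by rw [ht', h1]; exact N.2) (h2.not_isNode_tgt hd')
  · exact absurd (by rw [ht, h2]; exact N'.2) (h1.not_isNode_tgt hd)
  · obtain rfl := h1.eq_of_tgt_eq hd h2 hd' (ht.trans ht'.symm)
    exact (h1.unique h2).1

/-- A chain leaving a node ends in a cut edge or in a vertex of valency one. -/
theorem exists_terminal [Finite D] (hd₀ : Γ.src d₀ = N.1) :
    ∃ d P P' Q Q', S.Out N d₀ d P P' Q Q' ∧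
      (d ∈ S.cut ∨ d ∉ S.cut ∧ Γ.valency (Γ.tgt d) = 1) := by
  classical
  by_contra hcon
  push Not at hcon
  have hex : ∀ d, (∃ P P' Q Q', S.Out N d₀ d P P' Q Q') → ∃ d', S.PieceStep d d' := by
    rintro d ⟨P, P', Q, Q', h⟩
    obtain ⟨h1, h2⟩ := hcon d P P' Q Q' h
    have h3 := h2 h1
    rw [Ne, valency_eq_one_iff] at h3
    push Not at h3
    obtain ⟨d', h4, h5⟩ := h3
    exact ⟨d', h1, h.not_isNode_tgt h1, h4, h5⟩
  let R := {d : D // ∃ P P' Q Q', S.Out N d₀ d P P' Q Q'}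
  choose f hf using hex
  have hfo : ∀ d : R, ∃ P P' Q Q', S.Out N d₀ (f d.1 d.2) P P' Q Q' := fun d => by
    obtain ⟨P, P', Q, Q', h⟩ := d.2
    exact ⟨_, _, _, _, h.step (hf d.1 d.2)⟩
  let F : R → R := fun d => ⟨f d.1 d.2, hfo d⟩
  have hinj : Function.Injective F := fun a b hab => by
    have := congrArg Subtype.val hab
    exact Subtype.ext ((hf a.1 a.2).left_unique (by
      have h2 := hf b.1 b.2
      rwa [← show f a.1 a.2 = f b.1 b.2 from this] at h2))
  obtain ⟨c, hc⟩ := Finite.surjective_of_injective hinj ⟨d₀, _, _, _, _, .start hd₀⟩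
  have h1 := hf c.1 c.2
  rw [show f c.1 c.2 = d₀ from congrArg Subtype.val hc] at h1
  apply h1.2.1
  rw [← h1.2.2.1, hd₀]
  exact N.2

/-- On one chain, two oriented edges pointing away from the node are comparable. -/
theorem Out.total [Finite D] (h : S.Out N d₀ d P P' Q Q') (h' : S.Out N' d₀ d' R R' W W') :
    Relation.ReflTransGen S.PieceStep d d' ∨ Relation.ReflTransGen S.PieceStep d' d :=
  Relation.ReflTransGen.total_of_right_unique (fun _ _ _ => PieceStep.right_unique)
    h.reflTransGen h'.reflTransGen

/-- `d` has no continuation in its piece: it is cut or ends in a vertex of valency one. -/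
def IsTerminal (S : Γ.JSJCut) (d : D) : Prop := d ∈ S.cut ∨ d ∉ S.cut ∧ Γ.valency (Γ.tgt d) = 1

theorem IsTerminal.not_pieceStep [Finite D] (h : S.IsTerminal d) : ¬ S.PieceStep d d' := by
  rintro ⟨h1, h2, h3, h4⟩
  rcases h with h | ⟨-, h⟩
  · exact h1 h
  · exact h4 (valency_eq_one_iff.1 h _ h3)

theorem IsTerminal.eq_of_reflTransGen [Finite D] (h : S.IsTerminal d)
    (h' : Relation.ReflTransGen S.PieceStep d d') : d' = d := by
  rcases Relation.ReflTransGen.cases_head h' with h1 | ⟨c, h1, -⟩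
  · exact h1.symm
  · exact absurd h1 h.not_pieceStep

theorem Out.reflTransGen_terminal [Finite D] (h : S.Out N d₀ d P P' Q Q')
    (h' : S.Out N' d₀ d' R R' W W') (ht : S.IsTerminal d') :
    Relation.ReflTransGen S.PieceStep d d' := by
  rcases h.total h' with h1 | h1
  · exact h1
  · rw [ht.eq_of_reflTransGen h1]

theorem Out.terminal_unique [Finite D] (h : S.Out N d₀ d P P' Q Q')
    (h' : S.Out N' d₀ d' R R' W W') (hd : S.IsTerminal d) (ht : S.IsTerminal d') : d = d' :=
  (hd.eq_of_reflTransGen (h.reflTransGen_terminal h' ht)).symm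

/-- Every piece has an arrowhead. -/
theorem exists_cut [Finite D] (hconn : Γ.IsConnected) (hchain : ∃ l, Γ.IsNodeChain l)
    (N : Γ.Node) : ∃ d ∈ S.cut, Γ.src d ∈ S.piece N := by
  by_contra hcon
  push Not at hcon
  obtain ⟨l, hl⟩ := hchain
  obtain ⟨d, ⟨-, hd⟩, -⟩ := S.existsUnique_mem l hl
  refine hcon d hd ?_
  generalize Γ.src d = x
  have h := hconn N.1 x
  induction h with
  | refl => exact S.node_mem N
  | tail _ hs ih =>
    obtain ⟨c, rfl, rfl⟩ := hs
    exact S.tgt_mem (fun hc => hcon c hc ih) ih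

/-- The case of Euler number `-1` is excluded by minimality. -/
theorem euler_le [Fintype V] [Finite D] (hneg : (-Γ.intersectionMatrix).PosDef)
    (hmin : Γ.IsMinimal) {v : V} (hv : ¬ Γ.IsNode v) : Γ.euler v ≤ -2 := by
  classical
  have h1 := hneg.diag_pos (i := v)
  simp only [intersectionMatrix, Matrix.neg_apply, Matrix.of_apply, if_true] at h1
  have h2 : (Γ.euler v : ℝ) < 0 := by
    have : (0 : ℝ) ≤ (Set.ncard {d : D | Γ.src d = v ∧ Γ.tgt d = v} : ℝ) := Nat.cast_nonneg _
    linarith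
  have h3 : Γ.euler v < 0 := by exact_mod_cast h2
  unfold IsNode at hv
  push Not at hv
  have := hmin v (by omega) (by omega)
  omega

/-- The exponents grow along a chain, since its interior vertices have Euler number at most `-2`. -/
theorem Out.bounds (hE : ∀ v, ¬ Γ.IsNode v → Γ.euler v ≤ -2) (h : S.Out N d₀ d P P' Q Q') :
    0 ≤ P ∧ P < P' ∧ 1 ≤ P - Q ∧ P - Q ≤ P' - Q' := by
  induction h with
  | start h => norm_num
  | step _ hs ih =>
    have := hE _ hs.2.1
    refine ⟨?_, ?_, ?_, ?_⟩ <;> nlinarith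

theorem Out.eq_start_of_nonpos (hE : ∀ v, ¬ Γ.IsNode v → Γ.euler v ≤ -2)
    (h : S.Out N d₀ d P P' Q Q') (hP : P ≤ 0) : d = d₀ ∧ P = 0 ∧ P' = 1 ∧ Q = -1 ∧ Q' = 0 := by
  cases h with
  | start h => simp
  | step h hs => have := h.bounds hE; omega

/-- Along a chain, the determinants of the exponents at one edge with those at a later edge are
positive and increasing. -/
theorem Out.later (hE : ∀ v, ¬ Γ.IsNode v → Γ.euler v ≤ -2)
    (h : S.Out N d₀ d P P' Q Q') (h' : Relation.ReflTransGen S.PieceStep d d') :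
    ∃ R R' W W', S.Out N d₀ d' R R' W W' ∧
      ((d' = d ∧ R = P ∧ R' = P' ∧ W = Q ∧ W' = Q') ∨
        (1 ≤ W * P - R * Q ∧ W * P - R * Q < W' * P - R' * Q ∧
          0 ≤ W * P' - R * Q' ∧ W * P' - R * Q' < W' * P' - R' * Q')) := by
  induction h' with
  | refl => exact ⟨_, _, _, _, h, Or.inl ⟨rfl, rfl, rfl, rfl, rfl⟩⟩
  | tail _ hs ih =>
    obtain ⟨R, R', W, W', h1, h2⟩ := ih
    refine ⟨_, _, _, _, h1.step hs, Or.inr ?_⟩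
    have hb := hE _ hs.2.1
    have hdet := h.det
    rcases h2 with ⟨rfl, rfl, rfl, rfl, rfl⟩ | ⟨h3, h4, h5, h6⟩
    · refine ⟨?_, ?_, ?_, ?_⟩ <;> nlinarith
    · refine ⟨?_, ?_, ?_, ?_⟩ <;> nlinarith

end JSJCut

end Combinatorics

end PlumbingGraph

/-! ### The fibres, and homomorphisms from the group of a piece -/

namespace PlumbingGraph

namespace JSJCut

variable {V D : Type*} [Fintype D] [LinearOrder D] {Γ : PlumbingGraph V D} (S : Γ.JSJCut)

open Classical in
/-- The fibre of `x` in the group of the piece of `N`, with value `1` if `x` is not in the piece. -/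
noncomputable def fib (N : Γ.Node) (x : V) : S.G N :=
  if hx : x ∈ S.piece N then S.γ x hx else 1

open Classical in
/-- The fibre of the other end of `d` in the group of the piece of `N`, with value `1` if `d` does
not start in the piece. -/
noncomputable def head (N : Γ.Node) (d : D) : S.G N :=
  if h : Γ.src d ∈ S.piece N then S.γHead d h else 1

variable {S} {N N' : Γ.Node}

theorem fib_eq {x : V} (hx : x ∈ S.piece N) : S.fib N x = S.γ x hx := dif_pos hx

theorem head_eq {d : D} (h : Γ.src d ∈ S.piece N) : S.head N d = S.γHead d h := dif_pos h

theorem head_eq_fib {d : D} (h : Γ.src d ∈ S.piece N) (hd : d ∉ S.cut) :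
    S.head N d = S.fib N (Γ.tgt d) := by
  rw [head_eq h, fib_eq (S.tgt_mem hd h), γHead, headGen, dif_neg hd, γ]

theorem mem_dartsAt {x : V} {d : D} : d ∈ dartsAt Γ x ↔ Γ.src d = x := by simp [dartsAt]

theorem nodup_dartsAt (x : V) : (dartsAt Γ x).Nodup := Finset.sort_nodup _ _

theorem comm_eq_one_iff {A : Type*} [Group A] {a b : A} : comm a b = 1 ↔ Commute a b := by
  rw [comm, mul_inv_eq_one, mul_inv_eq_iff_eq_mul]
  exact Iff.rfl

theorem map_comm {A B : Type*} [Group A] [Group B] (F : A →* B) (a b : A) :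
    F (comm a b) = comm (F a) (F b) := by simp [comm]

theorem map_adjProd {P : Type*} [Group P] (F : FreeGroup (S.Gen N) →* P) {x : V}
    (hx : x ∈ S.piece N) (v : D → P)
    (hv : ∀ (d : D) (h : Γ.src d ∈ S.piece N), Γ.src d = x →
      F (FreeGroup.of (S.headGen d h)) = v d) :
    F (S.adjProd x hx) = ((dartsAt Γ x).map v).prod := by
  rw [adjProd, map_list_prod, List.map_map, ← List.attach_map_val (l := dartsAt Γ x) (f := v)]
  congr 1
  refine List.map_congr_left fun d _ => ?_
  exact hv d.1 _ (mem_dartsAt.1 d.2)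

theorem map_handleProd {P : Type*} [Group P] (F : FreeGroup (S.Gen N) →* P) :
    F (S.handleProd N) = (List.ofFn fun i =>
      comm (F (FreeGroup.of (Gen.handleA i))) (F (FreeGroup.of (Gen.handleB i)))).prod := by
  rw [handleProd, map_list_prod, List.map_ofFn]
  congr 2
  funext i
  exact map_comm F _ _

/-- The fibre of the node is central in the group of its piece. -/
theorem commute_fib (g : S.G N) : Commute (S.fib N N.1) g := by
  rw [fib_eq (S.node_mem N)]
  have hg : g ∈ Subgroup.closure (Set.range (PresentedGroup.of (rels := S.rels N))) := by
    rw [PresentedGroup.closure_range_of]; trivial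
  induction hg using Subgroup.closure_induction with
  | mem x hx =>
    obtain ⟨y, rfl⟩ := hx
    have h1 := PresentedGroup.one_of_mem (rels := S.rels N)
      (x := comm (FreeGroup.of (Gen.vert N.1 (S.node_mem N))) (FreeGroup.of y))
      (Or.inl (Or.inl ⟨y, rfl⟩))
    rw [map_comm, comm_eq_one_iff] at h1
    exact h1
  | one => exact Commute.one_right _
  | mul x y _ _ hx hy => exact hx.mul_right hy
  | inv x _ hx => exact hx.inv_right

theorem relation_of_ne {x : V} (hx : x ∈ S.piece N) (hN : x ≠ N.1) :
    S.fib N x ^ (-Γ.euler x) = ((dartsAt Γ x).map (S.head N)).prod := by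
  have h1 := PresentedGroup.one_of_mem (rels := S.rels N) (Or.inr ⟨x, hx, rfl⟩)
  rw [if_neg hN, one_mul, map_mul, map_inv, map_zpow, inv_mul_eq_one] at h1
  rw [fib_eq hx]
  refine h1.trans (map_adjProd _ hx _ fun d h _ => (head_eq h).symm)

theorem relation_node :
    ∃ a b : Fin (Γ.genus N.1) → S.G N, S.fib N N.1 ^ (-Γ.euler N.1) =
      (List.ofFn fun i => comm (a i) (b i)).prod *
        ((dartsAt Γ N.1).map (S.head N)).prod := by
  have h1 := PresentedGroup.one_of_mem (rels := S.rels N) (Or.inr ⟨N.1, S.node_mem N, rfl⟩)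
  rw [if_pos rfl, map_mul, map_inv, map_zpow, inv_mul_eq_one, map_mul, map_handleProd] at h1
  refine ⟨fun i => PresentedGroup.mk _ (FreeGroup.of (Gen.handleA i)),
    fun i => PresentedGroup.mk _ (FreeGroup.of (Gen.handleB i)), ?_⟩
  rw [fib_eq (S.node_mem N)]
  refine h1.trans ?_
  rw [map_adjProd _ _ (S.head N) fun d h _ => (head_eq h).symm]

theorem dartsAt_terminal {d : D} (hd : Γ.valency (Γ.tgt d) = 1) :
    dartsAt Γ (Γ.tgt d) = [Γ.rev d] := by
  rw [valency_eq_one_iff] at hd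
  apply List.perm_singleton.1
  rw [List.perm_ext_iff_of_nodup (nodup_dartsAt _) (by simp)]
  intro c
  rw [mem_dartsAt, List.mem_singleton]
  exact ⟨hd c, fun h => h ▸ src_rev d⟩

theorem dartsAt_step {d d' : D} (hd : S.PieceStep d d') :
    (dartsAt Γ (Γ.tgt d)).Perm [Γ.rev d, d'] := by
  rw [List.perm_ext_iff_of_nodup (nodup_dartsAt _) (by simpa using hd.2.2.2.symm)]
  intro c
  simp only [mem_dartsAt, List.mem_cons, List.not_mem_nil, or_false]
  constructor
  · intro hc
    by_contra! hne
    exact hne.2 (eq_of_not_isNode hd.2.1 (src_rev d) hc hd.2.2.1 hne.1 hd.2.2.2)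
  · rintro (rfl | rfl)
    exacts [src_rev d, hd.2.2.1]

theorem prod_dartsAt_step {d d' : D} (hd : S.PieceStep d d') {P : Type*} [Group P] (v : D → P)
    (hv : Commute (v (Γ.rev d)) (v d')) :
    ((dartsAt Γ (Γ.tgt d)).map v).prod = v (Γ.rev d) * v d' := by
  have h := (dartsAt_step hd).map v
  rw [← List.prod_pair]
  refine (h.symm.prod_eq' ?_).symm
  simpa using hv

namespace Out

variable {d₀ d d' : D} {P P' Q Q' : ℤ}

/-- The fibres along a chain are products of powers of those of the first two vertices. -/
theorem fib_src (h : S.Out N d₀ d P P' Q Q') :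
    S.fib N (Γ.src d) = S.head N d₀ ^ P * S.fib N N.1 ^ (-Q) ∧
      S.head N d = S.head N d₀ ^ P' * S.fib N N.1 ^ (-Q') := by
  induction h with
  | start h => simp [h]
  | @step d d' P P' Q Q' h hs ih =>
    have hc : ∀ z : S.G N, ∀ k l : ℤ, Commute (S.fib N N.1 ^ k) (z ^ l) :=
      fun z k l => ((commute_fib z).zpow_left k).zpow_right l
    have ht := S.tgt_mem hs.1 h.src_mem
    have h1 := head_eq_fib h.src_mem hs.1
    have hne : Γ.tgt d ≠ N.1 := fun e => hs.2.1 (e ▸ N.2)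
    have h2 := relation_of_ne ht hne
    have hrev : S.head N (Γ.rev d) = S.fib N (Γ.src d) := by
      rw [head_eq_fib (by rwa [src_rev]) (mt S.rev_mem_cut_iff.1 hs.1), tgt_rev]
    have hcomm : Commute (S.fib N (Γ.src d)) (S.fib N (Γ.tgt d)) := by
      rw [← h1, head_eq h.src_mem, fib_eq h.src_mem]
      exact S.commute_γ d h.src_mem
    have hcomm' : Commute (S.fib N (Γ.tgt d)) (S.head N d') := by
      have hm : Γ.src d' ∈ S.piece N := by rw [hs.2.2.1]; exact ht
      rw [← hs.2.2.1, fib_eq hm, head_eq hm]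
      exact S.commute_γ d' hm
    have h3 : S.head N d' = S.fib N (Γ.tgt d) ^ (-Γ.euler (Γ.tgt d)) * (S.fib N (Γ.src d))⁻¹ := by
      rcases (List.perm_pair.1 (dartsAt_step hs)) with hp | hp
      all_goals
        rw [hp] at h2
        simp only [List.map_cons, List.map_nil, List.prod_cons, List.prod_nil, mul_one,
          hrev] at h2
      · rw [((hcomm.zpow_right _).inv_left).symm.eq, h2, inv_mul_cancel_left]
      · rw [h2, mul_inv_cancel_right]
    refine ⟨by rw [hs.2.2.1, ← h1, ih.2], ?_⟩
    rw [h3, ← h1, ih.2, ih.1, (hc _ _ _).symm.mul_zpow, mul_inv_rev, ← zpow_mul, ← zpow_mul,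
      ← zpow_neg, ← zpow_neg, zpow_sub, mul_assoc, ← mul_assoc (S.fib N N.1 ^ _)
      (S.fib N N.1 ^ _), ← zpow_add, (hc _ _ _).eq, ← mul_assoc, ← zpow_add, ← zpow_neg, ← zpow_add]
    congr 2 <;> ring

end Out

/-- Homomorphisms from the group of a piece, given on the fibre of the node, the fibres adjacent to
it and the handles. The fibres of the other vertices of the chains are then determined by the
relations of the interior vertices; there remain the relation of the node and, for each chain without
arrow, the relation of its end vertex. -/
theorem exists_hom {P : Type*} [Group P] (N : Γ.Node) (H : P) (f : D → P)
    (a b : Fin (Γ.genus N.1) → P) (hf : ∀ d, Γ.src d = N.1 → Commute H (f d))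
    (ha : ∀ i, Commute H (a i)) (hb : ∀ i, Commute H (b i))
    (hmain : H ^ (-Γ.euler N.1) =
      (List.ofFn fun i => comm (a i) (b i)).prod * ((dartsAt Γ N.1).map f).prod)
    (hleg : ∀ d₀ d P P' Q Q', S.Out N d₀ d P P' Q Q' → d ∉ S.cut → Γ.valency (Γ.tgt d) = 1 →
      f d₀ ^ (-Γ.euler (Γ.tgt d) * P' - P) = H ^ (-Γ.euler (Γ.tgt d) * Q' - Q)) :
    ∃ F : S.G N →* P, F (S.fib N N.1) = H ∧ ∀ d, Γ.src d = N.1 → F (S.head N d) = f d := by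
  classical
  have hc : ∀ d₀ d P P' Q Q', S.Out N d₀ d P P' Q Q' → ∀ k l : ℤ,
      Commute (H ^ k) (f d₀ ^ l) := fun d₀ d _ _ _ _ h k l =>
    ((hf _ h.src_eq).zpow_left k).zpow_right l
  -- `hv d` and `vv x` are the images of the fibre at the end of `d` and of the fibre of `x`
  obtain ⟨hv, hhv⟩ : ∃ hv : D → P, ∀ d₀ d P P' Q Q', S.Out N d₀ d P P' Q Q' →
      hv d = f d₀ ^ P' * H ^ (-Q') := by
    refine ⟨fun d => if h : ∃ z : D × ℤ × ℤ × ℤ × ℤ,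
      S.Out N z.1 d z.2.1 z.2.2.1 z.2.2.2.1 z.2.2.2.2 then
        f h.choose.1 ^ h.choose.2.2.1 * H ^ (-h.choose.2.2.2.2) else 1, ?_⟩
    intro d₀ d P P' Q Q' h
    have hex : ∃ z : D × ℤ × ℤ × ℤ × ℤ, S.Out N z.1 d z.2.1 z.2.2.1 z.2.2.2.1 z.2.2.2.2 :=
      ⟨(d₀, P, P', Q, Q'), h⟩
    simp only [dif_pos hex]
    obtain ⟨-, h1, -, h2, -, h3⟩ := hex.choose_spec.unique h
    rw [h1, h2, h3]
  obtain ⟨vv, hvN, hvv⟩ : ∃ vv : V → P, vv N.1 = H ∧ ∀ d₀ d P P' Q Q',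
      S.Out N d₀ d P P' Q Q' → d ∉ S.cut → vv (Γ.tgt d) = hv d := by
    refine ⟨fun x => if x = N.1 then H else if h : ∃ d, (∃ d₀ P P' Q Q',
      S.Out N d₀ d P P' Q Q') ∧ d ∉ S.cut ∧ Γ.tgt d = x then hv h.choose else 1, by simp, ?_⟩
    intro d₀ d P P' Q Q' h hd
    have hne : Γ.tgt d ≠ N.1 := fun e => h.not_isNode_tgt hd (e ▸ N.2)
    have hex : ∃ c, (∃ d₀ P P' Q Q', S.Out N d₀ c P P' Q Q') ∧ c ∉ S.cut ∧ Γ.tgt c = Γ.tgt d :=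
      ⟨d, ⟨_, _, _, _, _, h⟩, hd, rfl⟩
    simp only [if_neg hne, dif_pos hex]
    obtain ⟨⟨_, _, _, _, _, h1⟩, h2, h3⟩ := hex.choose_spec
    rw [h1.eq_of_tgt_eq h2 h hd h3]
  let φ : S.Gen N → P := fun y => match y with
    | .vert x _ => vv x
    | .arrow d _ _ => hv d
    | .handleA i => a i
    | .handleB i => b i
  have hhead : ∀ (d : D) (h : Γ.src d ∈ S.piece N) d₀ P P' Q Q', S.Out N d₀ d P P' Q Q' →
      φ (S.headGen d h) = hv d := by
    intro d h d₀ P P' Q Q' h1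
    by_cases hd : d ∈ S.cut
    · rw [headGen, dif_pos hd]
    · rw [headGen, dif_neg hd]
      exact hvv _ _ _ _ _ _ h1 hd
  have hsrc : ∀ d₀ d P P' Q Q', S.Out N d₀ d P P' Q Q' → vv (Γ.src d) = f d₀ ^ P * H ^ (-Q) := by
    intro d₀ d P P' Q Q' h
    cases h with
    | start h => simp [h, hvN]
    | step h hs => rw [hs.2.2.1, hvv _ _ _ _ _ _ h hs.1, hhv _ _ _ _ _ _ h]
  have hrev : ∀ (d : D) (h : Γ.src (Γ.rev d) ∈ S.piece N), d ∉ S.cut →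
      φ (S.headGen (Γ.rev d) h) = vv (Γ.src d) := by
    intro d h hd
    rw [headGen, dif_neg (mt S.rev_mem_cut_iff.1 hd)]
    show vv (Γ.tgt (Γ.rev d)) = _
    rw [tgt_rev]
  have hcv : ∀ d₀ d P P' Q Q', S.Out N d₀ d P P' Q Q' → Commute (vv (Γ.src d)) (hv d) := by
    intro d₀ d P P' Q Q' h
    rw [hsrc _ _ _ _ _ _ h, hhv _ _ _ _ _ _ h]
    have h1 := hc _ _ _ _ _ _ h
    refine Commute.mul_left (Commute.mul_right ?_ (h1 _ _).symm) (Commute.mul_right (h1 _ _) ?_)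
    · exact Commute.zpow_zpow_self _ _ _
    · exact Commute.zpow_zpow_self _ _ _
  have hHv : ∀ d₀ d P P' Q Q', S.Out N d₀ d P P' Q Q' → Commute H (hv d) := by
    intro d₀ d P P' Q Q' h
    rw [hhv _ _ _ _ _ _ h]
    exact ((hf _ h.src_eq).zpow_right _).mul_right ((Commute.refl H).zpow_right _)
  have hφ : ∀ r ∈ S.rels N, FreeGroup.lift φ r = 1 := by
    rintro r ((⟨y, rfl⟩ | ⟨d, h, rfl⟩) | ⟨x, hx, rfl⟩)
    · rw [map_comm, comm_eq_one_iff, FreeGroup.lift_apply_of, FreeGroup.lift_apply_of]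
      show Commute (vv N.1) _
      rw [hvN]
      rcases y with ⟨x, hx⟩ | ⟨d, hd, hx⟩ | i | i
      · rcases mem_piece hx with rfl | ⟨d₀, d, P, P', Q, Q', h, hd, rfl⟩
        · show Commute H (vv N.1)
          rw [hvN]
        · show Commute H (vv _)
          rw [hvv _ _ _ _ _ _ h hd]
          exact hHv _ _ _ _ _ _ h
      · obtain ⟨d₀, P, P', Q, Q', h⟩ := exists_out_of_mem_cut hx hd
        exact hHv _ _ _ _ _ _ h
      · exact ha i
      · exact hb i
    · rw [map_comm, comm_eq_one_iff, FreeGroup.lift_apply_of, FreeGroup.lift_apply_of]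
      show Commute (vv (Γ.src d)) _
      rcases out_or_out_rev h with ⟨d₀, P, P', Q, Q', h1⟩ | ⟨hd, d₀, P, P', Q, Q', h1⟩
      · rw [hhead d h _ _ _ _ _ h1]
        exact hcv _ _ _ _ _ _ h1
      · have h2 := hvv _ _ _ _ _ _ h1 (mt S.rev_mem_cut_iff.1 hd)
        rw [tgt_rev] at h2
        rw [h2, headGen, dif_neg hd]
        exact (hcv _ _ _ _ _ _ h1).symm
    · rw [map_mul, map_inv, map_zpow, inv_mul_eq_one, FreeGroup.lift_apply_of, map_mul]
      show vv x ^ _ = _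
      rcases mem_piece hx with rfl | ⟨d₀, d, P, P', Q, Q', h, hd, rfl⟩
      · rw [if_pos rfl, map_handleProd, hvN, hmain]
        congr 1
        · simp only [FreeGroup.lift_apply_of]; rfl
        · rw [map_adjProd _ _ f]
          intro d h1 h2
          rw [FreeGroup.lift_apply_of, hhead d h1 _ _ _ _ _ (.start h2),
            hhv _ _ _ _ _ _ (.start h2)]
          simp
      · have hne : Γ.tgt d ≠ N.1 := fun e => h.not_isNode_tgt hd (e ▸ N.2)
        rw [if_neg hne, map_one, one_mul, hvv _ _ _ _ _ _ h hd]
        by_cases hval : Γ.valency (Γ.tgt d) = 1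
        · rw [map_adjProd _ _ fun _ => vv (Γ.src d), dartsAt_terminal hval, hhv _ _ _ _ _ _ h,
            hsrc _ _ _ _ _ _ h]
          · have h1 := hleg _ _ _ _ _ _ h hd hval
            have h2 := hc _ _ _ _ _ _ h
            simp only [List.map_cons, List.map_nil, List.prod_cons, List.prod_nil, mul_one]
            rw [(h2 _ _).symm.mul_zpow, ← zpow_mul, ← zpow_mul,
              show P' * -Γ.euler (Γ.tgt d) = P + (-Γ.euler (Γ.tgt d) * P' - P) by ring, zpow_add,
              h1, mul_assoc, ← zpow_add]
            congr 2
            ring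
          · intro c h1 h2
            rw [valency_eq_one_iff] at hval
            obtain rfl := hval c h2
            rw [FreeGroup.lift_apply_of, hrev d h1 hd]
        · obtain ⟨d', hs⟩ : ∃ d', S.PieceStep d d' := by
            rw [valency_eq_one_iff] at hval
            push Not at hval
            obtain ⟨d', h4, h5⟩ := hval
            exact ⟨d', hd, h.not_isNode_tgt hd, h4, h5⟩
          have h2 := hc _ _ _ _ _ _ h
          rw [map_adjProd _ _ fun c => if c = Γ.rev d then vv (Γ.src d) else hv d',
            prod_dartsAt_step hs, if_pos rfl, if_neg hs.2.2.2, hhv _ _ _ _ _ _ (h.step hs),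
            hhv _ _ _ _ _ _ h, hsrc _ _ _ _ _ _ h]
          · rw [(h2 _ _).symm.mul_zpow, ← zpow_mul, ← zpow_mul, mul_assoc,
              ← mul_assoc (H ^ (-Q)), (h2 _ _).eq, mul_assoc, ← mul_assoc, ← zpow_add, ← zpow_add]
            congr 2 <;> ring
          · rw [if_pos rfl, if_neg hs.2.2.2, hhv _ _ _ _ _ _ (h.step hs), hsrc _ _ _ _ _ _ h]
            refine Commute.mul_left (Commute.mul_right ?_ (h2 _ _).symm)
              (Commute.mul_right (h2 _ _) ?_)
            · exact Commute.zpow_zpow_self _ _ _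
            · exact Commute.zpow_zpow_self _ _ _
          · intro c h1 h3
            rw [FreeGroup.lift_apply_of]
            split_ifs with hcr
            · subst hcr
              exact hrev d h1 hd
            · have := eq_of_not_isNode hs.2.1 (src_rev d) h3 hs.2.2.1 hcr hs.2.2.2
              subst this
              exact hhead _ h1 _ _ _ _ _ (h.step hs)
  refine ⟨PresentedGroup.toGroup hφ, ?_, ?_⟩
  · rw [fib_eq (S.node_mem N), γ, PresentedGroup.toGroup.of]
    exact hvN
  · intro d hd
    have hm : Γ.src d ∈ S.piece N := by rw [hd]; exact S.node_mem N
    rw [head_eq hm, γHead, PresentedGroup.toGroup.of, hhead d hm _ _ _ _ _ (.start hd),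
      hhv _ _ _ _ _ _ (.start hd)]
    simp

end JSJCut

end PlumbingGraph

/-! ### Test groups -/

section TestGroups

/-- The group `SL₂(ℝ)`. -/
abbrev SL2R : Type := Matrix.SpecialLinearGroup (Fin 2) ℝ

/-- The quotient of the group `SL₂(ℝ)` by its centre `±1`. -/
abbrev PSL2 : Type := SL2R ⧸ Subgroup.center (SL2R)

theorem mem_center_of_entries {M : SL2R} {r : ℝ}
    (h : (M : Matrix (Fin 2) (Fin 2) ℝ) = r • 1) : M ∈ Subgroup.center _ := by
  rw [Matrix.SpecialLinearGroup.mem_center_iff]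
  have hdet := M.det_coe
  rw [h] at hdet
  simp only [Matrix.det_smul, Matrix.det_one, mul_one] at hdet
  exact ⟨r, hdet, by rw [h]; simp [Matrix.smul_one_eq_diagonal]⟩

/-- A matrix of trace `2 * cos θ` rotates by `θ`: it has finite order modulo the centre if `θ` is a
rational multiple of `π`. -/
theorem pow_mem_center (M : SL2R) (θ : ℝ)
    (htr : M 0 0 + M 1 1 = 2 * Real.cos θ) (hs : Real.sin θ ≠ 0) (n : ℕ)
    (hn : Real.sin (n * θ) = 0) : M ^ n ∈ Subgroup.center _ := by
  have hdet : M 0 0 * M 1 1 - M 0 1 * M 1 0 = 1 := by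
    have := M.det_coe
    rwa [Matrix.det_fin_two] at this
  have key : ∀ k : ℕ, Real.sin θ • ((M ^ k : SL2R) :
      Matrix (Fin 2) (Fin 2) ℝ) = Real.sin (k * θ) • (M : Matrix (Fin 2) (Fin 2) ℝ) -
        Real.sin (k * θ - θ) • 1 := by
    intro k
    induction k with
    | zero => simp
    | succ k ih =>
      have e1 : Real.sin (((k + 1 : ℕ) : ℝ) * θ) =
          2 * Real.cos θ * Real.sin (k * θ) - Real.sin (k * θ - θ) := by
        push_cast
        rw [add_mul, one_mul, Real.sin_add, Real.sin_sub]
        ring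
      have e2 : ((k + 1 : ℕ) : ℝ) * θ - θ = k * θ := by push_cast; ring
      rw [e1, e2, pow_succ, Matrix.SpecialLinearGroup.coe_mul, ← Matrix.smul_mul, ih, ← htr]
      ext i j
      fin_cases i <;> fin_cases j <;> simp [Matrix.mul_apply]
      · linear_combination (-Real.sin (k * θ)) * hdet
      · ring
      · ring
      · linear_combination (-Real.sin (k * θ)) * hdet
  have h1 := key n
  rw [hn, zero_smul, zero_sub] at h1
  apply mem_center_of_entries (r := -(Real.sin (n * θ - θ) / Real.sin θ))
  rw [← (smul_right_injective _ hs).eq_iff]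
  simp only [h1, smul_smul, ← neg_smul]
  congr 1
  field_simp

/-- Conjugate elements of `PSL₂(ℝ)`, in terms of matrices. -/
theorem exists_of_isConj_psl2 {X Y : SL2R}
    (h : IsConj (X : PSL2) (Y : PSL2)) :
    ∃ (g : SL2R) (ε : ℝ), ε ^ 2 = 1 ∧
      (g * X : Matrix (Fin 2) (Fin 2) ℝ) = ε • (Y * g : Matrix (Fin 2) (Fin 2) ℝ) := by
  obtain ⟨c, hc⟩ := isConj_iff.1 h
  obtain ⟨g, rfl⟩ := QuotientGroup.mk_surjective c
  rw [mul_inv_eq_iff_eq_mul] at hc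
  have h1 : ((g * X : SL2R) : PSL2) = (Y * g : _) := hc
  rw [eq_comm, QuotientGroup.eq] at h1
  obtain ⟨ε, h2, h3⟩ := Matrix.SpecialLinearGroup.mem_center_iff.1 h1
  refine ⟨g, ε, by simpa using h2, ?_⟩
  have h4 : g * X = (Y * g) * ((Y * g)⁻¹ * (g * X)) := by group
  have h5 := congrArg (fun M : SL2R => (M : Matrix (Fin 2) (Fin 2) ℝ)) h4
  simp only [Matrix.SpecialLinearGroup.coe_mul] at h5
  rw [h5, ← Matrix.SpecialLinearGroup.coe_mul _ X, ← Matrix.SpecialLinearGroup.coe_mul _ (g * X), ← h3]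
  simp [Matrix.smul_eq_mul_diagonal]

/-- Conjugate elements of `PSL₂(ℝ)` have the same trace up to sign. -/
theorem trace_of_isConj_psl2 {X Y : SL2R}
    (h : IsConj (X : PSL2) (Y : PSL2)) : ∃ ε : ℝ, ε ^ 2 = 1 ∧
      X 0 0 + X 1 1 = ε * (Y 0 0 + Y 1 1) := by
  obtain ⟨g, ε, h1, h2⟩ := exists_of_isConj_psl2 h
  refine ⟨ε, h1, ?_⟩
  have h3 : (X : Matrix (Fin 2) (Fin 2) ℝ) = ε • ((g⁻¹ : SL2R) *
      (Y * g : Matrix (Fin 2) (Fin 2) ℝ)) := by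
    rw [← Matrix.mul_smul, ← h2, ← Matrix.mul_assoc, ← Matrix.SpecialLinearGroup.coe_mul,
      inv_mul_cancel, Matrix.SpecialLinearGroup.coe_one, Matrix.one_mul]
  have h4 := congrArg Matrix.trace h3
  rw [Matrix.trace_smul, Matrix.trace_mul_comm, Matrix.mul_assoc, ← Matrix.SpecialLinearGroup.coe_mul g,
    mul_inv_cancel, Matrix.SpecialLinearGroup.coe_one, Matrix.mul_one, Matrix.trace_fin_two,
    Matrix.trace_fin_two, smul_eq_mul] at h4
  exact h4

/-- The powers of an upper triangular matrix. -/
theorem zpow_upper {X : SL2R} (hX : X 1 0 = 0) (a : ℤ) :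
    (X ^ a) 1 0 = 0 ∧ (X ^ a) 0 0 = X 0 0 ^ a ∧ (X ^ a) 1 1 = X 1 1 ^ a := by
  have hdet : X 0 0 * X 1 1 = 1 := by
    have := X.det_coe
    rwa [Matrix.det_fin_two, hX, mul_zero, sub_zero] at this
  have h0 : X 0 0 ≠ 0 := left_ne_zero_of_mul_eq_one hdet
  have h1 : X 1 1 ≠ 0 := right_ne_zero_of_mul_eq_one hdet
  have hi : X⁻¹ 1 0 = 0 ∧ X⁻¹ 0 0 = (X 0 0)⁻¹ ∧ X⁻¹ 1 1 = (X 1 1)⁻¹ := by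
    rw [Matrix.SpecialLinearGroup.SL2_inv_expl]
    refine ⟨by simp [hX], ?_, ?_⟩
    · exact eq_inv_of_mul_eq_one_right hdet
    · exact eq_inv_of_mul_eq_one_left hdet
  induction a with
  | zero => simp
  | succ k ih =>
    obtain ⟨i1, i2, i3⟩ := ih
    rw [zpow_add_one, zpow_add_one₀ h0, zpow_add_one₀ h1]
    simp only [Matrix.SpecialLinearGroup.coe_mul, Matrix.mul_apply, Fin.sum_univ_two]
    rw [i1, i2, i3, hX]
    simp
  | pred k ih =>
    obtain ⟨i1, i2, i3⟩ := ih
    rw [zpow_sub_one, zpow_sub_one₀ h0, zpow_sub_one₀ h1]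
    simp only [Matrix.SpecialLinearGroup.coe_mul, Matrix.mul_apply, Fin.sum_univ_two]
    rw [i1, i2, i3, hi.1, hi.2.1, hi.2.2]
    simp

theorem two_zpow_add_eq {a b : ℤ} {ε : ℝ} (hε : ε ^ 2 = 1)
    (h : (2 : ℝ)⁻¹ ^ a + 2 ^ a = ε * (2⁻¹ ^ b + 2 ^ b)) : a = b ∨ a = -b := by
  have ha : (0 : ℝ) < 2 ^ a := by positivity
  have hb : (0 : ℝ) < 2 ^ b := by positivity
  rw [inv_zpow, inv_zpow] at h
  have hε1 : ε = 1 := by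
    rcases mul_self_eq_one_iff.1 ((sq _).symm.trans hε) with h1 | h1
    · exact h1
    · exfalso
      have : (0 : ℝ) < (2 ^ a)⁻¹ := by positivity
      have : (0 : ℝ) < (2 ^ b)⁻¹ := by positivity
      rw [h1] at h
      linarith
  rw [hε1, one_mul] at h
  have h2 : ((2 : ℝ) ^ a - 2 ^ b) * (2 ^ a * 2 ^ b - 1) = 0 := by
    field_simp at h
    linear_combination h
  rcases mul_eq_zero.1 h2 with h3 | h3
  · left
    exact zpow_right_injective₀ (by norm_num) (by norm_num) (sub_eq_zero.1 h3)
  · right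
    have h4 : (2 : ℝ) ^ (a + b) = 2 ^ (0 : ℤ) := by
      rw [zpow_add₀ (by norm_num), zpow_zero]; linarith
    have := zpow_right_injective₀ (by norm_num) (by norm_num) h4
    omega

/-- An elliptic matrix of trace `c`. -/
def ellMat (c : ℝ) : SL2R := ⟨!![c, -1; 1, 0], by simp [Matrix.det_fin_two]⟩

/-- A matrix of trace `d`, whose product with `ellMat c` is upper triangular with diagonal entries
`s⁻¹` and `s`. -/
noncomputable def ellMat' (s : ℝ) (hs : s ≠ 0) (d : ℝ) : SL2R :=
  ⟨!![0, s; -s⁻¹, d], by simp [Matrix.det_fin_two, hs]⟩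

theorem ellMat_mul_ellMat' (c s : ℝ) (hs : s ≠ 0) (d : ℝ) :
    ((ellMat c * ellMat' s hs d : SL2R) : Matrix (Fin 2) (Fin 2) ℝ) =
      !![s⁻¹, c * s - d; 0, s] := by
  rw [Matrix.SpecialLinearGroup.coe_mul]
  simp [ellMat, ellMat', sub_eq_add_neg]

theorem ellMat_pow {n : ℕ} (hn : 2 ≤ n) :
    ((ellMat (2 * Real.cos (Real.pi / n)) : SL2R) : PSL2) ^ n = 1 := by
  rw [← QuotientGroup.mk_pow, QuotientGroup.eq_one_iff]
  have hn' : (2 : ℝ) ≤ n := by exact_mod_cast hn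
  apply pow_mem_center _ (Real.pi / n)
  · simp [ellMat]
  · apply ne_of_gt
    apply Real.sin_pos_of_pos_of_lt_pi (by positivity)
    rw [div_lt_iff₀ (by linarith)]
    nlinarith [Real.pi_pos]
  · rw [mul_div_cancel₀ _ (by linarith), Real.sin_pi]

theorem ellMat'_pow {n : ℕ} (hn : 2 ≤ n) (s : ℝ) (hs : s ≠ 0) :
    ((ellMat' s hs (-(2 * Real.cos (Real.pi / n))) : SL2R) : PSL2) ^ n =
      1 := by
  rw [← QuotientGroup.mk_pow, QuotientGroup.eq_one_iff]
  have hn' : (2 : ℝ) ≤ n := by exact_mod_cast hn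
  apply pow_mem_center _ (Real.pi - Real.pi / n)
  · simp [ellMat', Real.cos_pi_sub]
  · rw [Real.sin_pi_sub]
    apply ne_of_gt
    apply Real.sin_pos_of_pos_of_lt_pi (by positivity)
    rw [div_lt_iff₀ (by linarith)]
    nlinarith [Real.pi_pos]
  · rw [mul_sub, mul_div_cancel₀ _ (by linarith), Real.sin_sub_pi, Real.sin_nat_mul_pi, neg_zero]

/-- A test group for a product of two elements of finite order: the product is hyperbolic, and two
of its powers are conjugate only if their exponents agree up to sign. -/
theorem exists_hyperbolic {n m : ℕ} (hn : 2 ≤ n) (hm : 2 ≤ m) : ∃ u v : PSL2,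
    u ^ n = 1 ∧ v ^ m = 1 ∧ ∀ a b : ℤ, IsConj ((u * v) ^ a) ((u * v) ^ b) → a = b ∨ a = -b := by
  refine ⟨_, _, ellMat_pow hn, ellMat'_pow hm 2 (by norm_num), fun a b h => ?_⟩
  rw [← QuotientGroup.mk_mul, ← QuotientGroup.mk_zpow, ← QuotientGroup.mk_zpow] at h
  obtain ⟨ε, h1, h2⟩ := trace_of_isConj_psl2 h
  have hX := ellMat_mul_ellMat' (2 * Real.cos (Real.pi / n)) 2 (by norm_num)
    (-(2 * Real.cos (Real.pi / m)))
  generalize ellMat (2 * Real.cos (Real.pi / n)) * ellMat' 2 (by norm_num)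
    (-(2 * Real.cos (Real.pi / m))) = X at hX h2
  have h10 : X 1 0 = 0 := by rw [hX]; rfl
  have h00 : X 0 0 = 2⁻¹ := by rw [hX]; rfl
  have h11 : X 1 1 = 2 := by rw [hX]; rfl
  rw [(zpow_upper h10 a).2.1, (zpow_upper h10 a).2.2, (zpow_upper h10 b).2.1,
    (zpow_upper h10 b).2.2, h00, h11] at h2
  exact two_zpow_add_eq h1 h2

/-- The powers of a parabolic matrix. -/
theorem zpow_parabolic {N : Matrix (Fin 2) (Fin 2) ℝ} {x : SL2R}
    (hx : (x : Matrix (Fin 2) (Fin 2) ℝ) = 1 + N) (hN : N * N = 0) (a : ℤ) :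
    ((x ^ a : SL2R) : Matrix (Fin 2) (Fin 2) ℝ) = 1 + (a : ℝ) • N := by
  have hi : ((x⁻¹ : SL2R) : Matrix (Fin 2) (Fin 2) ℝ) = 1 - N := by
    have h1 : ((x⁻¹ : SL2R) : Matrix (Fin 2) (Fin 2) ℝ) * (1 + N) = 1 := by
      rw [← hx, ← Matrix.SpecialLinearGroup.coe_mul, inv_mul_cancel, Matrix.SpecialLinearGroup.coe_one]
    have h2 : (1 + N) * (1 - N) = 1 := by
      rw [Matrix.add_mul, Matrix.mul_sub, Matrix.mul_sub, hN]; simp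
    calc _ = ((x⁻¹ : SL2R) : Matrix (Fin 2) (Fin 2) ℝ) *
          ((1 + N) * (1 - N)) := by rw [h2, Matrix.mul_one]
      _ = _ := by rw [← Matrix.mul_assoc, h1, Matrix.one_mul]
  induction a with
  | zero => simp
  | succ k ih =>
    rw [zpow_add_one, Matrix.SpecialLinearGroup.coe_mul, ih, hx]
    simp only [Matrix.add_mul, Matrix.mul_add, Matrix.smul_mul, hN]
    push_cast
    simp [add_smul, add_assoc, add_comm]
  | pred k ih =>
    rw [zpow_sub_one, Matrix.SpecialLinearGroup.coe_mul, ih, hi]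
    simp only [Matrix.add_mul, Matrix.mul_sub, Matrix.smul_mul, hN]
    push_cast
    simp [add_smul, sub_eq_add_neg]
    abel

/-- A test group for the product of an element of finite order with an arbitrary one: no power of
the product is conjugate to a power of the second factor. -/
theorem exists_parabolic {n : ℕ} (hn : 2 ≤ n) : ∃ u v : PSL2,
    u ^ n = 1 ∧ ∀ a b : ℤ, IsConj ((u * v) ^ a) (v ^ b) → a = 0 := by
  refine ⟨_, (ellMat' 2 (by norm_num) 2 : SL2R), ellMat_pow hn,
    fun a b h => ?_⟩
  rw [← QuotientGroup.mk_mul, ← QuotientGroup.mk_zpow, ← QuotientGroup.mk_zpow] at h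
  obtain ⟨ε, h1, h2⟩ := trace_of_isConj_psl2 h
  have hX := ellMat_mul_ellMat' (2 * Real.cos (Real.pi / n)) 2 (by norm_num) 2
  generalize ellMat (2 * Real.cos (Real.pi / n)) * ellMat' 2 (by norm_num) 2 = X at hX h2
  have h10 : X 1 0 = 0 := by rw [hX]; rfl
  have h00 : X 0 0 = 2⁻¹ := by rw [hX]; rfl
  have h11 : X 1 1 = 2 := by rw [hX]; rfl
  have hB := zpow_parabolic (N := !![-1, 2; -2⁻¹, 1])
    (x := ellMat' 2 (by norm_num) 2) (by
      ext i j; fin_cases i <;> fin_cases j <;> simp [ellMat']; norm_num)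
    (by ext i j; fin_cases i <;> fin_cases j <;> simp) b
  rw [(zpow_upper h10 a).2.1, (zpow_upper h10 a).2.2, h00, h11, hB] at h2
  have h3 : (2 : ℝ)⁻¹ ^ a + 2 ^ a = ε * (2⁻¹ ^ (0 : ℤ) + 2 ^ (0 : ℤ)) := by
    rw [h2]; simp; left; ring
  have := two_zpow_add_eq h1 h3
  omega

/-- A parabolic element is not conjugate to its inverse in `PSL₂(ℝ)`. -/
theorem eq_zero_of_isConj_parabolic {X : SL2R} {t : ℝ} (ht : t ≠ 0)
    (hX : (X : Matrix (Fin 2) (Fin 2) ℝ) = !![1, t; 0, 1]) {a : ℤ}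
    (h : IsConj ((X : PSL2) ^ a) ((X : PSL2) ^ (-a))) : a = 0 := by
  rw [← QuotientGroup.mk_zpow, ← QuotientGroup.mk_zpow] at h
  by_contra ha
  have hP : ∀ b : ℤ, ((X ^ b : SL2R) : Matrix (Fin 2) (Fin 2) ℝ) =
      !![1, b * t; 0, 1] := by
    intro b
    rw [zpow_parabolic (N := !![0, t; 0, 0]) (x := X)
      (by rw [hX]; ext i j; fin_cases i <;> fin_cases j <;> simp)
      (by ext i j; fin_cases i <;> fin_cases j <;> simp) b]
    ext i j; fin_cases i <;> fin_cases j <;> simp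
  obtain ⟨ε, h1, h2⟩ := trace_of_isConj_psl2 h
  rw [hP, hP] at h2
  have hε : ε = 1 := by
    norm_num at h2
    linarith
  obtain ⟨g, ε', h3, h4⟩ := exists_of_isConj_psl2 h
  rw [hP, hP] at h4
  have hdet : g 0 0 * g 1 1 - g 0 1 * g 1 0 = 1 := by
    have := g.det_coe
    rwa [Matrix.det_fin_two] at this
  rw [Matrix.eta_fin_two (g : Matrix (Fin 2) (Fin 2) ℝ)] at h4
  have e00 := congrFun (congrFun h4 0) 0
  have e01 := congrFun (congrFun h4 0) 1
  have e10 := congrFun (congrFun h4 1) 0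
  have e11 := congrFun (congrFun h4 1) 1
  simp at e00 e01 e10 e11
  have hat : (a : ℝ) * t ≠ 0 := mul_ne_zero (by exact_mod_cast ha) ht
  have hc : g 1 0 = 0 := by
    rcases mul_self_eq_one_iff.1 ((sq _).symm.trans h3) with hε' | hε' <;> rw [hε'] at e00 e01 e10 e11
    · have : g 1 0 * (a * t) = 0 := by linarith
      exact (mul_eq_zero.1 this).resolve_right hat
    · linarith
  rw [hc] at e00 hdet
  have hd0 : g 0 0 ≠ 0 := by rintro h0; rw [h0] at hdet; norm_num at hdet
  have hε' : ε' = 1 := by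
    have : (ε' - 1) * g 0 0 = 0 := by linarith
    have := (mul_eq_zero.1 this).resolve_right hd0
    linarith
  rw [hε'] at e01
  have h5 : (g 0 0 + g 1 1) * (a * t) = 0 := by linarith
  have h6 := (mul_eq_zero.1 h5).resolve_right hat
  have h7 : g 1 1 = -g 0 0 := by linarith
  rw [h7] at hdet
  have := mul_self_nonneg (g 0 0)
  linarith

/-- A test group for a product of two elements of finite order, not both of order two: the powers
of the product are not conjugate to their inverses. -/
theorem exists_parabolic_product {n m : ℕ} (hn : 2 ≤ n) (hm : 2 ≤ m) (hnm : ¬ (n = 2 ∧ m = 2)) :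
    ∃ u v : PSL2, u ^ n = 1 ∧ v ^ m = 1 ∧
      ∀ a : ℤ, IsConj ((u * v) ^ a) ((u * v) ^ (-a)) → a = 0 := by
  refine ⟨_, _, ellMat_pow hn, ellMat'_pow hm 1 one_ne_zero, fun a h => ?_⟩
  rw [← QuotientGroup.mk_mul] at h
  have hX := ellMat_mul_ellMat' (2 * Real.cos (Real.pi / n)) 1 one_ne_zero
    (-(2 * Real.cos (Real.pi / m)))
  refine eq_zero_of_isConj_parabolic (t := 2 * Real.cos (Real.pi / n) * 1 -
    (-(2 * Real.cos (Real.pi / m)))) ?_ (by rw [hX]; norm_num) h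
  have hcos : ∀ k : ℕ, 2 ≤ k → 0 ≤ Real.cos (Real.pi / k) ∧
      (k ≠ 2 → 0 < Real.cos (Real.pi / k)) := by
    intro k hk
    have hk' : (2 : ℝ) ≤ k := by exact_mod_cast hk
    have h0 : 0 < Real.pi / k := by have := Real.pi_pos; positivity
    refine ⟨Real.cos_nonneg_of_mem_Icc ⟨by linarith [Real.pi_pos], ?_⟩, fun hk2 =>
      Real.cos_pos_of_mem_Ioo ⟨by linarith [Real.pi_pos], ?_⟩⟩
    · exact div_le_div_of_nonneg_left Real.pi_pos.le (by norm_num) hk'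
    · have : (2 : ℝ) < k := by exact_mod_cast (by omega : 2 < k)
      exact div_lt_div_of_pos_left Real.pi_pos (by norm_num) this
  have h1 := hcos n hn
  have h2 := hcos m hm
  by_cases h3 : n = 2
  · have := h2.2 fun h4 => hnm ⟨h3, h4⟩
    linarith [h1.1]
  · have := h1.2 h3
    linarith [h2.1]

/-- A test group for a product of three involutions: the powers of the product are not conjugate
to their inverses. -/
theorem exists_parabolic_involutions : ∃ u v w : PSL2, u ^ 2 = 1 ∧ v ^ 2 = 1 ∧ w ^ 2 = 1 ∧
    ∀ a : ℤ, IsConj ((u * v * w) ^ a) ((u * v * w) ^ (-a)) → a = 0 := by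
  have hsq : ∀ X : SL2R, X 0 0 + X 1 1 = 0 → (X : PSL2) ^ 2 = 1 := by
    intro X hX
    rw [← QuotientGroup.mk_pow, QuotientGroup.eq_one_iff]
    apply pow_mem_center _ (Real.pi / 2)
    · simp [hX]
    · simp
    · rw [Nat.cast_ofNat, mul_div_cancel₀ _ two_ne_zero, Real.sin_pi]
  -- three matrices of trace zero whose product is unipotent
  let X : SL2R := ⟨!![0, -1; 1, 0], by simp [Matrix.det_fin_two]⟩
  let Y : SL2R := ⟨!![1, 1; -2, -1], by norm_num [Matrix.det_fin_two]⟩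
  let Z : SL2R := ⟨!![1, 2; -1, -1], by norm_num [Matrix.det_fin_two]⟩
  refine ⟨X, Y, Z, hsq X (by simp [X]), hsq Y (by simp [Y]), hsq Z (by simp [Z]), fun a h => ?_⟩
  rw [← QuotientGroup.mk_mul, ← QuotientGroup.mk_mul] at h
  refine eq_zero_of_isConj_parabolic (t := 3) (by norm_num) ?_ h
  rw [Matrix.SpecialLinearGroup.coe_mul, Matrix.SpecialLinearGroup.coe_mul]
  simp only [X, Y, Z, Matrix.mul_fin_two]
  norm_num

/-- The Heisenberg group of integral upper unitriangular matrices of size three. -/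
@[ext] structure Heis where
  x : ℤ
  y : ℤ
  z : ℤ

namespace Heis

instance : Group Heis where
  mul a b := ⟨a.x + b.x, a.y + b.y, a.z + b.z + a.x * b.y⟩
  one := ⟨0, 0, 0⟩
  inv a := ⟨-a.x, -a.y, -a.z + a.x * a.y⟩
  mul_assoc a b c := Heis.ext (add_assoc _ _ _) (add_assoc _ _ _) (by
    show a.z + b.z + a.x * b.y + c.z + (a.x + b.x) * c.y =
      a.z + (b.z + c.z + b.x * c.y) + a.x * (b.y + c.y)
    ring)
  one_mul a := Heis.ext (zero_add _) (zero_add _) (by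
    show 0 + a.z + 0 * a.y = a.z
    ring)
  mul_one a := Heis.ext (add_zero _) (add_zero _) (by
    show a.z + 0 + a.x * 0 = a.z
    ring)
  inv_mul_cancel a := Heis.ext (neg_add_cancel _) (neg_add_cancel _) (by
    show -a.z + a.x * a.y + a.z + -a.x * a.y = 0
    ring)

theorem mul_def (a b : Heis) : a * b = ⟨a.x + b.x, a.y + b.y, a.z + b.z + a.x * b.y⟩ := rfl

theorem inv_def (a : Heis) : a⁻¹ = ⟨-a.x, -a.y, -a.z + a.x * a.y⟩ := rfl

theorem one_def : (1 : Heis) = ⟨0, 0, 0⟩ := rfl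

end Heis

/-- A test group for a commutator: its powers are pairwise not conjugate. -/
theorem exists_heisenberg : ∃ u v : Heis, ∀ a b : ℤ,
    IsConj ((u * v * u⁻¹ * v⁻¹) ^ a) ((u * v * u⁻¹ * v⁻¹) ^ b) → a = b := by
  refine ⟨⟨1, 0, 0⟩, ⟨0, 1, 0⟩, fun a b h => ?_⟩
  have hz : (⟨1, 0, 0⟩ * ⟨0, 1, 0⟩ * ⟨1, 0, 0⟩⁻¹ * ⟨0, 1, 0⟩⁻¹ : Heis) = ⟨0, 0, 1⟩ := by
    simp [Heis.mul_def, Heis.inv_def]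
  -- the commutator is central, so conjugate powers of it are equal
  have hp : ∀ k : ℤ, (⟨0, 0, 1⟩ : Heis) ^ k = ⟨0, 0, k⟩ := by
    intro k
    induction k with
    | zero => simp [Heis.one_def]
    | succ k ih => rw [zpow_add_one, ih]; simp [Heis.mul_def]
    | pred k ih => rw [zpow_sub_one, ih]; simp [Heis.mul_def, Heis.inv_def]; ring
  rw [hz, hp, hp] at h
  obtain ⟨c, hc⟩ := isConj_iff.1 h
  rw [mul_inv_eq_iff_eq_mul] at hc
  have := congrArg Heis.z hc
  simpa [Heis.mul_def, add_comm] using this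

end TestGroups

/-! ### Quotients of the group of a piece with an arrowhead -/

namespace PlumbingGraph

namespace JSJCut

variable {V D : Type*} {Γ : PlumbingGraph V D}

/-- The chain starting with the oriented edge `e` at the node `N` leads to a cut edge. -/
def IsTorusDart (S : Γ.JSJCut) (N : Γ.Node) (e : D) : Prop :=
  ∃ d P P' Q Q', S.Out N e d P P' Q Q' ∧ d ∈ S.cut

/-- The chain starting with the oriented edge `d₀` at the node `N` is a chain without arrow, with
end vertex `x`. With `y` the fibre of its second vertex and `h` the fibre of the node, the relation
at `x` is `y ^ α = h ^ ω`. -/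
def IsLegDart (S : Γ.JSJCut) (N : Γ.Node) (d₀ : D) (x : V) (α ω : ℤ) : Prop :=
  ∃ d P P' Q Q', S.Out N d₀ d P P' Q Q' ∧ d ∉ S.cut ∧ Γ.valency (Γ.tgt d) = 1 ∧ x = Γ.tgt d ∧
    α = -Γ.euler (Γ.tgt d) * P' - P ∧ ω = -Γ.euler (Γ.tgt d) * Q' - Q

variable {S : Γ.JSJCut} {N : Γ.Node} {d₀ d₀' e e' : D} {α ω : ℤ} {x : V}

theorem isTorusDart_or_isLegDart [Finite D] (h : Γ.src d₀ = N.1) :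
    S.IsTorusDart N d₀ ∨ ∃ x α ω, S.IsLegDart N d₀ x α ω := by
  obtain ⟨d, P, P', Q, Q', h1, h2 | h2⟩ := exists_terminal (S := S) h
  · exact Or.inl ⟨d, P, P', Q, Q', h1, h2⟩
  · exact Or.inr ⟨_, _, _, d, P, P', Q, Q', h1, h2.1, h2.2, rfl, rfl, rfl⟩

theorem IsTorusDart.src_eq (h : S.IsTorusDart N e) : Γ.src e = N.1 := by
  obtain ⟨_, _, _, _, _, h, -⟩ := h
  exact h.src_eq

theorem IsLegDart.src_eq (h : S.IsLegDart N e x α ω) : Γ.src e = N.1 := by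
  obtain ⟨_, _, _, _, _, h, -⟩ := h
  exact h.src_eq

theorem IsTorusDart.not_isLegDart [Finite D] (h : S.IsTorusDart N e) :
    ¬ S.IsLegDart N e x α ω := by
  rintro ⟨d', R, R', W, W', h1, h2, h3, -⟩
  obtain ⟨d, P, P', Q, Q', h, hd⟩ := h
  obtain rfl := h.terminal_unique h1 (Or.inl hd) (Or.inr ⟨h2, h3⟩)
  exact h2 hd

theorem IsLegDart.unique [Finite D] {x' : V} {α' ω' : ℤ} (h : S.IsLegDart N e x α ω)
    (h' : S.IsLegDart N e x' α' ω') : x = x' ∧ α = α' ∧ ω = ω' := by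
  obtain ⟨d, P, P', Q, Q', h, hd, hv, rfl, rfl, rfl⟩ := h
  obtain ⟨d', R, R', W, W', h', hd', hv', rfl, rfl, rfl⟩ := h'
  obtain rfl := h.terminal_unique h' (Or.inr ⟨hd, hv⟩) (Or.inr ⟨hd', hv'⟩)
  obtain ⟨-, -, rfl, rfl, rfl, rfl⟩ := h.unique h'
  exact ⟨rfl, rfl, rfl⟩

theorem IsLegDart.two_le (hE : ∀ v, ¬ Γ.IsNode v → Γ.euler v ≤ -2)
    (h : S.IsLegDart N e x α ω) : 2 ≤ α := by
  obtain ⟨d, P, P', Q, Q', h, hd, hv, rfl, rfl, rfl⟩ := h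
  have h1 := h.bounds hE
  have h2 := hE _ (h.not_isNode_tgt hd)
  nlinarith

theorem IsLegDart.of_eq_two (hE : ∀ v, ¬ Γ.IsNode v → Γ.euler v ≤ -2)
    (h : S.IsLegDart N e x 2 ω) : x = Γ.tgt e ∧ Γ.genus x = 0 ∧ Γ.valency x = 1 ∧
      Γ.euler x = -2 ∧ ω = 1 := by
  obtain ⟨d, P, P', Q, Q', h, hd, hv, rfl, h2, rfl⟩ := h
  have h1 := h.bounds hE
  have h3 := hE _ (h.not_isNode_tgt hd)
  have h4 := h.not_isNode_tgt hd
  have hP : P ≤ 0 := by nlinarith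
  obtain ⟨rfl, rfl, rfl, rfl, rfl⟩ := h.eq_start_of_nonpos hE hP
  unfold IsNode at h4
  push Not at h4
  exact ⟨rfl, by omega, hv, by omega, by omega⟩

theorem prod_map_one {P : Type*} [Group P] (L : List D) : (L.map (1 : D → P)).prod = 1 :=
  List.prod_eq_one fun p hp => by
    obtain ⟨d, -, rfl⟩ := List.mem_map.1 hp
    rfl

section Groups

variable [Fintype D] [LinearOrder D]

theorem IsTorusDart.of_mem_cut {d : D} (hd : d ∈ S.cut) (h : Γ.src d ∈ S.piece N) :
    ∃ e, S.IsTorusDart N e := by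
  obtain ⟨e, P, P', Q, Q', h⟩ := exists_out_of_mem_cut h hd
  exact ⟨e, d, P, P', Q, Q', h, hd⟩

/-- The fibre `g` of the end vertex of a chain without arrow generates the fibres of the chain. -/
theorem IsLegDart.fib_pow (h : S.IsLegDart N e x α ω) :
    S.fib N N.1 = S.fib N x ^ α ∧ S.head N e = S.fib N x ^ ω ∧
      ∃ k l : ℤ, S.fib N x = S.head N e ^ k * S.fib N N.1 ^ l := by
  obtain ⟨d, P, P', Q, Q', h, hd, hv, rfl, rfl, rfl⟩ := h
  have hc : ∀ k l : ℤ, Commute (S.fib N N.1 ^ k) (S.head N e ^ l) :=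
    fun k l => ((commute_fib _).zpow_left k).zpow_right l
  have ht := S.tgt_mem hd h.src_mem
  have hne : Γ.tgt d ≠ N.1 := fun e' => h.not_isNode_tgt hd (e' ▸ N.2)
  have h1 := relation_of_ne ht hne
  have h2 := h.fib_src
  have hg := head_eq_fib h.src_mem hd
  rw [dartsAt_terminal hv, List.map_singleton, List.prod_singleton,
    head_eq_fib (by rwa [src_rev]) (mt S.rev_mem_cut_iff.1 hd), tgt_rev, h2.1, ← hg, h2.2,
    (hc _ _).symm.mul_zpow, ← zpow_mul, ← zpow_mul] at h1
  rw [← hg, h2.2, (hc _ _).symm.mul_zpow, (hc _ _).symm.mul_zpow, ← zpow_mul, ← zpow_mul,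
    ← zpow_mul, ← zpow_mul]
  have hdet := h.det
  generalize -Γ.euler (Γ.tgt d) = b at *
  generalize S.head N e = y at *
  generalize S.fib N N.1 = z at *
  have h3 : y ^ (b * P' - P) = z ^ (b * Q' - Q) := by
    have h4 : y ^ (b * P' - P) = y ^ (P' * b) * (y ^ P)⁻¹ := by
      rw [← zpow_neg, ← zpow_add]; congr 1; ring
    rw [h4, eq_mul_inv_of_mul_eq h1, ← zpow_neg z, mul_assoc (y ^ P), ← zpow_add, ← (hc _ _).eq,
      mul_inv_cancel_right]
    congr 1; ring
  refine ⟨?_, ?_, P', -Q', rfl⟩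
  · rw [mul_comm P', zpow_mul, h3, ← zpow_mul, ← zpow_add]
    conv_lhs => rw [← zpow_one z]
    congr 1
    linear_combination -hdet
  · rw [show -Q' * (b * Q' - Q) = (b * Q' - Q) * (-Q') by ring, zpow_mul z, ← h3, ← zpow_mul,
      ← zpow_add]
    conv_lhs => rw [← zpow_one y]
    congr 1
    linear_combination -hdet

/-- A homomorphism from the group of a piece with an arrowhead can be prescribed on all chains at
the node but one leading to an arrowhead, since the relation of the node can be solved for the second
fibre of that chain. -/
theorem exists_hom_of_isTorusDart (he : S.IsTorusDart N e) {l₁ l₂ : List D}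
    (hl : dartsAt Γ N.1 = l₁ ++ e :: l₂) {P : Type*} [Group P] (H : P) (f : D → P)
    (a b : Fin (Γ.genus N.1) → P) (hf : ∀ d, Commute H (f d))
    (ha : ∀ i, Commute H (a i)) (hb : ∀ i, Commute H (b i))
    (hleg : ∀ d₀ x α ω, d₀ ≠ e → S.IsLegDart N d₀ x α ω → f d₀ ^ α = H ^ ω) :
    ∃ F : S.G N →* P, F (S.fib N N.1) = H ∧
      (∀ d, Γ.src d = N.1 → d ≠ e → F (S.head N d) = f d) ∧
      F (S.head N e) = H ^ (-Γ.euler N.1) * ((l₂.map f).prod *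
        (List.ofFn fun i => comm (a i) (b i)).prod * (l₁.map f).prod)⁻¹ := by
  classical
  have hnd := nodup_dartsAt (Γ := Γ) N.1
  rw [hl] at hnd
  have he₁ : ∀ d ∈ l₁, d ≠ e := by
    rintro d hd rfl
    exact (List.nodup_append.1 hnd).2.2 d hd d (by simp) rfl
  have he₂ : ∀ d ∈ l₂, d ≠ e := by
    rintro d hd rfl
    exact (List.nodup_cons.1 (List.nodup_append.1 hnd).2.1).1 hd
  set X := H ^ (-Γ.euler N.1) * ((l₂.map f).prod *
        (List.ofFn fun i => comm (a i) (b i)).prod * (l₁.map f).prod)⁻¹ with hX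
  have hlist : ∀ l : List D, Commute H (l.map f).prod := by
    intro l
    induction l with
    | nil => simp
    | cons d l ih => rw [List.map_cons, List.prod_cons]; exact (hf d).mul_right ih
  have hab : Commute H (List.ofFn fun i => comm (a i) (b i)).prod := by
    have : ∀ l : List P, (∀ p ∈ l, Commute H p) → Commute H l.prod := by
      intro l hl
      induction l with
      | nil => simp
      | cons d l ih =>
        rw [List.prod_cons]
        exact (hl d (by simp)).mul_right (ih fun p hp => hl p (by simp [hp]))
    apply this
    intro p hp
    obtain ⟨i, rfl⟩ := (List.mem_ofFn' _ _).1 hp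
    exact (((ha i).mul_right (hb i)).mul_right (ha i).inv_right).mul_right (hb i).inv_right
  have hHX : Commute H X := by
    refine Commute.mul_right ((Commute.refl H).zpow_right _) (Commute.inv_right ?_)
    exact ((hlist _).mul_right hab).mul_right (hlist _)
  obtain ⟨F, hF1, hF2⟩ := exists_hom (S := S) N H (Function.update f e X) a b (fun d _ => by
      by_cases hd : d = e
      · subst hd; simpa using hHX
      · simpa [hd] using hf d) ha hb (by
      have hm : ∀ l : List D, (∀ d ∈ l, d ≠ e) → l.map (Function.update f e X) = l.map f :=
        fun l h => List.map_congr_left fun d hd => Function.update_of_ne (h d hd) _ _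
      rw [hl, List.map_append, List.map_cons, Function.update_self, hm _ he₁, hm _ he₂,
        List.prod_append, List.prod_cons, hX]
      have hz := ((hlist l₁).zpow_left (-Γ.euler N.1))
      have hz' := (hab.zpow_left (-Γ.euler N.1))
      simp only [← mul_assoc]
      rw [mul_assoc _ (l₁.map f).prod, ← hz.eq, ← mul_assoc, ← hz'.eq]
      group) (by
      intro d₀ d P P' Q Q' h hd hv
      have hne : d₀ ≠ e := by
        rintro rfl
        exact he.not_isLegDart ⟨d, P, P', Q, Q', h, hd, hv, rfl, rfl, rfl⟩
      rw [Function.update_of_ne hne]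
      exact hleg _ _ _ _ hne ⟨d, P, P', Q, Q', h, hd, hv, rfl, rfl, rfl⟩)
  refine ⟨F, hF1, fun d hd hne => ?_, ?_⟩
  · rw [hF2 d hd, Function.update_of_ne hne]
  · rw [hF2 e he.src_eq, Function.update_self]

/-- The fibre of the node has infinite order in the abelianization of the group of a piece with an
arrowhead: a chain without arrow contributes `ω / α`, and the relation of the node is solved at the
arrowhead. -/
theorem exists_hom_rat (hE : ∀ v, ¬ Γ.IsNode v → Γ.euler v ≤ -2) (he : S.IsTorusDart N e) :
    ∃ ρ : S.G N →* Multiplicative ℚ, ρ (S.fib N N.1) = Multiplicative.ofAdd 1 := by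
  classical
  obtain ⟨l₁, l₂, hl⟩ := List.append_of_mem (mem_dartsAt.2 he.src_eq)
  let f : D → Multiplicative ℚ := fun d =>
    if h : ∃ z : V × ℤ × ℤ, S.IsLegDart N d z.1 z.2.1 z.2.2 then
      Multiplicative.ofAdd ((h.choose.2.2 : ℚ) / h.choose.2.1) else 1
  obtain ⟨F, hF, -⟩ := exists_hom_of_isTorusDart he hl (Multiplicative.ofAdd (1 : ℚ)) f 1 1
    (fun _ => Commute.all _ _) (fun _ => Commute.all _ _) (fun _ => Commute.all _ _) (by
      intro d₀ x α ω _ h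
      have hex : ∃ z : V × ℤ × ℤ, S.IsLegDart N d₀ z.1 z.2.1 z.2.2 := ⟨(x, α, ω), h⟩
      simp only [f, dif_pos hex]
      obtain ⟨-, h1, h2⟩ := hex.choose_spec.unique h
      rw [h1, h2, ← ofAdd_zsmul, ← ofAdd_zsmul]
      have : (α : ℚ) ≠ 0 := by
        have := h.two_le hE
        exact_mod_cast (by omega : α ≠ 0)
      congr 1
      simp only [zsmul_eq_mul, mul_one]
      field_simp)
  exact ⟨F, hF⟩

theorem eq_of_isConj_fib_zpow_mul (hE : ∀ v, ¬ Γ.IsNode v → Γ.euler v ≤ -2)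
    (he : S.IsTorusDart N e) {g : S.G N} {b b' : ℤ}
    (h : IsConj (g * S.fib N N.1 ^ b) (g * S.fib N N.1 ^ b')) : b = b' := by
  obtain ⟨ρ, hρ⟩ := exists_hom_rat hE he
  have h1 := isConj_iff_eq.1 (ρ.map_isConj h)
  rw [map_mul, map_mul, mul_right_inj, map_zpow, map_zpow, hρ, ← ofAdd_zsmul,
    ← ofAdd_zsmul] at h1
  have h2 := Multiplicative.ofAdd.injective h1
  simpa using h2

/-- If the genus is positive, a boundary curve can be mapped to the inverse of any commutator in the
Heisenberg group, with the fibre of the node and the other chains mapped to `1`. -/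
theorem exists_hom_heis (he : S.IsTorusDart N e) (hg : 0 < Γ.genus N.1) (u v : Heis) :
    ∃ F : S.G N →* Heis, F (S.fib N N.1) = 1 ∧
      (∀ d, Γ.src d = N.1 → d ≠ e → F (S.head N d) = 1) ∧
      F (S.head N e) = (u * v * u⁻¹ * v⁻¹)⁻¹ := by
  obtain ⟨l₁, l₂, hl⟩ := List.append_of_mem (mem_dartsAt.2 he.src_eq)
  have hab : ∀ n : ℕ, 0 < n → ∃ a b : Fin n → Heis,
      (List.ofFn fun i => comm (a i) (b i)).prod = comm u v := by
    intro n hn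
    obtain ⟨k, rfl⟩ := Nat.exists_eq_succ_of_ne_zero hn.ne'
    refine ⟨Fin.cons u 1, Fin.cons v 1, ?_⟩
    rw [List.ofFn_succ]
    simp [comm]
  obtain ⟨a, b, hab⟩ := hab _ hg
  obtain ⟨F, hF1, hF2, hF3⟩ := exists_hom_of_isTorusDart he hl (1 : Heis) 1 a b
    (fun _ => Commute.one_left _) (fun _ => Commute.one_left _) (fun _ => Commute.one_left _)
    (fun _ _ _ _ _ _ => by simp)
  refine ⟨F, hF1, hF2, ?_⟩
  rw [hF3, hab, prod_map_one, prod_map_one]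
  simp [comm]

/-- The list `L` consists of the edges at the node `N` except `e`, in cyclic order after `e`; and
homomorphisms from the group of the piece which are trivial on the fibre of the node and on the
handles can be prescribed on `L`, as the main relation then determines them on `e`. -/
def IsComplement (S : Γ.JSJCut) (N : Γ.Node) (e : D) (L : List D) : Prop :=
  L.Nodup ∧ (∀ d, d ∈ L ↔ Γ.src d = N.1 ∧ d ≠ e) ∧ L.length + 1 = Γ.valency N.1 ∧
    ∀ (P : Type) [Group P] (f : D → P),
      (∀ d₀ x α ω, S.IsLegDart N d₀ x α ω → f d₀ ^ α = 1) →
      ∃ F : S.G N →* P, F (S.fib N N.1) = 1 ∧ (∀ d ∈ L, F (S.head N d) = f d) ∧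
        F (S.head N e) = (L.map f).prod⁻¹

theorem IsTorusDart.exists_isComplement (he : S.IsTorusDart N e) :
    ∃ L, S.IsComplement N e L := by
  obtain ⟨l₁, l₂, hl⟩ := List.append_of_mem (mem_dartsAt.2 he.src_eq)
  have hnd := nodup_dartsAt (Γ := Γ) N.1
  rw [hl, List.nodup_middle] at hnd
  have hperm : (l₂ ++ l₁).Perm (l₁ ++ l₂) := List.perm_append_comm
  have hmem : ∀ d, d ∈ l₂ ++ l₁ ↔ Γ.src d = N.1 ∧ d ≠ e := by
    intro d
    rw [← mem_dartsAt, hl, hperm.mem_iff]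
    have := (List.nodup_cons.1 hnd).1
    constructor
    · intro hd
      refine ⟨?_, fun h => this (h ▸ hd)⟩
      rw [List.mem_append] at hd ⊢
      exact hd.imp_right (List.mem_cons_of_mem _)
    · rintro ⟨hd, hne⟩
      rw [List.mem_append] at hd ⊢
      exact hd.imp_right fun h => (List.mem_cons.1 h).resolve_left hne
  refine ⟨l₂ ++ l₁, hperm.nodup_iff.2 (List.nodup_cons.1 hnd).2, hmem, ?_, ?_⟩
  · classical
    have h1 : (dartsAt Γ N.1).length = Γ.valency N.1 := by
      rw [valency, dartsAt, Finset.length_sort, Set.ncard_eq_toFinset_card']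
      congr 1
      ext d
      simp
    rw [← h1, hl]
    simp only [List.length_append, List.length_cons]
    omega
  · intro P _ f hleg
    obtain ⟨F, hF1, hF2, hF3⟩ := exists_hom_of_isTorusDart he hl (1 : P) f 1 1
      (fun _ => Commute.one_left _) (fun _ => Commute.one_left _) (fun _ => Commute.one_left _)
      (fun d₀ x α ω _ h => by simpa using hleg d₀ x α ω h)
    refine ⟨F, hF1, fun d hd => hF2 d ((hmem d).1 hd).1 ((hmem d).1 hd).2, ?_⟩
    rw [hF3]
    simp [comm, List.map_append, List.prod_append]

/-- An order which may be prescribed for the image of the second fibre of a chain: the order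
modulo the fibre of the node for a chain without arrow, and `3`, say, otherwise. -/
theorem exists_order (hE : ∀ v, ¬ Γ.IsNode v → Γ.euler v ≤ -2) (d : D) : ∃ n : ℕ, 2 ≤ n ∧
    (∀ x α ω, S.IsLegDart N d x α ω → α = n) ∧ (n = 2 → ∃ x ω, S.IsLegDart N d x 2 ω) := by
  by_cases h : ∃ x α ω, S.IsLegDart N d x α ω
  · obtain ⟨x, α, ω, h⟩ := h
    have h2 := h.two_le hE
    refine ⟨α.toNat, by omega, fun x' α' ω' h' => ?_, fun hn => ⟨x, ω, ?_⟩⟩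
    · rw [(h'.unique h).2.1]; omega
    · rwa [show α = 2 by omega] at h
  · refine ⟨3, by norm_num, fun x α ω h' => absurd ⟨x, α, ω, h'⟩ h, by norm_num⟩

theorem map_update_of_notMem {P : Type*} [DecidableEq D] {f : D → P} {i : D} {u : P} {L : List D}
    (hi : i ∉ L) : L.map (Function.update f i u) = L.map f :=
  List.map_congr_left fun _ hd => Function.update_of_ne (by rintro rfl; exact hi hd) _ _

/-- A homomorphism supported on two edges at the node, except for the edge to be eliminated. -/
theorem IsComplement.exists_hom_pair {L : List D} (hL : S.IsComplement N e L) {P : Type} [Group P]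
    {i j : D} (hij : [i, j].Sublist L) {u v : P}
    (hu : ∀ x α ω, S.IsLegDart N i x α ω → u ^ α = 1)
    (hv : ∀ x α ω, S.IsLegDart N j x α ω → v ^ α = 1) :
    ∃ F : S.G N →* P, F (S.fib N N.1) = 1 ∧ F (S.head N i) = u ∧ F (S.head N j) = v ∧
      F (S.head N e) = (u * v)⁻¹ := by
  classical
  obtain ⟨h1, h2, h3, h4⟩ := hL
  have hne : i ≠ j := by
    have := hij.nodup h1
    simpa using this
  obtain ⟨F, hF1, hF2, hF3⟩ := h4 P (Function.update (Function.update 1 j v) i u) (by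
    intro d₀ x α ω h
    by_cases hi : d₀ = i
    · subst hi; simpa using hu x α ω h
    · rw [Function.update_of_ne hi]
      by_cases hj : d₀ = j
      · subst hj; simpa using hv x α ω h
      · simp [Function.update_of_ne hj])
  refine ⟨F, hF1, ?_, ?_, ?_⟩
  · rw [hF2 i (hij.subset (by simp)), Function.update_self]
  · rw [hF2 j (hij.subset (by simp)), Function.update_of_ne hne.symm, Function.update_self]
  · rw [hF3]
    congr 1
    have key : ∀ L : List D, L.Nodup → [i, j].Sublist L →
        (L.map (Function.update (Function.update 1 j v) i u)).prod = u * v := by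
      have key1 : ∀ L : List D, L.Nodup → j ∈ L →
          (L.map (Function.update (1 : D → P) j v)).prod = v := by
        intro L hL hj
        induction L with
        | nil => simp at hj
        | cons d L ih =>
          rw [List.map_cons, List.prod_cons]
          rw [List.nodup_cons] at hL
          by_cases hd : d = j
          · subst hd
            rw [map_update_of_notMem hL.1, prod_map_one]
            simp
          · rw [Function.update_of_ne hd, Pi.one_apply, one_mul,
              ih hL.2 ((List.mem_cons.1 hj).resolve_left (Ne.symm hd))]
      intro L hL hs
      induction L with
      | nil => simp at hs
      | cons d L ih =>
        rw [List.map_cons, List.prod_cons]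
        rw [List.nodup_cons] at hL
        by_cases hd : d = i
        · subst hd
          rw [map_update_of_notMem hL.1, Function.update_self,
            key1 L hL.2 (List.singleton_sublist.1 (List.cons_sublist_cons.1 hs))]
        · have hs' : [i, j].Sublist L := by
            cases hs with
            | cons _ h => exact h
            | cons_cons => exact absurd rfl hd
          have hdj : d ≠ j := by
            rintro rfl
            exact hL.1 (hs'.subset (by simp))
          rw [Function.update_of_ne hd, Function.update_of_ne hdj, Pi.one_apply, one_mul,
            ih hL.2 hs']
    exact key L h1 hij

end Groups

end JSJCut

end PlumbingGraph

/-! ### Conjugacy of elements of chains in the group of a piece -/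

namespace PlumbingGraph

namespace JSJCut

theorem pair_sublist_or {A : Type*} {a b : A} {L : List A} (ha : a ∈ L) (hb : b ∈ L)
    (hab : a ≠ b) : [a, b].Sublist L ∨ [b, a].Sublist L := by
  induction L with
  | nil => simp at ha
  | cons c L ih =>
    by_cases hac : a = c
    · subst hac
      left
      exact (List.singleton_sublist.2 ((List.mem_cons.1 hb).resolve_left (Ne.symm hab))).cons_cons a
    · by_cases hbc : b = c
      · subst hbc
        right
        exact (List.singleton_sublist.2 ((List.mem_cons.1 ha).resolve_left hab)).cons_cons b
      · exact (ih ((List.mem_cons.1 ha).resolve_left hac) ((List.mem_cons.1 hb).resolve_left hbc)).imp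
          (fun h => h.cons c) (fun h => h.cons c)

variable {V D : Type*} [Fintype D] [LinearOrder D] {Γ : PlumbingGraph V D} {S : Γ.JSJCut}
  {N : Γ.Node} {d₀ d₀' e e' : D} {α ω a a' b b' : ℤ} {x : V}

theorem map_mul_fib {P : Type*} [Group P] {F : S.G N →* P} (hF : F (S.fib N N.1) = 1) (g : S.G N)
    (a b : ℤ) : F (g ^ a * S.fib N N.1 ^ b) = F g ^ a := by
  rw [map_mul, map_zpow, map_zpow, hF, one_zpow, mul_one]

theorem isConj_map_mul_fib {P : Type*} [Group P] {F : S.G N →* P} (hF : F (S.fib N N.1) = 1)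
    {g g' : S.G N}
    (h : IsConj (g ^ a * S.fib N N.1 ^ b) (g' ^ a' * S.fib N N.1 ^ b')) :
    IsConj (F g ^ a) (F g' ^ a') := by
  have := F.map_isConj h
  rwa [map_mul_fib hF, map_mul_fib hF] at this

theorem three_le_valency (hg : Γ.genus N.1 = 0) : 3 ≤ Γ.valency N.1 := by
  rcases N.2 with h | h
  · omega
  · exact h

theorem zpow_eq_one_of_order {P : Type*} [Group P] {u : P} {n : ℕ} (hu : u ^ n = 1) {d : D}
    (hn : ∀ x α ω, S.IsLegDart N d x α ω → α = n) (x : V) (α ω : ℤ)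
    (h : S.IsLegDart N d x α ω) : u ^ α = 1 := by
  rw [hn x α ω h, zpow_natCast, hu]

/-- Conjugate elements of a boundary torus have the same exponent of the boundary curve up to
sign. -/
theorem eq_or_eq_neg_of_isConj (hE : ∀ v, ¬ Γ.IsNode v → Γ.euler v ≤ -2)
    (he : S.IsTorusDart N e)
    (h : IsConj (S.head N e ^ a * S.fib N N.1 ^ b) (S.head N e ^ a' * S.fib N N.1 ^ b')) :
    a = a' ∨ (Γ.genus N.1 = 0 ∧ a = -a') := by
  rcases Nat.eq_zero_or_pos (Γ.genus N.1) with hg | hg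
  · obtain ⟨L, hL⟩ := he.exists_isComplement
    have h3 := hL.2.2.1
    have h5 := three_le_valency hg
    match L, h3, hL with
    | [], h3, _ => simp at h3; omega
    | [_], h3, _ => simp at h3; omega
    | i :: j :: L, _, hL =>
      obtain ⟨n, hn, hn', -⟩ := exists_order (S := S) (N := N) hE i
      obtain ⟨m, hm, hm', -⟩ := exists_order (S := S) (N := N) hE j
      obtain ⟨u, v, hu, hv, huv⟩ := exists_hyperbolic hn hm
      obtain ⟨F, hF, -, -, hFe⟩ := hL.exists_hom_pair (i := i) (j := j) (by simp)
        (zpow_eq_one_of_order hu hn') (zpow_eq_one_of_order hv hm')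
      have h6 := isConj_map_mul_fib hF h
      rw [hFe, inv_zpow', inv_zpow'] at h6
      have := huv _ _ h6
      omega
  · obtain ⟨u, v, huv⟩ := exists_heisenberg
    obtain ⟨F, hF, -, hFe⟩ := exists_hom_heis he hg u v
    have h6 := isConj_map_mul_fib hF h
    rw [hFe, inv_zpow', inv_zpow'] at h6
    have := huv _ _ h6
    omega

/-- The exponents of an element of a boundary torus are unique. -/
theorem torus_injective (hE : ∀ v, ¬ Γ.IsNode v → Γ.euler v ≤ -2) (he : S.IsTorusDart N e)
    (h : S.head N e ^ a * S.fib N N.1 ^ b = S.head N e ^ a' * S.fib N N.1 ^ b') :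
    a = a' ∧ b = b' := by
  have h1 : S.head N e ^ (a - a') * S.fib N N.1 ^ (0 : ℤ) =
      S.head N e ^ (0 : ℤ) * S.fib N N.1 ^ (b' - b) := by
    rw [zpow_zero, mul_one, zpow_zero, one_mul, sub_eq_neg_add, zpow_add, zpow_neg, zpow_sub,
      eq_mul_inv_iff_mul_eq, mul_assoc, h, inv_mul_cancel_left]
  have h2 : a = a' := by
    have h3 : IsConj (S.head N e ^ (a - a') * S.fib N N.1 ^ (0 : ℤ))
      (S.head N e ^ (0 : ℤ) * S.fib N N.1 ^ (b' - b)) := by rw [h1]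
    have := eq_or_eq_neg_of_isConj hE he h3
    omega
  subst h2
  exact ⟨rfl, eq_of_isConj_fib_zpow_mul hE he (by rw [h])⟩

/-- The piece of `N` is the twisted interval bundle over the Klein bottle: besides the chain of
`e`, there are just two chains without arrow at `N`, both of order two. -/
def IsKleinPiece (S : Γ.JSJCut) (N : Γ.Node) (e : D) : Prop :=
  Γ.genus N.1 = 0 ∧ ∃ i j x x' ω ω', (dartsAt Γ N.1).Perm [e, i, j] ∧
    S.IsLegDart N i x 2 ω ∧ S.IsLegDart N j x' 2 ω'

/-- An element of a boundary torus which is conjugate to an element with opposite exponent of the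
boundary curve lies over the fibre, or the piece is exceptional. -/
theorem eq_zero_or_isKleinPiece (hE : ∀ v, ¬ Γ.IsNode v → Γ.euler v ≤ -2)
    (he : S.IsTorusDart N e) (hg : Γ.genus N.1 = 0)
    (h : IsConj (S.head N e ^ a * S.fib N N.1 ^ b) (S.head N e ^ (-a) * S.fib N N.1 ^ b')) :
    a = 0 ∨ S.IsKleinPiece N e := by
  have h5 := three_le_valency hg
  obtain ⟨L, hL⟩ := he.exists_isComplement
  have h3 := hL.2.2.1
  have hpair : ∀ i j : D, [i, j].Sublist L → ∀ n m : ℕ, 2 ≤ n → 2 ≤ m → ¬ (n = 2 ∧ m = 2) →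
      (∀ x α ω, S.IsLegDart N i x α ω → α = n) → (∀ x α ω, S.IsLegDart N j x α ω → α = m) →
      a = 0 := by
    intro i j hij n m hn hm hnm hn' hm'
    obtain ⟨u, v, hu, hv, huv⟩ := exists_parabolic_product hn hm hnm
    obtain ⟨F, hF, -, -, hFe⟩ := hL.exists_hom_pair hij
      (zpow_eq_one_of_order hu hn') (zpow_eq_one_of_order hv hm')
    have h6 := isConj_map_mul_fib hF h
    rw [hFe, inv_zpow', inv_zpow'] at h6
    have := huv _ h6
    omega
  match L, h3, hL, hpair with
  | [], h3, _, _ => simp at h3; omega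
  | [_], h3, _, _ => simp at h3; omega
  | i :: j :: L, h3, hL, hpair =>
    obtain ⟨n, hn, hn', hn2⟩ := exists_order (S := S) (N := N) hE i
    obtain ⟨m, hm, hm', hm2⟩ := exists_order (S := S) (N := N) hE j
    by_cases hnm : n = 2 ∧ m = 2
    swap
    · exact Or.inl (hpair i j (by simp) n m hn hm hnm hn' hm')
    obtain ⟨rfl, rfl⟩ := hnm
    match L, h3, hL, hpair with
    | [], _, hL, _ =>
      right
      obtain ⟨x, ω, hx⟩ := hn2 rfl
      obtain ⟨x', ω', hx'⟩ := hm2 rfl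
      refine ⟨hg, i, j, x, x', ω, ω', ?_, hx, hx'⟩
      have hmem := hL.2.1
      rw [List.perm_ext_iff_of_nodup (nodup_dartsAt _)
        (List.nodup_cons.2 ⟨fun he' => ((hmem e).1 he').2 rfl, hL.1⟩)]
      intro d
      rw [mem_dartsAt, List.mem_cons, hmem]
      have := he.src_eq
      by_cases hd : d = e
      · subst hd; simpa
      · simp [hd]
    | k :: L, _, hL, hpair =>
      left
      obtain ⟨l, hl, hl', -⟩ := exists_order (S := S) (N := N) hE k
      by_cases hl2 : l = 2
      swap
      · exact hpair j k (by simp) 2 l le_rfl hl (fun h => hl2 h.2) hm' hl'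
      subst hl2
      classical
      obtain ⟨u, v, w, hu, hv, hw, huvw⟩ := exists_parabolic_involutions
      obtain ⟨F, hF, -, hFe⟩ := hL.2.2.2 PSL2
        (Function.update (Function.update (Function.update 1 k w) j v) i u) (by
        intro d₀ x α ω h0
        by_cases hi : d₀ = i
        · subst hi; simpa using zpow_eq_one_of_order hu hn' x α ω h0
        rw [Function.update_of_ne hi]
        by_cases hj : d₀ = j
        · subst hj; simpa using zpow_eq_one_of_order hv hm' x α ω h0
        rw [Function.update_of_ne hj]
        by_cases hk : d₀ = k
        · subst hk; simpa using zpow_eq_one_of_order hw hl' x α ω h0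
        simp [Function.update_of_ne hk])
      have h6 := isConj_map_mul_fib hF h
      have hnd := hL.1
      simp only [List.nodup_cons, List.mem_cons, not_or] at hnd
      obtain ⟨⟨hij, hik, hiL⟩, ⟨hjk, hjL⟩, hkL, -⟩ := hnd
      have hprod : ((i :: j :: k :: L).map (Function.update (Function.update
          (Function.update (1 : D → PSL2) k w) j v) i u)).prod = u * v * w := by
        simp only [List.map_cons, List.prod_cons, Function.update_self,
          Function.update_of_ne (Ne.symm hij), Function.update_of_ne (Ne.symm hik),
          Function.update_of_ne (Ne.symm hjk), map_update_of_notMem hiL,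
          map_update_of_notMem hjL, map_update_of_notMem hkL, prod_map_one, mul_one, mul_assoc]
      rw [hFe, hprod, inv_zpow', inv_zpow'] at h6
      have := huvw _ h6
      omega

theorem IsKleinPiece.isExceptional (hE : ∀ v, ¬ Γ.IsNode v → Γ.euler v ≤ -2)
    (h : S.IsKleinPiece N e) : Γ.IsExceptional N.1 := by
  obtain ⟨hg, i, j, x, x', ω, ω', hp, hi, hj⟩ := h
  have h3 : (dartsAt Γ N.1).length = Γ.valency N.1 := by
    classical
    rw [valency, dartsAt, Finset.length_sort, Set.ncard_eq_toFinset_card']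
    congr 1
    ext d
    simp
  refine ⟨hg, by rw [← h3, hp.length_eq]; rfl, i, j, ?_, ?_⟩
  · rintro rfl
    have := hp.nodup_iff.1 (nodup_dartsAt _)
    simp at this
  · obtain ⟨rfl, h1, h2, h4, -⟩ := hi.of_eq_two hE
    obtain ⟨rfl, h1', h2', h4', -⟩ := hj.of_eq_two hE
    rintro c (rfl | rfl)
    exacts [⟨hi.src_eq, h1, h2, h4⟩, ⟨hj.src_eq, h1', h2', h4'⟩]

/-- The exponent of the fibre is determined by the image in the abelianization, where the two chains
of order two both contribute half the class of the fibre to the relation of the node. -/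
theorem IsKleinPiece.fib_exponent (hE : ∀ v, ¬ Γ.IsNode v → Γ.euler v ≤ -2)
    (he : S.IsTorusDart N e) (hk : S.IsKleinPiece N e)
    (h : IsConj (S.head N e ^ a * S.fib N N.1 ^ b) (S.head N e ^ (-a) * S.fib N N.1 ^ b')) :
    b' = b + 2 * a * (-Γ.euler N.1 - 1) := by
  obtain ⟨hg, i, j, x, x', ω, ω', hp, hi, hj⟩ := hk
  obtain ⟨ρ, hρ⟩ := exists_hom_rat hE he
  obtain ⟨A, B, hrel⟩ := relation_node (S := S) (N := N)
  have hhalf : ∀ d x ω, S.IsLegDart N d x 2 ω → (ρ (S.head N d)).toAdd = 1 / 2 := by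
    intro d x ω hd
    obtain ⟨-, -, -, -, rfl⟩ := hd.of_eq_two hE
    obtain ⟨h1, h2, -⟩ := hd.fib_pow
    rw [zpow_one] at h2
    have h3 := congrArg (fun g => (ρ g).toAdd) h1
    simp only [← h2, map_zpow, hρ, toAdd_zpow, toAdd_ofAdd] at h3
    simp only [zsmul_eq_mul] at h3
    push_cast at h3
    linarith
  have h1 := congrArg (fun g => (ρ g).toAdd) hrel
  have hcomm : ρ (List.ofFn fun i => comm (A i) (B i)).prod = 1 := by
    rw [map_list_prod]
    apply List.prod_eq_one
    intro p hp
    obtain ⟨q, hq, rfl⟩ := List.mem_map.1 hp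
    obtain ⟨k, rfl⟩ := (List.mem_ofFn' _ _).1 hq
    simp [comm]
  have hprod : ρ ((dartsAt Γ N.1).map (S.head N)).prod =
      ρ (S.head N e) * (ρ (S.head N i) * ρ (S.head N j)) := by
    rw [map_list_prod, List.map_map, (hp.map _).prod_eq]
    simp
  simp only [map_mul, hcomm, one_mul, hprod, map_zpow, hρ, toAdd_mul, toAdd_zpow, toAdd_ofAdd,
    hhalf _ _ _ hi, hhalf _ _ _ hj, zsmul_eq_mul] at h1
  have h2 := congrArg Multiplicative.toAdd (isConj_iff_eq.1 (ρ.map_isConj h))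
  simp only [map_mul, map_zpow, hρ, toAdd_mul, toAdd_zpow, toAdd_ofAdd, zsmul_eq_mul] at h2
  have h3 : ((b' : ℤ) : ℚ) = ((b + 2 * a * (-Γ.euler N.1 - 1) : ℤ) : ℚ) := by
    push_cast at h1 h2 ⊢
    have h4 : (ρ (S.head N e)).toAdd = -Γ.euler N.1 - 1 := by linarith
    rw [h4] at h2
    linarith
  exact_mod_cast h3

/-- In the exceptional case, negative definiteness bounds the Euler number of the node. -/
theorem IsKleinPiece.euler_le [Fintype V] (hneg : (-Γ.intersectionMatrix).PosDef)
    (hE : ∀ v, ¬ Γ.IsNode v → Γ.euler v ≤ -2) (hk : S.IsKleinPiece N e) :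
    Γ.euler N.1 ≤ -2 := by
  classical
  obtain ⟨hg, i, j, x, x', ω, ω', hp, hi, hj⟩ := hk
  obtain ⟨rfl, hxg, hxv, hxe, -⟩ := hi.of_eq_two hE
  obtain ⟨rfl, hxg', hxv', hxe', -⟩ := hj.of_eq_two hE
  have hsi := hi.src_eq
  have hsj := hj.src_eq
  have hij : i ≠ j := by
    rintro rfl
    have := hp.nodup_iff.1 (nodup_dartsAt _)
    simp at this
  have hNi : Γ.tgt i ≠ N.1 := by
    intro h; have := three_le_valency hg; rw [← h] at this; omega
  have hNj : Γ.tgt j ≠ N.1 := by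
    intro h; have := three_le_valency hg; rw [← h] at this; omega
  have hne : Γ.tgt i ≠ Γ.tgt j := by
    intro h
    have := valency_eq_one_iff.1 hxv (Γ.rev j) (by rw [src_rev, h])
    exact hij (rev_injective this).symm
  -- the cycle `2 * E_N + E_x + E_x'` has self-intersection at least `4 * euler N + 4`
  have hpos := hneg.dotProduct_mulVec_pos (x := Pi.single N.1 2 + Pi.single (Γ.tgt i) 1 +
    Pi.single (Γ.tgt j) 1) (by
      intro h
      have := congrFun h N.1
      simp [hNi.symm, hNj.symm] at this)
  have hnn : ∀ u w, (0 : ℝ) ≤ (Set.ncard {d : D | Γ.src d = u ∧ Γ.tgt d = w} : ℝ) :=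
    fun u w => Nat.cast_nonneg _
  have hone : ∀ d, (1 : ℝ) ≤
      (Set.ncard {d' : D | Γ.src d' = Γ.src d ∧ Γ.tgt d' = Γ.tgt d} : ℝ) := by
    intro d
    have : 0 < Set.ncard {d' : D | Γ.src d' = Γ.src d ∧ Γ.tgt d' = Γ.tgt d} :=
      (Set.ncard_pos (Set.toFinite _)).2 ⟨d, rfl, rfl⟩
    exact_mod_cast this
  have e1 := hone i
  have e2 := hone (Γ.rev i)
  have e3 := hone j
  have e4 := hone (Γ.rev j)
  rw [src_rev, tgt_rev] at e2 e4
  rw [hsi] at e1 e2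
  rw [hsj] at e3 e4
  have f1 := hnn N.1 N.1
  have f2 := hnn (Γ.tgt i) (Γ.tgt i)
  have f3 := hnn (Γ.tgt j) (Γ.tgt j)
  have f4 := hnn (Γ.tgt i) (Γ.tgt j)
  have f5 := hnn (Γ.tgt j) (Γ.tgt i)
  simp only [star_trivial, Matrix.mulVec_add, dotProduct_add, add_dotProduct,
    Matrix.mulVec_single, single_dotProduct, Pi.smul_apply, Matrix.col_apply, Matrix.neg_apply,
    intersectionMatrix, Matrix.of_apply, if_true, if_neg hNi, if_neg hNj, if_neg hne,
    if_neg hNi.symm, if_neg hNj.symm, if_neg hne.symm, MulOpposite.smul_eq_mul_unop,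
    MulOpposite.unop_op, hxe, hxe'] at hpos
  push_cast at hpos
  have : (Γ.euler N.1 : ℝ) < -1 := by linarith
  have : Γ.euler N.1 < -1 := by exact_mod_cast this
  omega

/-- Conjugacy in a boundary torus: conjugate elements are equal, except in the exceptional case. -/
theorem torus_conj (hE : ∀ v, ¬ Γ.IsNode v → Γ.euler v ≤ -2) (he : S.IsTorusDart N e)
    (h : IsConj (S.head N e ^ a * S.fib N N.1 ^ b) (S.head N e ^ a' * S.fib N N.1 ^ b')) :
    (a' = a ∧ b' = b) ∨
      (S.IsKleinPiece N e ∧ a' = -a ∧ b' = b + 2 * a * (-Γ.euler N.1 - 1)) := by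
  have key : a' = a → b' = b := by
    rintro rfl
    exact (eq_of_isConj_fib_zpow_mul hE he h).symm
  rcases eq_or_eq_neg_of_isConj hE he h with h1 | ⟨hg, h1⟩
  · exact Or.inl ⟨h1.symm, key h1.symm⟩
  · obtain rfl : a' = -a := by omega
    rcases eq_zero_or_isKleinPiece hE he hg h with h2 | h2
    · exact Or.inl ⟨by omega, key (by omega)⟩
    · exact Or.inr ⟨h2, rfl, h2.fib_exponent hE he h⟩

/-- Different boundary tori have conjugate elements over the fibre only. -/
theorem eq_zero_of_isConj_torus (hE : ∀ v, ¬ Γ.IsNode v → Γ.euler v ≤ -2)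
    (he : S.IsTorusDart N e) (he' : S.IsTorusDart N e') (hne : e ≠ e')
    (h : IsConj (S.head N e ^ a * S.fib N N.1 ^ b) (S.head N e' ^ a' * S.fib N N.1 ^ b')) :
    a = 0 := by
  rcases Nat.eq_zero_or_pos (Γ.genus N.1) with hg | hg
  · have h5 := three_le_valency hg
    obtain ⟨L, hL⟩ := he.exists_isComplement
    have h3 := hL.2.2.1
    have he'L : e' ∈ L := (hL.2.1 e').2 ⟨he'.src_eq, hne.symm⟩
    obtain ⟨k, hk, hke⟩ : ∃ k ∈ L, k ≠ e' := by
      by_contra! hcon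
      have := List.eq_replicate_of_mem hcon
      have hnd := hL.1
      rw [this, List.nodup_replicate] at hnd
      omega
    obtain ⟨n, hn, hn', -⟩ := exists_order (S := S) (N := N) hE k
    obtain ⟨u, v, hu, huv⟩ := exists_parabolic hn
    rcases pair_sublist_or hk he'L hke with hs | hs
    · obtain ⟨F, hF, -, hF', hFe⟩ := hL.exists_hom_pair hs (zpow_eq_one_of_order hu hn')
        (v := v) (fun x α ω h => absurd h he'.not_isLegDart)
      have h6 := isConj_map_mul_fib hF h
      rw [hFe, hF', inv_zpow'] at h6
      have := huv _ _ h6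
      omega
    · obtain ⟨F, hF, hF', -, hFe⟩ := hL.exists_hom_pair hs (u := v)
        (fun x α ω h => absurd h he'.not_isLegDart) (zpow_eq_one_of_order hu hn')
      have h6 := isConj_map_mul_fib hF h
      rw [hFe, hF', inv_zpow'] at h6
      -- the order of the two chains does not matter, as `u * v` and `v * u` are conjugate
      have h7 : IsConj ((u * v) ^ (-a)) ((v * u) ^ (-a)) := by
        refine isConj_iff.2 ⟨v, ?_⟩
        rw [← conj_zpow]
        congr 1
        group
      have := huv _ _ (h7.trans h6)
      omega
  · obtain ⟨u, v, huv⟩ := exists_heisenberg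
    obtain ⟨F, hF, hF', hFe⟩ := exists_hom_heis he hg u v
    have h6 := isConj_map_mul_fib hF h
    rw [hFe, hF' e' he'.src_eq hne.symm, inv_zpow', one_zpow,
      ← zpow_zero (u * v * u⁻¹ * v⁻¹)] at h6
    have := huv _ _ h6
    omega

theorem IsLegDart.head_zpow (h : S.IsLegDart N e x α ω) :
    S.head N e ^ α = S.fib N N.1 ^ ω := by
  obtain ⟨h1, h2, -⟩ := h.fib_pow
  rw [h1, h2, ← zpow_mul, ← zpow_mul, mul_comm]

theorem mul_fib_zpow (g : S.G N) (k : ℤ) :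
    (g ^ a * S.fib N N.1 ^ b) ^ k = g ^ (a * k) * S.fib N N.1 ^ (b * k) := by
  rw [(((commute_fib g).zpow_left b).zpow_right a).symm.mul_zpow, zpow_mul, zpow_mul]

theorem isConj_zpow {A : Type*} [Group A] {g g' : A} (h : IsConj g g') (k : ℤ) :
    IsConj (g ^ k) (g' ^ k) := by
  obtain ⟨c, rfl⟩ := isConj_iff.1 h
  exact isConj_iff.2 ⟨c, conj_zpow.symm⟩

/-- A power of an element of a chain without arrow is a power of the fibre, so its conjugates in a
boundary torus lie over the fibre. -/
theorem eq_zero_of_isConj_leg (hE : ∀ v, ¬ Γ.IsNode v → Γ.euler v ≤ -2)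
    (he : S.IsTorusDart N e) (hd : S.IsLegDart N d₀ x α ω)
    (h : IsConj (S.head N e ^ a * S.fib N N.1 ^ b) (S.head N d₀ ^ a' * S.fib N N.1 ^ b')) :
    a = 0 := by
  have h1 := isConj_zpow h α
  rw [mul_fib_zpow, mul_fib_zpow, mul_comm a' α, zpow_mul (S.head N d₀), hd.head_zpow, ← zpow_mul,
    ← zpow_add, ← one_mul (S.fib N N.1 ^ (ω * a' + b' * α)), ← zpow_zero (S.head N e)] at h1
  have h2 : a * α = 0 := by
    have := eq_or_eq_neg_of_isConj hE he h1
    omega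
  have := hd.two_le hE
  rcases mul_eq_zero.1 h2 with h | h <;> omega

/-- Conjugate elements belonging to different chains at a node lie over the fibre of the node. -/
theorem mem_zpowers_of_isConj (hE : ∀ v, ¬ Γ.IsNode v → Γ.euler v ≤ -2)
    (he : S.IsTorusDart N e) (hd : Γ.src d₀ = N.1) (hd' : Γ.src d₀' = N.1) (hne : d₀ ≠ d₀')
    (h : IsConj (S.head N d₀ ^ a * S.fib N N.1 ^ b) (S.head N d₀' ^ a' * S.fib N N.1 ^ b')) :
    S.head N d₀ ^ a * S.fib N N.1 ^ b ∈ Subgroup.zpowers (S.fib N N.1) := by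
  rcases isTorusDart_or_isLegDart (S := S) hd with h1 | ⟨x, α, ω, h1⟩ <;>
  rcases isTorusDart_or_isLegDart (S := S) hd' with h2 | ⟨x', α', ω', h2⟩
  · obtain rfl := eq_zero_of_isConj_torus hE h1 h2 hne h
    exact ⟨b, by simp⟩
  · obtain rfl := eq_zero_of_isConj_leg hE h1 h2 h
    exact ⟨b, by simp⟩
  · obtain rfl := eq_zero_of_isConj_leg hE h2 h1 h.symm
    obtain ⟨c, hc⟩ := isConj_iff.1 h.symm
    rw [zpow_zero, one_mul, ← ((commute_fib c).zpow_left b').eq, mul_inv_cancel_right] at hc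
    exact ⟨b', hc⟩
  · classical
    have hed : d₀ ≠ e := by rintro rfl; exact he.not_isLegDart h1
    have hed' : d₀' ≠ e := by rintro rfl; exact he.not_isLegDart h2
    obtain ⟨L, hL⟩ := he.exists_isComplement
    have hα := h1.two_le hE
    -- the exponent `a` modulo `α` is seen in a cyclic quotient in which the other chain is trivial
    obtain ⟨F, hF, hF', -⟩ := hL.2.2.2 (Multiplicative (ZMod α.toNat))
      (Function.update 1 d₀ (Multiplicative.ofAdd 1)) (by
        intro d x'' α'' ω'' h3
        by_cases hdd : d = d₀
        · subst hdd
          obtain ⟨-, rfl, -⟩ := h3.unique h1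
          rw [Function.update_self, ← ofAdd_zsmul, ← ofAdd_zero]
          congr 1
          rw [zsmul_one, ZMod.intCast_zmod_eq_zero_iff_dvd, Int.toNat_of_nonneg (by omega)]
        · simp [Function.update_of_ne hdd])
    have h6 := isConj_iff_eq.1 (isConj_map_mul_fib hF h)
    rw [hF' d₀ ((hL.2.1 d₀).2 ⟨hd, hed⟩), hF' d₀' ((hL.2.1 d₀').2 ⟨hd', hed'⟩),
      Function.update_self, Function.update_of_ne hne.symm, Pi.one_apply, one_zpow,
      ← ofAdd_zsmul, ← ofAdd_zero] at h6
    have h7 := Multiplicative.ofAdd.injective h6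
    rw [zsmul_one, ZMod.intCast_zmod_eq_zero_iff_dvd, Int.toNat_of_nonneg (by omega)] at h7
    obtain ⟨k, rfl⟩ := h7
    rw [zpow_mul, h1.head_zpow, ← zpow_mul, ← zpow_add]
    exact ⟨_, rfl⟩

/-- Conjugate powers of the fibre of the end vertex of a chain without arrow are equal. -/
theorem IsLegDart.eq_of_isConj (hE : ∀ v, ¬ Γ.IsNode v → Γ.euler v ≤ -2)
    (he : S.IsTorusDart N e) (hd : S.IsLegDart N d₀ x α ω) {r s : ℤ}
    (h : IsConj (S.fib N x ^ r) (S.fib N x ^ s)) : r = s := by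
  obtain ⟨ρ, hρ⟩ := exists_hom_rat hE he
  have h1 := congrArg (fun g => (ρ g).toAdd) hd.fib_pow.1
  have h2 := congrArg Multiplicative.toAdd (isConj_iff_eq.1 (ρ.map_isConj h))
  simp only [map_zpow, hρ, toAdd_zpow, toAdd_ofAdd, zsmul_eq_mul] at h1 h2
  have h3 : (ρ (S.fib N x)).toAdd ≠ 0 := by
    intro h0
    rw [h0, mul_zero] at h1
    exact one_ne_zero h1
  exact_mod_cast mul_right_cancel₀ h3 h2

/-- Two elements belonging to chains at a node which are conjugate are equal, except for elements of
the boundary torus of a twisted interval bundle over the Klein bottle; if they belong to different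
chains they are powers of the fibre of the node. -/
theorem chain_conj (hE : ∀ v, ¬ Γ.IsNode v → Γ.euler v ≤ -2)
    (he : S.IsTorusDart N e) (hd : Γ.src d₀ = N.1) (hd' : Γ.src d₀' = N.1)
    (h : IsConj (S.head N d₀ ^ a * S.fib N N.1 ^ b) (S.head N d₀' ^ a' * S.fib N N.1 ^ b')) :
    (S.head N d₀' ^ a' * S.fib N N.1 ^ b' = S.head N d₀ ^ a * S.fib N N.1 ^ b ∧
      (d₀ ≠ d₀' → S.head N d₀ ^ a * S.fib N N.1 ^ b ∈ Subgroup.zpowers (S.fib N N.1))) ∨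
    (d₀ = d₀' ∧ S.IsTorusDart N d₀ ∧
      S.IsKleinPiece N d₀ ∧ a' = -a ∧ b' = b + 2 * a * (-Γ.euler N.1 - 1)) := by
  by_cases hne : d₀ = d₀'
  · subst hne
    rcases isTorusDart_or_isLegDart (S := S) hd with h1 | ⟨x, α, ω, h1⟩
    · rcases torus_conj hE h1 h with ⟨rfl, rfl⟩ | h2
      · exact Or.inl ⟨rfl, fun h => absurd rfl h⟩
      · exact Or.inr ⟨rfl, h1, h2⟩
    · left
      refine ⟨?_, fun h => absurd rfl h⟩
      obtain ⟨h2, h3, -⟩ := h1.fib_pow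
      rw [h2, h3] at h ⊢
      simp only [← zpow_mul, ← zpow_add] at h ⊢
      rw [h1.eq_of_isConj hE he h]
  · left
    have h1 := mem_zpowers_of_isConj hE he hd hd' hne h
    refine ⟨?_, fun _ => h1⟩
    obtain ⟨k, hk⟩ := h1
    rw [← hk] at h ⊢
    obtain ⟨c, hc⟩ := isConj_iff.1 h
    have hc' := ((commute_fib c).zpow_left k).eq
    simp only at hc
    rw [← hc, ← hc', mul_inv_cancel_right]

end JSJCut

end PlumbingGraph

/-! ### Sets with an action of a commutative group -/

section EquivariantEquiv

universe u

variable {E : Type*} [CommGroup E]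

/-- A set with an action of a commutative group is determined by the stabilizers that occur, up to
the product with a sufficiently large set `K`: the set `K × Y` consists of `K` copies of `E ⧸ B` for
each stabilizer `B`. -/
theorem exists_equiv_sigma_quotient {Y K : Type u} [Infinite K] (ι : Y ↪ K)
    (θ : E →* Equiv.Perm Y) (Bs : Set (Subgroup E))
    (hBs : ∀ B, B ∈ Bs ↔ ∃ y, ∀ e, e ∈ B ↔ θ e y = y) :
    ∃ β : (Σ B : Bs, K × (E ⧸ B.1)) ≃ K × Y, ∀ (e : E) (B : Bs) (k : K) (q : E ⧸ B.1),
      β ⟨B, k, e • q⟩ = ((β ⟨B, k, q⟩).1, θ e (β ⟨B, k, q⟩).2) := by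
  classical
  -- a representative in each orbit
  obtain ⟨r, hr1, hr2⟩ : ∃ r : Y → Y, (∀ y, ∃ e, θ e (r y) = y) ∧ ∀ e y, r (θ e y) = r y := by
    let s : Setoid Y :=
      { r := fun y y' => ∃ e, θ e y = y'
        iseqv := ⟨fun y => ⟨1, by simp⟩, fun {y y'} ⟨e, he⟩ => ⟨e⁻¹, by simp [← he]⟩,
          fun {x y z} ⟨e, he⟩ ⟨e', he'⟩ => ⟨e' * e, by simp [← he', ← he]⟩⟩ }
    refine ⟨fun y => (Quotient.mk s y).out, fun y => Quotient.mk_out (s := s) y, fun e y => ?_⟩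
    simp only
    congr 1
    exact Quotient.sound (s := s) ⟨e⁻¹, by simp⟩
  have hstab : ∀ e e' y, θ e (θ e' y) = θ e' y ↔ θ e y = y := by
    intro e e' y
    rw [← Equiv.Perm.mul_apply, ← map_mul, mul_comm, map_mul, Equiv.Perm.mul_apply,
      (θ e').injective.eq_iff]
  let O (B : Bs) := {y : Y // r y = y ∧ ∀ e, e ∈ B.1 ↔ θ e y = y}
  have hκ : ∀ B : Bs, Nonempty (K ≃ K × O B) := by
    intro B
    have hO : Nonempty (O B) := by
      obtain ⟨y, hy⟩ := (hBs B.1).1 B.2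
      obtain ⟨e', he'⟩ := hr1 y
      refine ⟨⟨r y, ?_, fun e => ?_⟩⟩
      · rw [← hr2 e' (r y), he']
      · rw [hy, ← hstab e e' (r y), he']
    rw [← Cardinal.eq, Cardinal.mk_prod, Cardinal.lift_id, Cardinal.lift_id,
      Cardinal.mul_eq_left (Cardinal.aleph0_le_mk K)]
    · exact ⟨fun y => ι y.1, fun a b h => Subtype.ext (ι.injective h)⟩
    · exact Cardinal.mk_ne_zero _
  let κ := fun B => (hκ B).some
  have hwd : ∀ (B : Bs) (k : K) (a b : E), QuotientGroup.leftRel B.1 a b →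
      θ a (κ B k).2.1 = θ b (κ B k).2.1 := by
    intro B k a b hab
    rw [QuotientGroup.leftRel_apply, (κ B k).2.2.2, map_mul, map_inv, Equiv.Perm.mul_apply,
      Equiv.Perm.inv_eq_iff_eq] at hab
    exact hab.symm
  let F : (Σ B : Bs, K × (E ⧸ B.1)) → K × Y := fun z =>
    ((κ z.1 z.2.1).1, Quotient.liftOn' z.2.2 (fun e => θ e (κ z.1 z.2.1).2.1) (hwd _ _))
  have hF : ∀ (B : Bs) (k : K) (e : E),
      F ⟨B, k, (e : E ⧸ B.1)⟩ = ((κ B k).1, θ e (κ B k).2.1) := fun _ _ _ => rfl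
  have hbij : Function.Bijective F := by
    constructor
    · rintro ⟨B, k, q⟩ ⟨B', k', q'⟩ h
      obtain ⟨e, rfl⟩ := QuotientGroup.mk_surjective q
      obtain ⟨e', rfl⟩ := QuotientGroup.mk_surjective q'
      rw [hF, hF, Prod.mk.injEq] at h
      obtain ⟨h1, h2⟩ := h
      have h3 : (κ B k).2.1 = (κ B' k').2.1 := by
        rw [← (κ B k).2.2.1, ← (κ B' k').2.2.1, ← hr2 e, h2, hr2]
      obtain rfl : B = B' := by
        apply Subtype.ext
        ext c
        rw [(κ B k).2.2.2, (κ B' k').2.2.2, h3]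
      obtain rfl : k = k' := (κ B).injective (Prod.ext h1 (Subtype.ext h3))
      have h4 : (e : E ⧸ B.1) = e' := by
        rw [QuotientGroup.eq, (κ B k).2.2.2, map_mul, map_inv, Equiv.Perm.mul_apply, ← h2,
          Equiv.Perm.inv_eq_iff_eq]
      rw [h4]
    · rintro ⟨k, y⟩
      obtain ⟨e, he⟩ := hr1 y
      let B : Subgroup E := (MulAction.stabilizer (Equiv.Perm Y) (r y)).comap θ
      have hB : ∀ e, e ∈ B ↔ θ e (r y) = r y := fun e => Iff.rfl
      have hrr : r (r y) = r y := by
        rw [← hr2 e (r y), he]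
      let B' : Bs := ⟨B, (hBs B).2 ⟨r y, hB⟩⟩
      refine ⟨⟨B', (κ B').symm (k, ⟨r y, hrr, hB⟩), (e : E ⧸ B)⟩, ?_⟩
      rw [hF]
      simp [he]
  refine ⟨Equiv.ofBijective F hbij, fun e B k q => ?_⟩
  obtain ⟨a, rfl⟩ := QuotientGroup.mk_surjective q
  show F ⟨B, k, ((e * a : E) : E ⧸ B.1)⟩ = ((F ⟨B, k, _⟩).1, θ e (F ⟨B, k, _⟩).2)
  rw [hF, hF, map_mul, Equiv.Perm.mul_apply]

/-- Sets with actions of a commutative group in which the same stabilizers occur become isomorphic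
after taking the product with a sufficiently large set. -/
theorem exists_equivariant_equiv {Y Y' K : Type u} [Infinite K] (ι : Y ↪ K) (ι' : Y' ↪ K)
    (θ : E →* Equiv.Perm Y) (θ' : E →* Equiv.Perm Y')
    (h : ∀ y, ∃ y', ∀ e, θ e y = y ↔ θ' e y' = y')
    (h' : ∀ y', ∃ y, ∀ e, θ' e y' = y' ↔ θ e y = y) :
    ∃ β : K × Y ≃ K × Y', ∀ (e : E) (x : K × Y),
      β (x.1, θ e x.2) = ((β x).1, θ' e (β x).2) := by
  let Bs : Set (Subgroup E) := {B | ∃ y, ∀ e, e ∈ B ↔ θ e y = y}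
  obtain ⟨f, hf⟩ := exists_equiv_sigma_quotient ι θ Bs (fun B => Iff.rfl)
  obtain ⟨g, hg⟩ := exists_equiv_sigma_quotient ι' θ' Bs (fun B => by
    constructor
    · rintro ⟨y, hy⟩
      obtain ⟨y', hy'⟩ := h y
      exact ⟨y', fun e => (hy e).trans (hy' e)⟩
    · rintro ⟨y, hy⟩
      obtain ⟨y', hy'⟩ := h' y
      exact ⟨y', fun e => (hy e).trans (hy' e)⟩)
  refine ⟨f.symm.trans g, fun e x => ?_⟩
  obtain ⟨⟨B, k, q⟩, rfl⟩ := f.surjective x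
  rw [← hf]
  simp [hg]

end EquivariantEquiv

/-! ### Graphs of sets -/

namespace PlumbingGraph

namespace JSJCut

variable {V D : Type*} [Fintype D] [LinearOrder D] {Γ : PlumbingGraph V D} {S : Γ.JSJCut}
  {N N' : Γ.Node}

theorem Edge.ext_dart {e e' : S.Edge N N'} (h : e.dart = e'.dart) : e = e' := by
  cases e; cases e'; cases h; rfl

theorem Edge.reverse_reverse (e : S.Edge N N') : e.reverse.reverse = e :=
  Edge.ext_dart (Γ.rev_rev _)

theorem Edge.φPlus_reverse (e : S.Edge N N') (c : EdgeGroup) :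
    e.reverse.φPlus c = e.φMinus c.swap := by
  show e.reverse.reverse.φMinus c.swap = _
  rw [e.reverse_reverse]

theorem Edge.φMinus_reverse (e : S.Edge N N') (c : EdgeGroup) :
    e.reverse.φMinus c = e.φPlus c.swap := by
  show _ = e.reverse.φMinus c.swap.swap
  rw [Prod.swap_swap]

/-- Conjugacy of elements of vertex groups of the graph of groups, by way of conjugations in vertex
groups and of the edge isomorphisms. -/
inductive EllConj (w : S.Word₀) : S.Word₀ → Prop
  | refl : EllConj w w
  | conj {N : Γ.Node} {g g' : S.G N} : EllConj w ⟨N, g⟩ → IsConj g g' → EllConj w ⟨N, g'⟩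
  | edge {N N' : Γ.Node} (e : S.Edge N N') (c : EdgeGroup) :
      EllConj w ⟨N, e.φMinus c⟩ → EllConj w ⟨N', e.φPlus c⟩

theorem EllConj.zpow {w w' : S.Word₀} (h : EllConj w w') (k : ℤ) :
    EllConj ⟨w.1, w.2 ^ k⟩ ⟨w'.1, w'.2 ^ k⟩ := by
  induction h with
  | refl => exact .refl
  | conj _ hc ih => exact ih.conj (isConj_zpow hc k)
  | edge e c _ ih =>
    simp only [← map_zpow] at ih ⊢
    exact ih.edge e (c ^ k)

/-- The maps along the edge paths from a node, for a family of maps indexed by the edges. -/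
inductive PathMap (S : Γ.JSJCut) {X : Γ.Node → Type*}
    (β : ∀ {N N' : Γ.Node}, S.Edge N N' → (X N ≃ X N')) (N₀ : Γ.Node) :
    ∀ N : Γ.Node, List D → (X N₀ ≃ X N) → Prop
  | nil : PathMap S β N₀ N₀ [] (Equiv.refl _)
  | snoc {N N' : Γ.Node} {l : List D} {q : X N₀ ≃ X N} (e : S.Edge N N') :
      PathMap S β N₀ N l q → PathMap S β N₀ N' (l ++ [e.dart]) (q.trans (β e))

theorem isEdgePath_append {N N' : Γ.Node} {l l' : List D} :
    S.IsEdgePath N (l ++ l') N' ↔ ∃ M, S.IsEdgePath N l M ∧ S.IsEdgePath M l' N' := by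
  induction l generalizing N with
  | nil => simp [IsEdgePath]
  | cons d l ih =>
    simp only [List.cons_append, IsEdgePath, ih]
    constructor
    · rintro ⟨M, e, h, M', h1, h2⟩
      exact ⟨M', ⟨M, e, h, h1⟩, h2⟩
    · rintro ⟨M', ⟨M, e, h, h1⟩, h2⟩
      exact ⟨M, e, h, M', h1, h2⟩

theorem isEdgePath_snoc {N N' : Γ.Node} {l : List D} {d : D} :
    S.IsEdgePath N (l ++ [d]) N' ↔ ∃ M, S.IsEdgePath N l M ∧ ∃ e : S.Edge M N', e.dart = d := by
  rw [isEdgePath_append]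
  refine exists_congr fun M => and_congr_right fun _ => ?_
  simp only [IsEdgePath]
  constructor
  · rintro ⟨M', e, h, rfl⟩
    exact ⟨e, h⟩
  · rintro ⟨e, h⟩
    exact ⟨N', e, h, rfl⟩

section PathMap

variable {X : Γ.Node → Type*} {β : ∀ {N N' : Γ.Node}, S.Edge N N' → (X N ≃ X N')}
  {N₀ : Γ.Node}

theorem PathMap.exists_of_isEdgePath {N : Γ.Node} {l : List D} (h : S.IsEdgePath N₀ l N) :
    ∃ q, PathMap S β N₀ N l q := by
  induction l using List.reverseRecOn generalizing N with
  | nil =>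
    obtain rfl : N₀ = N := h
    exact ⟨_, .nil⟩
  | append_singleton l d ih =>
    obtain ⟨M, h1, e, rfl⟩ := isEdgePath_snoc.1 h
    obtain ⟨q, hq⟩ := ih h1
    exact ⟨_, hq.snoc e⟩

theorem PathMap.unique {N N' : Γ.Node} {l l' : List D} {q : X N₀ ≃ X N} {q' : X N₀ ≃ X N'}
    (h : PathMap S β N₀ N l q) (h' : PathMap S β N₀ N' l' q') (hl : l = l') :
    (⟨N, q⟩ : Σ N, X N₀ ≃ X N) = ⟨N', q'⟩ := by
  induction h generalizing N' l' with
  | nil =>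
    cases h' with
    | nil => rfl
    | snoc e h => simp at hl
  | snoc e h ih =>
    cases h' with
    | nil => simp at hl
    | snoc e' h' =>
      obtain ⟨hl, hd⟩ := List.append_inj' hl rfl
      simp only [List.cons.injEq, and_true] at hd
      have := ih h' hl
      cases this
      obtain rfl := eq_of_mem_piece (hd ▸ e.tgt_mem) e'.tgt_mem
      rw [Edge.ext_dart hd]

/-- The vertex sets of a graph of sets can be identified with one of them along a maximal tree, in a
way compatible with permutations `σ` that commute with the edge maps. -/
theorem MaximalTree.exists_identification (T : S.MaximalTree)
    (hrev : ∀ {N N' : Γ.Node} (e : S.Edge N N'), β e.reverse = (β e).symm)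
    (σ : ∀ N, Equiv.Perm (X N))
    (hσ : ∀ {N N' : Γ.Node} (e : S.Edge N N') x, β e (σ N x) = σ N' (β e x)) (N₀ : Γ.Node) :
    ∃ q : ∀ N, X N₀ ≃ X N, (∀ N x, q N (σ N₀ x) = σ N (q N x)) ∧
      ∀ {N N' : Γ.Node} (e : S.Edge N N'), e.dart ∈ T.edges → q N' = (q N).trans (β e) := by
  choose l hl hlu using T.existsUnique_path N₀
  choose q hq using fun N => PathMap.exists_of_isEdgePath (β := β) (hl N).1
  have hqσ : ∀ N l (q : X N₀ ≃ X N), PathMap S β N₀ N l q → ∀ x, q (σ N₀ x) = σ N (q x) := by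
    intro N l q h
    induction h with
    | nil => intro x; rfl
    | snoc e _ ih =>
      intro x
      simp only [Equiv.trans_apply, ih, hσ]
  refine ⟨q, fun N => hqσ N _ _ (hq N), ?_⟩
  intro N N' e he
  by_cases hback : ∃ l', l N = l' ++ [Γ.rev e.dart]
  · -- the path to the starting point of `e` ends with the inverse of `e`
    obtain ⟨l', hl'⟩ := hback
    have h1 := hq N
    obtain ⟨h2, h3, h4⟩ := hl N
    rw [hl'] at h1 h2 h3 h4
    obtain ⟨M, h5, e', he'⟩ := isEdgePath_snoc.1 h2
    have hM : M = N' := by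
      refine eq_of_mem_piece (S := S) e'.src_mem ?_
      rw [he', src_rev]
      exact e.tgt_mem
    subst hM
    have h6 : e' = e.reverse := Edge.ext_dart he'
    have h7 : l' = l M := by
      refine hlu M l' ⟨h5, fun d hd => h3 d (by simp [hd]), ?_⟩
      exact (List.isChain_append.1 h4).1
    have h8 := (hq M).snoc e'
    have h9 := h1.unique h8 (by rw [h7, he'])
    have h10 : q N = (q M).trans (β e') := eq_of_heq (Sigma.mk.inj h9).2
    rw [h10, h6, hrev]
    ext x
    simp
  · -- the path to the end point of `e` passes through `e`
    have h1 : l N ++ [e.dart] = l N' := by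
      refine hlu N' _ ⟨isEdgePath_snoc.2 ⟨N, (hl N).1, e, rfl⟩, ?_, ?_⟩
      · intro d hd
        rcases List.mem_append.1 hd with hd | hd
        · exact (hl N).2.1 d hd
        · rw [List.mem_singleton.1 hd]; exact he
      · rw [List.isChain_append]
        refine ⟨(hl N).2.2, by simp, ?_⟩
        intro a ha b hb hab
        simp only [List.head?_cons, Option.mem_def, Option.some.injEq] at hb
        apply hback
        refine ⟨(l N).dropLast, ?_⟩
        have ha' : a = Γ.rev e.dart := by rw [hb, hab, Γ.rev_rev]
        rw [← ha']
        have hne : l N ≠ [] := by rintro h; rw [h] at ha; simp at ha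
        rw [List.getLast?_eq_some_getLast hne, Option.mem_def, Option.some.injEq] at ha
        rw [← ha, List.dropLast_append_getLast hne]
    have h2 := ((hq N).snoc e).unique (hq N') h1
    exact (eq_of_heq (Sigma.mk.inj h2).2).symm

end PathMap

end JSJCut

end PlumbingGraph

/-! ### Actions of the fundamental group of the graph of groups -/

namespace PlumbingGraph

namespace JSJCut

variable {V D : Type*} [Fintype D] [LinearOrder D] {Γ : PlumbingGraph V D} {S : Γ.JSJCut}
  {N N' : Γ.Node}

theorem src_mem_of_isChain {N : Γ.Node} {l : List D} {d : D} (hl : (l ++ [d]).IsChain Γ.Step)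
    (hc : ∀ d' ∈ l, d' ∉ S.cut) (h : ∀ d' ∈ (l ++ [d]).head?, Γ.src d' ∈ S.piece N) :
    Γ.src d ∈ S.piece N := by
  induction l with
  | nil => exact h d (by simp)
  | cons a l ih =>
    refine ih hl.tail (fun d' hd' => hc d' (List.mem_cons_of_mem _ hd')) fun d' hd' => ?_
    have h1 : Γ.Step a d' := by
      cases l with
      | nil =>
        obtain rfl : d = d' := by simpa using hd'
        simpa using hl
      | cons b l =>
        obtain rfl : b = d' := by simpa using hd'
        exact (List.isChain_cons_cons.1 hl).1
    rw [h1.2.1]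
    exact S.tgt_mem (hc a (by simp)) (h a (by simp))

theorem exists_src_mem_piece {d : D} (hd : d ∈ S.cut) : ∃ N : Γ.Node, Γ.src d ∈ S.piece N := by
  obtain ⟨l, hl, hdl⟩ := S.exists_chain d hd
  obtain ⟨l₁, l₂, rfl, hd₁⟩ := List.eq_append_cons_of_mem hdl
  have ⟨_, h2, h3, _⟩ := hl
  have h4 : (l₁ ++ d :: l₂).head? = (l₁ ++ [d]).head? := by cases l₁ <;> simp
  rw [h4] at h3
  obtain ⟨a, ha⟩ : ∃ a, a ∈ (l₁ ++ [d]).head? := by cases l₁ <;> simp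
  refine ⟨⟨Γ.src a, h3 a ha⟩, src_mem_of_isChain (l := l₁) (d := d) ?_ ?_ ?_⟩
  · rw [show l₁ ++ d :: l₂ = (l₁ ++ [d]) ++ l₂ by simp] at h2
    exact h2.left_of_append
  · intro d' hd' hc
    obtain ⟨u, _, hu⟩ := S.existsUnique_mem _ ‹_›
    have := (hu d' ⟨by simp [hd'], hc⟩).trans (hu d ⟨by simp, hd⟩).symm
    exact hd₁ (this ▸ hd')
  · intro d' hd'
    obtain rfl : a = d' := Option.mem_unique ha hd'
    exact S.node_mem _

theorem exists_edge {d : D} (hd : d ∈ S.cut) : ∃ (N N' : Γ.Node) (e : S.Edge N N'), e.dart = d := by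
  obtain ⟨N, h⟩ := exists_src_mem_piece hd
  obtain ⟨N', h'⟩ := exists_src_mem_piece (S.rev_mem d hd)
  exact ⟨N, N', ⟨d, hd, h, h'⟩, rfl⟩

/-- A graph of sets, with compatible actions of the vertex groups, defines an action of the
fundamental group of the graph of groups. Hence the existence of fixed points depends only on the
conjugacy class in the fundamental group. The permutations `σ`, which commute with everything,
twist the fixed points. -/
theorem exists_fixed_of_isConj_label {X : Γ.Node → Type*} (T : S.MaximalTree)
    (act : ∀ N : Γ.Node, S.G N →* Equiv.Perm (X N))
    (β : ∀ {N N' : Γ.Node}, S.Edge N N' → (X N ≃ X N'))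
    (hrev : ∀ {N N' : Γ.Node} (e : S.Edge N N'), β e.reverse = (β e).symm)
    (hβ : ∀ {N N' : Γ.Node} (e : S.Edge N N') (c : EdgeGroup) (x : X N),
      β e (act N (e.φMinus c) x) = act N' (e.φPlus c) (β e x))
    (σ : ∀ N, Equiv.Perm (X N))
    (hσ : ∀ {N N' : Γ.Node} (e : S.Edge N N') x, β e (σ N x) = σ N' (β e x))
    (hσact : ∀ N g x, act N g (σ N x) = σ N (act N g x)) {w w' : S.Word₀}
    (h : IsConj (T.label w) (T.label w')) (hfix : ∃ x, act w.1 w.2 (σ w.1 x) = x) :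
    ∃ x, act w'.1 w'.2 (σ w'.1 x) = x := by
  obtain ⟨q, hqσ, hqT⟩ := T.exists_identification (β := β) hrev σ hσ w.1
  let ρ (N : Γ.Node) : S.G N →* Equiv.Perm (X w.1) :=
    ((q N).symm.permCongrHom.toMonoidHom).comp (act N)
  have hρ : ∀ N g x, ρ N g x = (q N).symm (act N g (q N x)) := fun N g x => rfl
  let τe {N N' : Γ.Node} (e : S.Edge N N') : Equiv.Perm (X w.1) :=
    ((q N').trans (β e).symm).trans (q N).symm
  have hτ : ∀ d : {d : D // d ∈ S.cut}, ∃ t : Equiv.Perm (X w.1),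
      ∀ (N N' : Γ.Node) (e : S.Edge N N'), e.dart = d.1 → t = τe e := by
    rintro ⟨d, hd⟩
    obtain ⟨N, N', e, rfl⟩ := exists_edge hd
    refine ⟨τe e, fun M M' e' he' => ?_⟩
    simp only at he'
    obtain rfl := eq_of_mem_piece e.src_mem (he' ▸ e'.src_mem)
    obtain rfl := eq_of_mem_piece e.tgt_mem (he' ▸ e'.tgt_mem)
    rw [Edge.ext_dart he']
  choose τ hτ using hτ
  let Ψ : S.PreGroup →* Equiv.Perm (X w.1) :=
    Monoid.Coprod.lift (Monoid.CoprodI.lift ρ) (FreeGroup.lift τ)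
  have hΨG : ∀ N g, Ψ (S.inG N g) = ρ N g := by
    intro N g
    simp [Ψ, inG]
  have hΨt : ∀ {N N'} (e : S.Edge N N'), Ψ (S.t e.dart e.mem_cut) = τe e := by
    intro N N' e
    simp only [Ψ, t, Monoid.Coprod.lift_apply_inr, FreeGroup.lift_apply_of]
    exact hτ _ _ _ e rfl
  have hker : Subgroup.normalClosure T.rels ≤ Ψ.ker := by
    refine Subgroup.normalClosure_le_normal ?_
    rintro r ((⟨N, N', e, c, rfl⟩ | ⟨d, hd, rfl⟩) | ⟨d, hd, rfl⟩)
    · rw [SetLike.mem_coe, MonoidHom.mem_ker]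
      simp only [map_mul, map_inv, hΨG, hΨt]
      rw [mul_inv_eq_one, mul_inv_eq_iff_eq_mul]
      ext x
      simp only [Equiv.Perm.mul_apply, hρ, τe, Equiv.trans_apply, Equiv.apply_symm_apply]
      congr 1
      rw [Equiv.symm_apply_eq, hβ]
      simp
    · obtain ⟨N, N', e, rfl⟩ := exists_edge hd
      rw [SetLike.mem_coe, MonoidHom.mem_ker, map_mul, hΨt e]
      have : Ψ (S.t (Γ.rev e.dart) (S.rev_mem _ hd)) = τe e.reverse := hΨt e.reverse
      rw [this]
      ext x
      simp [τe, hrev]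
    · obtain ⟨N, N', e, rfl⟩ := exists_edge (T.subset hd)
      rw [SetLike.mem_coe, MonoidHom.mem_ker, hΨt e]
      ext x
      simp [τe, hqT e hd]
  have hcomm : ∀ z x, Ψ z (σ w.1 x) = σ w.1 (Ψ z x) := by
    have hqσ' : ∀ N y, (q N).symm (σ N y) = σ w.1 ((q N).symm y) := by
      intro N y
      rw [Equiv.symm_apply_eq, hqσ, Equiv.apply_symm_apply]
    have hG : ∀ z x, Monoid.CoprodI.lift ρ z (σ w.1 x) = σ w.1 (Monoid.CoprodI.lift ρ z x) := by
      intro z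
      induction z using Monoid.CoprodI.induction_on with
      | one => intro x; simp
      | of N g => intro x; rw [Monoid.CoprodI.lift_of, hρ, hρ, hqσ, hσact, hqσ']
      | mul a b ha hb => intro x; rw [map_mul, Equiv.Perm.mul_apply, hb, ha]; rfl
    have hτσ : ∀ d x, τ d (σ w.1 x) = σ w.1 (τ d x) := by
      rintro ⟨d, hd⟩ x
      obtain ⟨N, N', e, rfl⟩ := exists_edge hd
      rw [hτ _ _ _ e rfl]
      simp only [τe, Equiv.trans_apply]
      have h3 : (β e).symm (σ N' (q N' x)) = σ N ((β e).symm (q N' x)) := by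
        rw [Equiv.symm_apply_eq, hσ, Equiv.apply_symm_apply]
      rw [hqσ, h3, hqσ']
    have hF : ∀ z x, FreeGroup.lift τ z (σ w.1 x) = σ w.1 (FreeGroup.lift τ z x) := by
      intro z
      induction z using FreeGroup.induction_on with
      | C1 => intro x; simp
      | of d => intro x; simp only [FreeGroup.lift_apply_of]; exact hτσ d x
      | inv_of d _ =>
        intro x
        simp only [map_inv, FreeGroup.lift_apply_of]
        rw [Equiv.Perm.inv_eq_iff_eq, hτσ, ← Equiv.Perm.mul_apply (τ d), mul_inv_cancel]
        rfl
      | mul a b ha hb => intro x; rw [map_mul, Equiv.Perm.mul_apply, hb, ha]; rfl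
    intro z
    induction z using Monoid.Coprod.induction_on with
    | inl z => intro x; simp only [Ψ, Monoid.Coprod.lift_apply_inl]; exact hG z x
    | inr z => intro x; simp only [Ψ, Monoid.Coprod.lift_apply_inr]; exact hF z x
    | mul a b ha hb => intro x; rw [map_mul, Equiv.Perm.mul_apply, hb, ha]; rfl
  obtain ⟨x, hx⟩ := hfix
  obtain ⟨c, hc⟩ := isConj_iff.1 h
  obtain ⟨z, rfl⟩ := QuotientGroup.mk'_surjective _ c
  have h1 := congrArg (QuotientGroup.lift _ Ψ hker) hc
  have h2 : Ψ z * ρ w.1 w.2 * (Ψ z)⁻¹ = ρ w'.1 w'.2 := by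
    rw [← hΨG, ← hΨG, ← map_inv, ← map_mul, ← map_mul]
    exact h1
  have h3 : ρ w.1 w.2 (σ w.1 ((q w.1).symm x)) = (q w.1).symm x := by
    rw [hρ, hqσ, Equiv.apply_symm_apply, hx]
  have h4 : ρ w'.1 w'.2 (σ w.1 (Ψ z ((q w.1).symm x))) = Ψ z ((q w.1).symm x) := by
    rw [← h2, ← hcomm, ← Equiv.Perm.mul_apply, inv_mul_cancel_right, Equiv.Perm.mul_apply, h3]
  refine ⟨q w'.1 (Ψ z ((q w.1).symm x)), ?_⟩
  rw [← hqσ]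
  rw [hρ, Equiv.symm_apply_eq] at h4
  exact h4

end JSJCut

end PlumbingGraph

/-! ### Conjugacy in the fundamental group of the graph of groups -/

namespace PlumbingGraph

namespace JSJCut

variable {V D : Type*} [Fintype D] [LinearOrder D] {Γ : PlumbingGraph V D} {S : Γ.JSJCut}
  {N N' : Γ.Node}

theorem Out.zpow_mul_zpow {d₀ d : D} {P P' Q Q' : ℤ} (h : S.Out N d₀ d P P' Q Q') (m n : ℤ) :
    S.fib N (Γ.src d) ^ m * S.head N d ^ n =
      S.head N d₀ ^ (m * P + n * P') * S.fib N N.1 ^ (-(m * Q + n * Q')) := by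
  have hc : ∀ (k : ℤ) g, Commute (S.fib N N.1 ^ k) g := fun k g => (commute_fib g).zpow_left k
  rw [h.fib_src.1, h.fib_src.2, (hc _ _).symm.mul_zpow, (hc _ _).symm.mul_zpow]
  simp only [← zpow_mul]
  rw [mul_assoc, ← mul_assoc (S.fib N N.1 ^ _), (hc _ _).eq, mul_assoc, ← zpow_add, ← mul_assoc,
    ← zpow_add]
  congr 2 <;> ring

theorem Edge.φMinus_apply {e : S.Edge N N'} {d₀ : D} {P P' Q Q' : ℤ}
    (h : S.Out N d₀ e.dart P P' Q Q') (c : EdgeGroup) :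
    e.φMinus c = S.head N d₀ ^ (c.1.toAdd * P + c.2.toAdd * P') *
      S.fib N N.1 ^ (-(c.1.toAdd * Q + c.2.toAdd * Q')) := by
  rw [← h.zpow_mul_zpow, fib_eq e.src_mem, head_eq e.src_mem]
  rfl

theorem Edge.φMinus_injective (hE : ∀ v, ¬ Γ.IsNode v → Γ.euler v ≤ -2) (e : S.Edge N N') :
    Function.Injective e.φMinus := by
  obtain ⟨d₀, P, P', Q, Q', h⟩ := exists_out_of_mem_cut e.src_mem e.mem_cut
  intro c c' hc
  rw [e.φMinus_apply h, e.φMinus_apply h] at hc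
  obtain ⟨h1, h2⟩ := torus_injective hE ⟨_, _, _, _, _, h, e.mem_cut⟩ hc
  have hdet := h.det
  refine Prod.ext (Multiplicative.toAdd.injective ?_) (Multiplicative.toAdd.injective ?_)
  · linear_combination -(c.1.toAdd - c'.1.toAdd) * hdet + h1 * Q' + h2 * P'
  · linear_combination -(c.2.toAdd - c'.2.toAdd) * hdet - h1 * Q - h2 * P

theorem Edge.φPlus_injective (hE : ∀ v, ¬ Γ.IsNode v → Γ.euler v ≤ -2) (e : S.Edge N N') :
    Function.Injective e.φPlus :=
  (e.reverse.φMinus_injective hE).comp Prod.swap_injective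

section Construction

/-- The elements `(g, k)` of the product of a vertex group and `ℤ` such that `g` is, by way of
the vertex groups, conjugate to the `k`-th power of a given element. -/
def conjPowers (w : S.Word₀) (N : Γ.Node) : Set (S.G N × Multiplicative ℤ) :=
  {a | EllConj ⟨w.1, w.2 ^ a.2.toAdd⟩ ⟨N, a.1⟩}

variable {w : S.Word₀}

theorem conj_mem_conjPowers {a : S.G N × Multiplicative ℤ} (ha : a ∈ conjPowers w N)
    (b : S.G N × Multiplicative ℤ) : b * a * b⁻¹ ∈ conjPowers w N := by
  have h : (b * a * b⁻¹).2 = a.2 := by simp [mul_comm]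
  show EllConj ⟨w.1, w.2 ^ (b * a * b⁻¹).2.toAdd⟩ _
  rw [h]
  exact EllConj.conj ha (isConj_iff.2 ⟨b.1, rfl⟩)

theorem zpow_mem_conjPowers {a : S.G N × Multiplicative ℤ} (ha : a ∈ conjPowers w N) (k : ℤ) :
    a ^ k ∈ conjPowers w N := by
  have h := EllConj.zpow ha k
  rw [← zpow_mul] at h
  show EllConj ⟨w.1, w.2 ^ (a ^ k).2.toAdd⟩ _
  rwa [show (a ^ k).2.toAdd = a.2.toAdd * k by simp [mul_comm]]

/-- The disjoint union of the transitive sets with stabilizers the cyclic groups generated by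
`conjPowers w N`. -/
abbrev ConjSet (w : S.Word₀) (N : Γ.Node) :=
  Σ a : conjPowers w N, (S.G N × Multiplicative ℤ) ⧸ Subgroup.zpowers a.1

theorem ConjSet.exists_stabilizer (y : ConjSet w N) :
    ∃ a ∈ conjPowers w N, ∀ g : S.G N × Multiplicative ℤ, g • y = y ↔ g ∈ Subgroup.zpowers a := by
  obtain ⟨a, q⟩ := y
  obtain ⟨b, rfl⟩ := QuotientGroup.mk_surjective q
  refine ⟨b * a * b⁻¹, conj_mem_conjPowers a.2 b, fun g => ?_⟩
  have h1 : g • (⟨a, (b : _ ⧸ Subgroup.zpowers a.1)⟩ : ConjSet w N) =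
      ⟨a, ((g * b : _) : _ ⧸ Subgroup.zpowers a.1)⟩ := rfl
  rw [h1, Sigma.mk.inj_iff, heq_eq_eq, QuotientGroup.eq, Subgroup.mem_zpowers_iff,
    Subgroup.mem_zpowers_iff]
  simp only [true_and, conj_zpow]
  constructor
  · rintro ⟨k, hk⟩
    refine ⟨-k, ?_⟩
    rw [zpow_neg, hk]; group
  · rintro ⟨k, hk⟩
    refine ⟨-k, ?_⟩
    rw [zpow_neg, ← hk]; group

theorem ConjSet.exists_of_mem {a : S.G N × Multiplicative ℤ} (ha : a ∈ conjPowers w N) :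
    ∃ y : ConjSet w N, ∀ g : S.G N × Multiplicative ℤ, g • y = y ↔ g ∈ Subgroup.zpowers a := by
  refine ⟨⟨⟨a, ha⟩, ((1 : S.G N × Multiplicative ℤ) : _ ⧸ Subgroup.zpowers a)⟩, fun g => ?_⟩
  have h1 : g • (⟨⟨a, ha⟩, ((1 : S.G N × Multiplicative ℤ) : _ ⧸ Subgroup.zpowers a)⟩ :
      ConjSet w N) = ⟨⟨a, ha⟩, ((g * 1 : S.G N × Multiplicative ℤ) : _ ⧸ Subgroup.zpowers a)⟩ := rfl
  rw [h1, Sigma.mk.inj_iff, heq_eq_eq, QuotientGroup.eq]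
  simp

/-- The stabilizers of an edge group in the sets at its two ends are the same. -/
theorem ConjSet.exists_same_stabilizer (hE : ∀ v, ¬ Γ.IsNode v → Γ.euler v ≤ -2)
    (e : S.Edge N N') (y : ConjSet w N) :
    ∃ y' : ConjSet w N', ∀ c : EdgeGroup × Multiplicative ℤ,
      (e.φMinus c.1, c.2) • y = y ↔ (e.φPlus c.1, c.2) • y' = y' := by
  obtain ⟨a, ha, hya⟩ := y.exists_stabilizer
  let ψ : EdgeGroup × Multiplicative ℤ →* S.G N × Multiplicative ℤ :=
    e.φMinus.prodMap (MonoidHom.id _)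
  have hψ : Function.Injective ψ := (e.φMinus_injective hE).prodMap Function.injective_id
  let ψ' : EdgeGroup × Multiplicative ℤ →* S.G N' × Multiplicative ℤ :=
    e.φPlus.prodMap (MonoidHom.id _)
  have hψ' : Function.Injective ψ' := (e.φPlus_injective hE).prodMap Function.injective_id
  have hcyc : IsCyclic ((Subgroup.zpowers a).comap ψ) :=
    isCyclic_of_injective (ψ.subgroupComap (Subgroup.zpowers a)) fun x x' hx =>
      Subtype.ext (hψ (congrArg Subtype.val hx))
  obtain ⟨ε, hε⟩ := (Subgroup.isCyclic_iff_exists_zpowers_eq_top _).1 hcyc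
  have hεa : ψ ε ∈ Subgroup.zpowers a := by
    show ε ∈ (Subgroup.zpowers a).comap ψ
    rw [← hε]; exact Subgroup.mem_zpowers ε
  obtain ⟨k, hk⟩ := Subgroup.mem_zpowers_iff.1 hεa
  have hεC : ψ' ε ∈ conjPowers w N' := by
    have h := zpow_mem_conjPowers ha k
    rw [hk] at h
    exact EllConj.edge e ε.1 h
  obtain ⟨y', hy'⟩ := ConjSet.exists_of_mem hεC
  refine ⟨y', fun c => ?_⟩
  rw [hya, hy']
  show c ∈ (Subgroup.zpowers a).comap ψ ↔ ψ' c ∈ _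
  rw [← hε, Subgroup.mem_zpowers_iff, Subgroup.mem_zpowers_iff]
  simp only [← map_zpow, hψ'.eq_iff]

/-- Elements of vertex groups that are conjugate in the fundamental group of the graph of groups
are conjugate by way of the vertex groups and the edge isomorphisms. To see this, the vertex groups
act on sets in which the stabilizers are generated by the elements obtained from `w` in this way.
An element `w'` conjugate to `w` then has a fixed point. The factor `ℤ` records exponents, so that
`w'` is obtained from `w` itself and not only from a power of it. -/
theorem ellConj_of_isConj_label (hE : ∀ v, ¬ Γ.IsNode v → Γ.euler v ≤ -2) (T : S.MaximalTree)
    {w w' : S.Word₀} (h : IsConj (T.label w) (T.label w')) : EllConj w w' := by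
  -- the product with `K` makes the sets at the two ends of an edge isomorphic over the edge group
  let K := (Σ N, ConjSet w N) ⊕ ℕ
  let ι (N : Γ.Node) : ConjSet w N ↪ K :=
    ⟨fun y => Sum.inl ⟨N, y⟩, fun y y' h => by
      have h1 := Sum.inl_injective h
      exact eq_of_heq (Sigma.mk.inj h1).2⟩
  let X (N : Γ.Node) := K × ConjSet w N
  have hch : ∀ {N N' : Γ.Node} (e : S.Edge N N'), ∃ β : X N ≃ X N',
      ∀ (c : EdgeGroup) (k : Multiplicative ℤ) (x : X N),
        β (x.1, (e.φMinus c, k) • x.2) = ((β x).1, (e.φPlus c, k) • (β x).2) := by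
    intro N N' e
    obtain ⟨β, hβ⟩ := exists_equivariant_equiv (E := EdgeGroup × Multiplicative ℤ) (ι N) (ι N')
      ((MulAction.toPermHom _ _).comp (e.φMinus.prodMap (MonoidHom.id _)))
      ((MulAction.toPermHom _ _).comp (e.φPlus.prodMap (MonoidHom.id _)))
      (fun y => ConjSet.exists_same_stabilizer hE e y)
      (fun y => by
        obtain ⟨y', hy'⟩ := ConjSet.exists_same_stabilizer hE e.reverse y
        refine ⟨y', fun c => ?_⟩
        have := hy' (c.1.swap, c.2)
        rwa [e.φMinus_reverse, e.φPlus_reverse] at this)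
    exact ⟨β, fun c k x => hβ (c, k) x⟩
  choose ch hch using @hch
  -- the map is chosen for one orientation of each edge, so that inverse edges have inverse maps
  let β {N N' : Γ.Node} (e : S.Edge N N') : X N ≃ X N' :=
    if e.dart < Γ.rev e.dart then ch e else (ch e.reverse).symm
  have hβ : ∀ {N N' : Γ.Node} (e : S.Edge N N') (c : EdgeGroup) (k : Multiplicative ℤ) (x : X N),
      β e (x.1, (e.φMinus c, k) • x.2) = ((β e x).1, (e.φPlus c, k) • (β e x).2) := by
    intro N N' e c k x
    by_cases hd : e.dart < Γ.rev e.dart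
    · simp only [β, if_pos hd]
      exact hch e c k x
    · simp only [β, if_neg hd]
      rw [Equiv.symm_apply_eq]
      have := hch e.reverse c.swap k ((ch e.reverse).symm x)
      rw [e.φMinus_reverse, e.φPlus_reverse] at this
      simp only [Prod.swap_swap, Equiv.apply_symm_apply] at this
      exact this.symm
  let act (N : Γ.Node) : S.G N →* Equiv.Perm (X N) := MonoidHom.mk'
    (fun g => Equiv.prodCongr (Equiv.refl K)
      (MulAction.toPerm ((g, 1) : S.G N × Multiplicative ℤ))) (fun g g' => by
      ext x : 1
      refine Prod.ext rfl ?_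
      show ((g * g', 1) : S.G N × Multiplicative ℤ) • x.2 =
        ((g, 1) : S.G N × Multiplicative ℤ) • ((g', 1) : S.G N × Multiplicative ℤ) • x.2
      rw [smul_smul, Prod.mk_mul_mk, mul_one])
  let σ (N : Γ.Node) : Equiv.Perm (X N) := Equiv.prodCongr (Equiv.refl K)
      (MulAction.toPerm ((1, Multiplicative.ofAdd 1) : S.G N × Multiplicative ℤ))
  have hact : ∀ N g x, act N g (σ N x) = (x.1, ((g, Multiplicative.ofAdd 1) :
      S.G N × Multiplicative ℤ) • x.2) := by
    intro N g x
    refine Prod.ext rfl ?_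
    show ((g, 1) : S.G N × Multiplicative ℤ) •
      ((1, Multiplicative.ofAdd 1) : S.G N × Multiplicative ℤ) • x.2 = _
    rw [smul_smul, Prod.mk_mul_mk, mul_one, one_mul]
  have hβrev : ∀ {N N' : Γ.Node} (e : S.Edge N N'), β e.reverse = (β e).symm := by
    intro N N' e
    have hne : Γ.rev e.dart ≠ e.dart := Γ.rev_ne _
    have h1 : e.reverse.dart = Γ.rev e.dart := rfl
    simp only [β, h1, Γ.rev_rev, e.reverse_reverse]
    rcases lt_or_gt_of_ne hne with hd | hd
    · rw [if_pos hd, if_neg hd.not_gt, Equiv.symm_symm]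
    · rw [if_pos hd, if_neg hd.not_gt]
  have hβσ : ∀ {N N' : Γ.Node} (e : S.Edge N N') x, β e (σ N x) = σ N' (β e x) := by
    intro N N' e x
    have := hβ e 1 (Multiplicative.ofAdd 1) x
    rwa [map_one e.φMinus, map_one e.φPlus] at this
  have hσact : ∀ N g x, act N g (σ N x) = σ N (act N g x) := by
    intro N g x
    rw [hact]
    refine Prod.ext rfl ?_
    show _ = ((1, Multiplicative.ofAdd 1) : S.G N × Multiplicative ℤ) •
      ((g, 1) : S.G N × Multiplicative ℤ) • x.2
    rw [smul_smul, Prod.mk_mul_mk, mul_one, one_mul]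
  have hw : ((w.2, Multiplicative.ofAdd 1) : S.G w.1 × Multiplicative ℤ) ∈
      conjPowers w w.1 := by
    show EllConj ⟨w.1, w.2 ^ (1 : ℤ)⟩ ⟨w.1, w.2⟩
    rw [zpow_one]
    exact .refl
  have hfix : ∃ x, act w.1 w.2 (σ w.1 x) = x := by
    obtain ⟨y, hy⟩ := ConjSet.exists_of_mem hw
    refine ⟨(Sum.inr 0, y), ?_⟩
    rw [hact]
    exact Prod.ext rfl ((hy _).2 (Subgroup.mem_zpowers _))
  obtain ⟨x, hx⟩ := exists_fixed_of_isConj_label T act β hβrev (fun e c x => hβ e c 1 x) σ hβσ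
    hσact h hfix
  rw [hact] at hx
  obtain ⟨a, ha, hya⟩ := x.2.exists_stabilizer
  obtain ⟨k, hk⟩ := Subgroup.mem_zpowers_iff.1 ((hya _).1 (Prod.ext_iff.1 hx).2)
  have h1 := zpow_mem_conjPowers ha k
  rw [hk] at h1
  have h2 : EllConj ⟨w.1, w.2 ^ (1 : ℤ)⟩ ⟨w'.1, w'.2⟩ := h1
  rwa [zpow_one] at h2

end Construction

end JSJCut

end PlumbingGraph

/-! ### m-arc-generators -/

namespace PlumbingGraph

namespace JSJCut

variable {V D : Type*} [Fintype D] [LinearOrder D] {Γ : PlumbingGraph V D} {S : Γ.JSJCut}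
  {N N' : Γ.Node} {d d₀ d₀' e : D} {P P' Q Q' α ω : ℤ} {x : V} {g g' : S.G N}

/-- The group of the products of powers of the fibre of the node and of the second fibre of a chain
at the node; it contains all the fibres of the chain. -/
noncomputable def chainSubgroup (S : Γ.JSJCut) (N : Γ.Node) (d : D) : Subgroup (S.G N) where
  carrier := {g | ∃ a b : ℤ, g = S.head N d ^ a * S.fib N N.1 ^ b}
  one_mem' := ⟨0, 0, by simp⟩
  mul_mem' := by
    rintro _ _ ⟨a, b, rfl⟩ ⟨a', b', rfl⟩
    refine ⟨a + a', b + b', ?_⟩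
    rw [zpow_add, zpow_add, mul_assoc, ← mul_assoc (S.fib N N.1 ^ b),
      ((commute_fib (S.head N d ^ a')).zpow_left b).eq]
    simp only [mul_assoc]
  inv_mem' := by
    rintro _ ⟨a, b, rfl⟩
    refine ⟨-a, -b, ?_⟩
    rw [mul_inv_rev, zpow_neg, zpow_neg, ← zpow_neg, ((commute_fib _).zpow_left (-b)).eq]

theorem fib_mem_chainSubgroup : S.fib N N.1 ∈ S.chainSubgroup N d := ⟨0, 1, by simp⟩

theorem Out.fib_mem_chainSubgroup (h : S.Out N d₀ d P P' Q Q') :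
    S.fib N (Γ.src d) ∈ S.chainSubgroup N d₀ ∧ S.head N d ∈ S.chainSubgroup N d₀ :=
  ⟨⟨_, _, h.fib_src.1⟩, ⟨_, _, h.fib_src.2⟩⟩

theorem Edge.φMinus_mem_chainSubgroup {e : S.Edge N N'} (h : S.Out N d₀ e.dart P P' Q Q')
    (c : EdgeGroup) : e.φMinus c ∈ S.chainSubgroup N d₀ := ⟨_, _, e.φMinus_apply h c⟩

theorem exists_mem_chainSubgroup (he : S.IsTorusDart N e) {w : S.Word₀} (hN : w.1 = N)
    (h : S.IsMArcGenerator w) : ∃ d, Γ.src d = w.1.1 ∧ w.2 ∈ S.chainSubgroup w.1 d := by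
  subst hN
  have hdart : ∀ d, Γ.src d ∈ S.piece w.1 → ∃ d₀, Γ.src d₀ = w.1.1 ∧
      S.fib w.1 (Γ.src d) ∈ S.chainSubgroup w.1 d₀ ∧ S.head w.1 d ∈ S.chainSubgroup w.1 d₀ := by
    intro d hd
    rcases out_or_out_rev hd with ⟨d₀, _, _, _, _, h⟩ | ⟨hc, d₀, _, _, _, _, h⟩
    · exact ⟨d₀, h.src_eq, h.fib_mem_chainSubgroup⟩
    · have hc' : Γ.rev d ∉ S.cut := mt S.rev_mem_cut_iff.1 hc
      have h1 : S.head w.1 d = S.fib w.1 (Γ.src (Γ.rev d)) := head_eq_fib hd hc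
      have h2 : S.fib w.1 (Γ.src d) = S.head w.1 (Γ.rev d) := by
        rw [head_eq_fib h.src_mem hc', tgt_rev]
      rw [h1, h2]
      exact ⟨d₀, h.src_eq, h.fib_mem_chainSubgroup.symm⟩
  rcases h with ⟨x, hx, m, hm⟩ | ⟨d, hd, -, m, hm⟩ | ⟨d, hd, m, n, hm⟩
  · rw [hm, ← fib_eq]
    rcases mem_piece hx with rfl | ⟨d₀, d, P, P', Q, Q', h, hc, rfl⟩
    · exact ⟨e, he.src_eq, Subgroup.zpow_mem _ fib_mem_chainSubgroup _⟩
    · refine ⟨d₀, h.src_eq, Subgroup.zpow_mem _ ?_ _⟩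
      rw [← head_eq_fib h.src_mem hc]
      exact h.fib_mem_chainSubgroup.2
  · obtain ⟨d₀, h0, -, h2⟩ := hdart d hd
    rw [hm, ← head_eq]
    exact ⟨d₀, h0, Subgroup.zpow_mem _ h2 _⟩
  · obtain ⟨d₀, h0, h1, h2⟩ := hdart d hd
    rw [hm, ← head_eq, ← fib_eq]
    exact ⟨d₀, h0, Subgroup.mul_mem _ (Subgroup.zpow_mem _ h1 _) (Subgroup.zpow_mem _ h2 _)⟩

/-- The only elements common to different chains are the powers of the fibre of the node. -/
theorem mem_zpowers_of_mem_chainSubgroup (hE : ∀ v, ¬ Γ.IsNode v → Γ.euler v ≤ -2)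
    (he : S.IsTorusDart N e) (hd : Γ.src d = N.1) (hd' : Γ.src d₀ = N.1) (hne : d ≠ d₀)
    (h : g ∈ S.chainSubgroup N d) (h' : g ∈ S.chainSubgroup N d₀) :
    g ∈ Subgroup.zpowers (S.fib N N.1) := by
  obtain ⟨a, b, rfl⟩ := h
  obtain ⟨a', b', h'⟩ := h'
  have hc := IsConj.refl (S.head N d ^ a * S.fib N N.1 ^ b)
  nth_rewrite 2 [h'] at hc
  rcases chain_conj hE he hd hd' hc with h1 | h1
  · exact h1.2 hne
  · exact absurd h1.1 hne

theorem eq_of_isConj_of_mem_chainSubgroup (hE : ∀ v, ¬ Γ.IsNode v → Γ.euler v ≤ -2)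
    (he : S.IsTorusDart N e) (hN : ¬ Γ.IsExceptional N.1)
    (h : ∃ d, Γ.src d = N.1 ∧ g ∈ S.chainSubgroup N d)
    (h' : ∃ d, Γ.src d = N.1 ∧ g' ∈ S.chainSubgroup N d) (hc : IsConj g g') : g = g' := by
  obtain ⟨d, hd, a, b, rfl⟩ := h
  obtain ⟨d', hd', a', b', rfl⟩ := h'
  rcases chain_conj hE he hd hd' hc with h1 | h1
  · exact h1.1.symm
  · exact absurd (h1.2.2.1.isExceptional hE) hN

/-- The type `τ` belongs to the chain starting with `d`. -/
def MType.HasDart (d : D) : S.MType N → Prop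
  | .torus c _ _ => ∃ P P' Q Q', S.Out N d c P P' Q Q'
  | .leg x _ _ _ => ∃ α ω, S.IsLegDart N d x α ω

theorem MType.HasDart.unique {τ τ' : S.MType N} (h : τ.HasDart d) (h' : τ'.HasDart d) : τ = τ' := by
  cases τ with
  | torus c hc h1 =>
    obtain ⟨P, P', Q, Q', h⟩ := h
    cases τ' with
    | torus c' hc' h1' =>
      obtain ⟨R, R', W, W', h'⟩ := h'
      obtain rfl := h.terminal_unique h' (Or.inl hc) (Or.inl hc')
      rfl
    | leg x' _ _ _ =>
      obtain ⟨_, _, h'⟩ := h'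
      exact absurd h' (IsTorusDart.not_isLegDart ⟨_, _, _, _, _, h, hc⟩)
  | leg x _ _ _ =>
    obtain ⟨_, _, h⟩ := h
    cases τ' with
    | torus c' hc' h1' =>
      obtain ⟨R, R', W, W', h'⟩ := h'
      exact absurd h (IsTorusDart.not_isLegDart ⟨_, _, _, _, _, h', hc'⟩)
    | leg x' _ _ _ =>
      obtain ⟨_, _, h'⟩ := h'
      obtain ⟨rfl, -, -⟩ := h.unique h'
      rfl

theorem MType.exists_hasDart (τ : S.MType N) :
    ∃ d, Γ.src d = N.1 ∧ τ.HasDart d ∧ τ.subgroup ≤ S.chainSubgroup N d := by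
  cases τ with
  | torus c hc hx =>
    obtain ⟨d₀, P, P', Q, Q', h⟩ := exists_out_of_mem_cut hx hc
    refine ⟨d₀, h.src_eq, ⟨_, _, _, _, h⟩, ?_⟩
    rw [MType.subgroup, Subgroup.closure_le]
    rintro g (rfl | rfl)
    · rw [← fib_eq]; exact h.fib_mem_chainSubgroup.1
    · rw [← head_eq]; exact h.fib_mem_chainSubgroup.2
  | leg x hx hn h1 =>
    rcases mem_piece hx with rfl | ⟨d₀, d, P, P', Q, Q', h, hc, rfl⟩
    · exact absurd N.2 hn
    · refine ⟨d₀, h.src_eq, ⟨_, _, d, P, P', Q, Q', h, hc, h1, rfl, rfl, rfl⟩, ?_⟩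
      rw [MType.subgroup, Subgroup.zpowers_le, ← fib_eq, ← head_eq_fib h.src_mem hc]
      exact h.fib_mem_chainSubgroup.2

theorem Edge.φMinus_mem_typeMinus (e : S.Edge N N') (c : EdgeGroup) :
    e.φMinus c ∈ e.typeMinus.subgroup := by
  refine Subgroup.mul_mem _ ?_ ?_
  · exact Subgroup.zpow_mem e.typeMinus.subgroup
      (x := S.γ (Γ.src e.dart) e.src_mem) (Subgroup.subset_closure (Or.inl rfl)) c.1.toAdd
  · exact Subgroup.zpow_mem e.typeMinus.subgroup
      (x := S.γHead e.dart e.src_mem) (Subgroup.subset_closure (Or.inr rfl)) c.2.toAdd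

theorem Edge.isPure_φMinus (hE : ∀ v, ¬ Γ.IsNode v → Γ.euler v ≤ -2) (e : S.Edge N N')
    (c : EdgeGroup) (h : e.φMinus c ∉ Subgroup.zpowers (S.fib N N.1)) :
    IsPure (e.φMinus c) e.typeMinus := by
  refine ⟨e.φMinus_mem_typeMinus c, fun τ hτ => ?_⟩
  obtain ⟨d₀, P, P', Q, Q', hd₀⟩ := exists_out_of_mem_cut e.src_mem e.mem_cut
  obtain ⟨d, h1, h2, h3⟩ := τ.exists_hasDart
  by_cases hd : d = d₀
  · subst hd
    exact h2.unique (show e.typeMinus.HasDart d from ⟨_, _, _, _, hd₀⟩)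
  · exact absurd (mem_zpowers_of_mem_chainSubgroup hE ⟨_, _, _, _, _, hd₀, e.mem_cut⟩ h1
      hd₀.src_eq hd (h3 hτ) (e.φMinus_mem_chainSubgroup hd₀ c)) h

theorem Edge.isPure_φPlus (hE : ∀ v, ¬ Γ.IsNode v → Γ.euler v ≤ -2) (e : S.Edge N N')
    (c : EdgeGroup) (h : e.φPlus c ∉ Subgroup.zpowers (S.fib N' N'.1)) :
    IsPure (e.φPlus c) e.typePlus := by
  have h1 : e.φPlus c = e.reverse.φMinus c.swap := rfl
  rw [h1] at h ⊢
  exact e.reverse.isPure_φMinus hE _ h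

theorem Edge.exponent_eq_zero (hE : ∀ v, ¬ Γ.IsNode v → Γ.euler v ≤ -2) {e : S.Edge N N'}
    (h : S.Out N d₀ e.dart P P' Q Q') {c : EdgeGroup}
    (hc : e.φMinus c ∈ Subgroup.zpowers (S.fib N N.1)) :
    c.1.toAdd * P + c.2.toAdd * P' = 0 := by
  obtain ⟨k, hk⟩ := Subgroup.mem_zpowers_iff.1 hc
  refine (torus_injective hE ⟨_, _, _, _, _, h, e.mem_cut⟩ (b' := k)
    (b := -(c.1.toAdd * Q + c.2.toAdd * Q')) ?_).1
  rw [← e.φMinus_apply h, zpow_zero, one_mul, hk]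

/-- The fibres of the nodes on the two sides of a torus are independent. -/
theorem Edge.eq_one_of_mem_zpowers (hE : ∀ v, ¬ Γ.IsNode v → Γ.euler v ≤ -2) {e : S.Edge N N'}
    {c : EdgeGroup} (hc : e.φMinus c ∈ Subgroup.zpowers (S.fib N N.1))
    (hc' : e.φPlus c ∈ Subgroup.zpowers (S.fib N' N'.1)) : c = 1 := by
  obtain ⟨d₀, P, P', Q, Q', h⟩ := exists_out_of_mem_cut e.src_mem e.mem_cut
  obtain ⟨d₁, R, R', W, W', h'⟩ := exists_out_of_mem_cut e.reverse.src_mem e.reverse.mem_cut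
  have h1 := Edge.exponent_eq_zero hE h hc
  have h2 := Edge.exponent_eq_zero hE h' (c := c.swap) hc'
  simp only [Prod.fst_swap, Prod.snd_swap] at h2
  obtain ⟨h3, h4, -⟩ := h.bounds hE
  obtain ⟨h5, h6, -⟩ := h'.bounds hE
  have hΔ : 0 < P' * R' - P * R := by nlinarith
  have hm : c.1.toAdd * (P' * R' - P * R) = 0 := by linear_combination P' * h2 - R * h1
  have hn : c.2.toAdd * (P' * R' - P * R) = 0 := by linear_combination R' * h1 - P * h2
  exact Prod.ext (Multiplicative.toAdd.injective ((mul_eq_zero.1 hm).resolve_right hΔ.ne'))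
    (Multiplicative.toAdd.injective ((mul_eq_zero.1 hn).resolve_right hΔ.ne'))

theorem Edge.dart_ne (e : S.Edge N N') {N'' : Γ.Node} (e' : S.Edge N' N'')
    (hne : e'.dart ≠ Γ.rev e.dart) {d₀' R R' W W'} (h : S.Out N' d₀ (Γ.rev e.dart) P P' Q Q')
    (h' : S.Out N' d₀' e'.dart R R' W W') : d₀ ≠ d₀' := by
  rintro rfl
  exact hne (h'.terminal_unique h (Or.inl e'.mem_cut) (Or.inl e.reverse.mem_cut))

/-- Elements common to different boundary tori are powers of the fibre of the node. -/
theorem Edge.mem_zpowers_of_eq (hE : ∀ v, ¬ Γ.IsNode v → Γ.euler v ≤ -2) (e : S.Edge N N')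
    {N'' : Γ.Node} (e' : S.Edge N' N'') (hne : e'.dart ≠ Γ.rev e.dart) {c c' : EdgeGroup}
    (h : e.φPlus c = e'.φMinus c') : e.φPlus c ∈ Subgroup.zpowers (S.fib N' N'.1) := by
  obtain ⟨d₁, R, R', W, W', h1⟩ := exists_out_of_mem_cut e.reverse.src_mem e.reverse.mem_cut
  obtain ⟨d₂, P, P', Q, Q', h2⟩ := exists_out_of_mem_cut e'.src_mem e'.mem_cut
  refine mem_zpowers_of_mem_chainSubgroup hE ⟨_, _, _, _, _, h1, e.reverse.mem_cut⟩ h1.src_eq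
    h2.src_eq (e.dart_ne e' hne h1 h2) ⟨_, _, e.reverse.φMinus_apply h1 c.swap⟩ ?_
  rw [h]
  exact ⟨_, _, e'.φMinus_apply h2 c'⟩

/-- Without exceptional pieces, a conjugacy between m-arc-generators crosses at most two tori,
since in each piece conjugate elements of chains are equal, and an element crossing a third torus
would lie over the fibres on both sides of the second one. -/
theorem eq_or_oneStep_or_twoStep (hE : ∀ v, ¬ Γ.IsNode v → Γ.euler v ≤ -2)
    (hcut : ∀ N : Γ.Node, ∃ e, S.IsTorusDart N e) (hexc : ∀ v, ¬ Γ.IsExceptional v)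
    {w w' : S.Word₀} (hw : w.2 ≠ 1) (harc : S.IsMArcGenerator w) (harc' : S.IsMArcGenerator w')
    (h : EllConj w w') : w = w' ∨ S.OneStep w w' ∨ S.TwoStep w w' := by
  have hchain : ∀ {N N' : Γ.Node} (e : S.Edge N N') c,
      ∃ d, Γ.src d = N.1 ∧ e.φMinus c ∈ S.chainSubgroup N d := by
    intro N N' e c
    obtain ⟨d₁, R, R', W, W', h1⟩ := exists_out_of_mem_cut e.src_mem e.mem_cut
    exact ⟨d₁, h1.src_eq, _, _, e.φMinus_apply h1 c⟩
  have hmarc : ∀ {w : S.Word₀}, S.IsMArcGenerator w →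
      ∃ d, Γ.src d = w.1.1 ∧ w.2 ∈ S.chainSubgroup w.1 d := fun {w} hw =>
    exists_mem_chainSubgroup (hcut w.1).choose_spec rfl hw
  have heq : ∀ {N : Γ.Node} {g g' : S.G N}, (∃ d, Γ.src d = N.1 ∧ g ∈ S.chainSubgroup N d) →
      (∃ d, Γ.src d = N.1 ∧ g' ∈ S.chainSubgroup N d) → IsConj g g' → g = g' := fun {N} _ _ =>
    eq_of_isConj_of_mem_chainSubgroup hE (hcut N).choose_spec (hexc _)
  -- the alternatives describe a conjugacy which has crossed no torus, one torus, or two tori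
  have key : ∃ g₀, IsConj g₀ w'.2 ∧ (∃ d, Γ.src d = w'.1.1 ∧ g₀ ∈ S.chainSubgroup w'.1 d) ∧
      (⟨w'.1, g₀⟩ = w ∨
      (∃ (e : S.Edge w.1 w'.1) (c : _), e.φMinus c = w.2 ∧ e.φPlus c = g₀) ∨
      ∃ (M : Γ.Node) (e₀ : S.Edge w.1 M) (e₁ : S.Edge M w'.1) (c₀ c₁ : _),
        e₁.dart ≠ Γ.rev e₀.dart ∧ e₀.φMinus c₀ = w.2 ∧ e₀.φPlus c₀ = e₁.φMinus c₁ ∧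
        e₁.φPlus c₁ = g₀) := by
    clear harc'
    induction h with
    | refl => exact ⟨_, IsConj.refl _, hmarc harc, Or.inl rfl⟩
    | conj _ hc ih =>
      obtain ⟨g₀, h1, h2⟩ := ih
      exact ⟨g₀, h1.trans hc, h2⟩
    | @edge N N' e c _ ih =>
      refine ⟨_, IsConj.refl _, hchain e.reverse c.swap, ?_⟩
      obtain ⟨g₀, h1, hg, h2⟩ := ih
      simp only at h1 h2
      obtain rfl := heq hg (hchain e c) h1
      rcases h2 with rfl | ⟨e₀, c₀, h2, h3⟩ | ⟨M, e₀, e₁, c₀, c₁, hne, h2, h3, h4⟩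
      · exact Or.inr (Or.inl ⟨e, c, rfl, rfl⟩)
      · by_cases hb : e.dart = Γ.rev e₀.dart
        · left
          have hN : w.1 = N' := eq_of_mem_piece (x := Γ.tgt e.dart)
            (by rw [hb, tgt_rev]; exact e₀.src_mem) e.tgt_mem
          obtain ⟨N₀, g⟩ := w
          simp only at hN
          subst hN
          obtain rfl : e = e₀.reverse := Edge.ext_dart hb
          rw [e₀.φMinus_reverse] at h3
          obtain rfl := e₀.φPlus_injective hE h3
          simp only at h2
          rw [e₀.φPlus_reverse, h2]
        · exact Or.inr (Or.inr ⟨N, e₀, e, c₀, c, hb, h2, h3, rfl⟩)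
      · by_cases hb : e.dart = Γ.rev e₁.dart
        · right; left
          obtain rfl := eq_of_mem_piece (x := Γ.tgt e.dart)
            (by rw [hb, tgt_rev]; exact e₁.src_mem) e.tgt_mem
          obtain rfl : e = e₁.reverse := Edge.ext_dart hb
          rw [e₁.φMinus_reverse] at h4
          obtain rfl := e₁.φPlus_injective hE h4
          exact ⟨e₀, c₀, h2, by rw [h3, e₁.φPlus_reverse]⟩
        · exfalso
          have h5 := Edge.mem_zpowers_of_eq hE e₀ e₁ hne h3
          have h6 := Edge.mem_zpowers_of_eq hE e₁ e hb h4
          rw [h3] at h5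
          obtain rfl := Edge.eq_one_of_mem_zpowers hE h5 h6
          rw [map_one, ← map_one e₀.φPlus] at h3
          obtain rfl := e₀.φPlus_injective hE h3
          exact hw (by rw [← h2, map_one])
  obtain ⟨g₀, h1, h2, h3⟩ := key
  obtain rfl := heq h2 (hmarc harc') h1
  rcases h3 with h3 | ⟨e, c, h3, h4⟩ | ⟨M, e₀, e₁, c₀, c₁, hne, h3, h4, h5⟩
  · exact Or.inl h3.symm
  · refine Or.inr (Or.inl ⟨e, c, h3, h4, ?_⟩)
    rw [← h3, ← h4]
    by_contra hcon
    rw [not_or] at hcon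
    have h5 := not_imp_comm.1 (e.isPure_φMinus hE c) hcon.1
    have h6 := not_imp_comm.1 (e.isPure_φPlus hE c) hcon.2
    obtain rfl := Edge.eq_one_of_mem_zpowers hE h5 h6
    exact hw (by rw [← h3, map_one])
  · have h6 := Edge.mem_zpowers_of_eq hE e₀ e₁ hne h4
    have h7 : c₀ ≠ 1 := by
      rintro rfl
      exact hw (by rw [← h3, map_one])
    have h8 : c₁ ≠ 1 := by
      rintro rfl
      rw [map_one, ← map_one e₀.φPlus] at h4
      exact h7 (e₀.φPlus_injective hE h4)
    refine Or.inr (Or.inr ⟨M, e₀, e₁, _, c₀, c₁, hne, h3, rfl, h4.symm, h5, ?_, ?_⟩)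
    · rw [← h3]
      exact e₀.isPure_φMinus hE c₀ fun h => h7 (Edge.eq_one_of_mem_zpowers hE h h6)
    · rw [← h5]
      rw [h4] at h6
      exact e₁.isPure_φPlus hE c₁ fun h => h8 (Edge.eq_one_of_mem_zpowers hE h6 h)

end JSJCut

end PlumbingGraph

/-! ### Coordinates of arc-generators -/

namespace PlumbingGraph

namespace JSJCut

variable {V D : Type*} [Fintype D] [LinearOrder D] {Γ : PlumbingGraph V D} {S : Γ.JSJCut}
  {N N' : Γ.Node} {d d' d₀ e : D} {P P' Q Q' R R' W W' α ω a b m n m' n' k : ℤ} {x : V}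
  {g : S.G N} {A A' : ArcGen V D}

/-- The coordinates of an arc-generator of a piece other than the powers of the fibre of the node.
It is `γ_u ^ m * γ_y ^ n`, where `d` runs from `u` to `y` and points away from the node; `m = 0`
for a power of a fibre. -/
inductive ArcData (S : Γ.JSJCut) : ArcGen V D → D → ℤ → ℤ → Prop
  | edge {d : D} (m n : ℕ+) : ArcData S (.edge d m n) d (m : ℕ) (n : ℕ)
  | rev {d : D} (m n : ℕ+) : d ∉ S.cut → ArcData S (.edge (Γ.rev d) n m) d (m : ℕ) (n : ℕ)
  | vertex {d : D} (n : ℕ+) : d ∉ S.cut → ArcData S (.vertex (Γ.tgt d) n) d 0 (n : ℕ)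

theorem ArcData.nonneg_pos (h : ArcData S A d m n) : 0 ≤ m ∧ 0 < n := by
  cases h with
  | edge m n => exact ⟨by positivity, by exact_mod_cast n.pos⟩
  | rev m n => exact ⟨by positivity, by exact_mod_cast n.pos⟩
  | vertex n => exact ⟨le_rfl, by exact_mod_cast n.pos⟩

theorem ArcData.eq_edge (h : ArcData S A d m n) (hd : d ∈ S.cut) :
    ∃ m' n' : ℕ+, A = .edge d m' n' ∧ m = (m' : ℕ) ∧ n = (n' : ℕ) := by
  cases h with
  | edge m n => exact ⟨m, n, rfl, rfl, rfl⟩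
  | rev m n h => exact absurd hd h
  | vertex n h => exact absurd hd h

theorem ArcData.sameArc (h : ArcData S A d m n) (h' : ArcData S A' d' m' n') (hd : d = d')
    (hm : m = m') (hn : n = n') : Γ.SameArc A A' := by
  subst hd
  cases h with
  | edge m n =>
    cases h' with
    | edge m' n' =>
      obtain rfl := PNat.coe_injective (Nat.cast_injective hm)
      obtain rfl := PNat.coe_injective (Nat.cast_injective hn)
      exact Or.inl rfl
    | rev m' n' =>
      obtain rfl := PNat.coe_injective (Nat.cast_injective hm)
      obtain rfl := PNat.coe_injective (Nat.cast_injective hn)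
      exact Or.inr ⟨_, _, _, rfl, rfl⟩
    | vertex n' => exact absurd hm (by exact_mod_cast m.ne_zero)
  | rev m n =>
    cases h' with
    | edge m' n' =>
      obtain rfl := PNat.coe_injective (Nat.cast_injective hm)
      obtain rfl := PNat.coe_injective (Nat.cast_injective hn)
      exact Or.inr ⟨_, _, _, rfl, by rw [Γ.rev_rev]⟩
    | rev m' n' =>
      obtain rfl := PNat.coe_injective (Nat.cast_injective hm)
      obtain rfl := PNat.coe_injective (Nat.cast_injective hn)
      exact Or.inl rfl
    | vertex n' => exact absurd hm (by exact_mod_cast m.ne_zero)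
  | vertex n =>
    cases h' with
    | edge m' n' => exact absurd hm.symm (by exact_mod_cast m'.ne_zero)
    | rev m' n' => exact absurd hm.symm (by exact_mod_cast m'.ne_zero)
    | vertex n' =>
      obtain rfl := PNat.coe_injective (Nat.cast_injective hn)
      exact Or.inl rfl

theorem Represents.exists_arcData (h : S.Represents ⟨N, g⟩ A) :
    (∃ m : ℕ+, A = .vertex N.1 m ∧ g = S.fib N N.1 ^ ((m : ℕ) : ℤ)) ∨
    ∃ d₀ d P P' Q Q' m n, S.Out N d₀ d P P' Q Q' ∧ ArcData S A d m n ∧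
      g = S.head N d₀ ^ (m * P + n * P') * S.fib N N.1 ^ (-(m * Q + n * Q')) := by
  cases A with
  | vertex x m =>
    obtain ⟨hx, hg⟩ := h
    simp only at hx hg
    rw [← fib_eq] at hg
    rcases mem_piece hx with rfl | ⟨d₀, d, P, P', Q, Q', h, hc, rfl⟩
    · exact Or.inl ⟨m, rfl, by rw [hg, zpow_natCast]⟩
    · refine Or.inr ⟨d₀, d, P, P', Q, Q', _, _, h, .vertex m hc, ?_⟩
      rw [hg, ← h.zpow_mul_zpow, zpow_zero, one_mul, zpow_natCast, head_eq_fib h.src_mem hc]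
  | edge d m n =>
    obtain ⟨hx, hg⟩ := h
    simp only at hx hg
    rw [← fib_eq, ← head_eq] at hg
    rcases out_or_out_rev hx with ⟨d₀, P, P', Q, Q', h⟩ | ⟨hc, d₀, P, P', Q, Q', h⟩
    · refine Or.inr ⟨d₀, d, P, P', Q, Q', _, _, h, .edge m n, ?_⟩
      rw [hg, ← h.zpow_mul_zpow, zpow_natCast, zpow_natCast]
    · have hc' : Γ.rev d ∉ S.cut := mt S.rev_mem_cut_iff.1 hc
      refine Or.inr ⟨d₀, Γ.rev d, P, P', Q, Q', (n : ℕ), (m : ℕ), h, ?_, ?_⟩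
      · have := ArcData.rev (S := S) n m hc'
        rwa [Γ.rev_rev] at this
      · have h1 : S.head N d = S.fib N (Γ.src (Γ.rev d)) := head_eq_fib hx hc
        have h2 : S.fib N (Γ.src d) = S.head N (Γ.rev d) := by
          rw [head_eq_fib h.src_mem hc', tgt_rev]
        have h3 : Commute (S.fib N (Γ.src d)) (S.head N d) := by
          rw [fib_eq hx, head_eq hx]
          exact S.commute_γ d hx
        rw [hg, ← h.zpow_mul_zpow, ← h1, ← h2, zpow_natCast, zpow_natCast, (h3.pow_pow _ _).eq]

/-- An element with nonnegative coordinates at an edge of a chain has, at a later edge, a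
nonpositive second coordinate, and a larger first coordinate. -/
theorem Out.compare (hE : ∀ v, ¬ Γ.IsNode v → Γ.euler v ≤ -2) (h : S.Out N d₀ d P P' Q Q')
    (h' : S.Out N d₀ d' R R' W W') (hdd : Relation.ReflTransGen S.PieceStep d d')
    (hm : 0 ≤ m) (hn : 0 < n) (h1 : m * P + n * P' = m' * R + n' * R')
    (h2 : m * Q + n * Q' = m' * W + n' * W') :
    (d = d' ∧ m = m' ∧ n = n') ∨ (0 < m' ∧ n' ≤ 0 ∧ 0 < m' + n') := by
  obtain ⟨R, R', W, W', h3, h4⟩ := h.later hE hdd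
  obtain ⟨-, -, rfl, rfl, rfl, rfl⟩ := h3.unique h'
  have hdet := h'.det
  have hm' : m' = m * (W' * P - R' * Q) + n * (W' * P' - R' * Q') := by
    linear_combination W' * (-h1) + R' * h2 - m' * hdet
  have hn' : n' = -(m * (W * P - R * Q) + n * (W * P' - R * Q')) := by
    linear_combination W * h1 - R * h2 - n' * hdet
  rcases h4 with ⟨rfl, rfl, rfl, rfl, rfl⟩ | ⟨h4, h5, h6, h7⟩
  · left
    refine ⟨rfl, ?_, ?_⟩
    · rw [hm']; linear_combination -m * hdet
    · rw [hn']; linear_combination -n * hdet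
  · right
    refine ⟨?_, ?_, ?_⟩
    · rw [hm']; nlinarith
    · rw [hn']; nlinarith
    · rw [hm', hn']; nlinarith

theorem IsLegDart.zpow_mul_zpow (h : S.IsLegDart N d₀ x α ω) (a b : ℤ) :
    S.head N d₀ ^ a * S.fib N N.1 ^ b = S.fib N x ^ (a * ω + b * α) := by
  rw [h.fib_pow.1, h.fib_pow.2.1, ← zpow_mul, ← zpow_mul, ← zpow_add]
  congr 1; ring

/-- Along a chain without arrow, an element with nonnegative coordinates is a positive power of the
fibre of the end vertex. -/
theorem Out.leg_exponent_pos (hE : ∀ v, ¬ Γ.IsNode v → Γ.euler v ≤ -2)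
    (h : S.Out N d₀ d P P' Q Q') (hl : S.IsLegDart N d₀ x α ω) (hm : 0 ≤ m) (hn : 0 < n) :
    0 < (m * P + n * P') * ω + -(m * Q + n * Q') * α := by
  obtain ⟨d', R, R', W, W', h', hc, hv, rfl, rfl, rfl⟩ := hl
  have he := hE _ (h'.not_isNode_tgt hc)
  obtain ⟨R, R', W, W', h3, h4⟩ := h.later hE (h.reflTransGen_terminal h' (Or.inr ⟨hc, hv⟩))
  obtain ⟨-, -, rfl, rfl, rfl, rfl⟩ := h3.unique h'
  have hdet := h'.det
  generalize Γ.euler (Γ.tgt d') = ε at *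
  have hX : 0 < -ε * (W' * P - R' * Q) - (W * P - R * Q) := by
    rcases h4 with ⟨rfl, rfl, rfl, rfl, rfl⟩ | ⟨h4, h5, h6, h7⟩ <;> nlinarith
  have hY : 0 < -ε * (W' * P' - R' * Q') - (W * P' - R * Q') := by
    rcases h4 with ⟨rfl, rfl, rfl, rfl, rfl⟩ | ⟨h4, h5, h6, h7⟩ <;> nlinarith
  have := mul_nonneg hm hX.le
  have := mul_pos hn hY
  linarith

end JSJCut

end PlumbingGraph

/-! ### Arc-generators in boundary tori -/

namespace PlumbingGraph

namespace JSJCut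

variable {V D : Type*} [Fintype D] [LinearOrder D] {Γ : PlumbingGraph V D} {S : Γ.JSJCut}
  {N N' : Γ.Node} {d d' d₀ e₀ : D} {P P' Q Q' R R' W W' α ω a b m n m' n' k : ℤ} {x : V}
  {g : S.G N} {A A' : ArcGen V D}

theorem exists_out_edge (e : S.Edge N N') : ∃ z : D × ℤ × ℤ × ℤ × ℤ,
    S.Out N z.1 e.dart z.2.1 z.2.2.1 z.2.2.2.1 z.2.2.2.2 := by
  obtain ⟨d₀, P, P', Q, Q', h⟩ := exists_out_of_mem_cut e.src_mem e.mem_cut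
  exact ⟨⟨d₀, P, P', Q, Q'⟩, h⟩

/-- The exponent, in an element of a boundary torus, of the second fibre of the chain of the
torus, the other generator being the fibre of the node. -/
noncomputable def Edge.exponent (e : S.Edge N N') (c : EdgeGroup) : ℤ :=
  c.1.toAdd * (exists_out_edge e).choose.2.1 + c.2.toAdd * (exists_out_edge e).choose.2.2.1

theorem Edge.exponent_eq {e : S.Edge N N'} (h : S.Out N d₀ e.dart P P' Q Q') (c : EdgeGroup) :
    e.exponent c = c.1.toAdd * P + c.2.toAdd * P' := by
  obtain ⟨-, -, h1, h2, -⟩ := h.unique (exists_out_edge e).choose_spec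
  rw [exponent, ← h1, ← h2]

theorem Edge.exponent_reverse_pos (hE : ∀ v, ¬ Γ.IsNode v → Γ.euler v ≤ -2) (e : S.Edge N N')
    {c : EdgeGroup} (h1 : 0 < c.1.toAdd) (h2 : 0 < c.1.toAdd + c.2.toAdd) :
    0 < e.reverse.exponent c.swap := by
  obtain ⟨d₁, R, R', W, W', h⟩ := exists_out_of_mem_cut e.reverse.src_mem e.reverse.mem_cut
  rw [Edge.exponent_eq h]
  obtain ⟨h3, h4, -⟩ := h.bounds hE
  simp only [Prod.fst_swap, Prod.snd_swap]
  nlinarith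

/-- When an element of a torus is replaced by a different conjugate one, the exponent changes its
sign, and the exponent on the other side of the torus grows. -/
theorem Edge.exponent_of_isConj (hE : ∀ v, ¬ Γ.IsNode v → Γ.euler v ≤ -2)
    (hK : ∀ (N : Γ.Node) e, S.IsKleinPiece N e → Γ.euler N.1 ≤ -2) (e : S.Edge N N')
    {c c' : EdgeGroup} (h : IsConj (e.φMinus c) (e.φMinus c')) :
    c' = c ∨ e.exponent c ≠ 0 ∧ e.exponent c' = -e.exponent c ∧ (0 ≤ e.exponent c →
      e.reverse.exponent c.swap + 2 * e.exponent c ≤ e.reverse.exponent c'.swap) := by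
  obtain ⟨d₀, P, P', Q, Q', h1⟩ := exists_out_of_mem_cut e.src_mem e.mem_cut
  obtain ⟨d₁, R, R', W, W', h2⟩ := exists_out_of_mem_cut e.reverse.src_mem e.reverse.mem_cut
  have h' := h
  rw [e.φMinus_apply h1, e.φMinus_apply h1] at h
  rcases chain_conj hE ⟨_, _, _, _, _, h1, e.mem_cut⟩ h1.src_eq h1.src_eq h with
    h3 | ⟨-, -, hk, h3, h4⟩
  · left
    rw [← e.φMinus_apply h1, ← e.φMinus_apply h1] at h3
    exact e.φMinus_injective hE h3.1
  · refine or_iff_not_imp_left.2 fun hne => ?_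
    rw [Edge.exponent_eq h1, Edge.exponent_eq h1, Edge.exponent_eq h2, Edge.exponent_eq h2]
    refine ⟨fun ha => hne ?_, h3, fun ha => ?_⟩
    · rw [ha, neg_zero] at h3
      rw [ha, mul_zero, zero_mul, add_zero] at h4
      apply e.φMinus_injective hE
      rw [e.φMinus_apply h1, e.φMinus_apply h1, h3, h4, ha]
    obtain ⟨h5, h6, h7, h8⟩ := h1.bounds hE
    obtain ⟨h9, h10, -⟩ := h2.bounds hE
    have hβ := hK _ _ hk
    have hdet := h1.det
    simp only [Prod.fst_swap, Prod.snd_swap]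
    generalize c.1.toAdd = m at *
    generalize c.2.toAdd = n at *
    generalize c'.1.toAdd = m' at *
    generalize c'.2.toAdd = n' at *
    generalize Γ.euler N.1 = ε at *
    -- the exponents on the other side are linear in the exponents on this side
    have hL : ∀ m n : ℤ, n * R + m * R' = (m * P + n * P') * (Q' * R' - Q * R) +
        -(m * Q + n * Q') * (P' * R' - P * R) := by
      intro m n
      linear_combination (-(n * R) - m * R') * hdet
    have hZ : 1 ≤ (P' * R' - P * R) - (Q' * R' - Q * R) := by
      have h11 : R' - R ≥ 1 := by omega
      nlinarith
    have hΔ : 0 < P' * R' - P * R := by nlinarith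
    have hβZ : 1 ≤ (-ε - 1) * (P' * R' - P * R) - (Q' * R' - Q * R) := by nlinarith
    rw [hL m n, hL m' n', h3, h4]
    have := mul_le_mul_of_nonneg_left hβZ ha
    linarith

theorem fib_zpow_eq_iff (hE : ∀ v, ¬ Γ.IsNode v → Γ.euler v ≤ -2) (he : S.IsTorusDart N e₀)
    {k l : ℤ} (h : S.fib N N.1 ^ k = S.fib N N.1 ^ l) : k = l := by
  refine (torus_injective hE he (a := 0) (a' := 0) ?_).2
  rw [h]

/-- An arc-generator which is a power of the fibre of the node is a positive power of it. -/
theorem Represents.pos_of_fib (hE : ∀ v, ¬ Γ.IsNode v → Γ.euler v ≤ -2)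
    (he : S.IsTorusDart N e₀) (h : S.Represents ⟨N, S.fib N N.1 ^ k⟩ A) : 0 < k := by
  rcases h.exists_arcData with ⟨m, -, hg⟩ | ⟨d₀, d, P, P', Q, Q', m, n, h1, h2, hg⟩
  · rw [fib_zpow_eq_iff hE he hg]
    exact_mod_cast m.pos
  · obtain ⟨hm, hn⟩ := h2.nonneg_pos
    rcases isTorusDart_or_isLegDart (S := S) h1.src_eq with h3 | ⟨x, α, ω, h3⟩
    · exfalso
      rw [← one_mul (S.fib N N.1 ^ k), ← zpow_zero (S.head N d₀)] at hg
      have := (torus_injective hE h3 hg).1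
      obtain ⟨h4, h5, -⟩ := h1.bounds hE
      nlinarith
    · have h4 := h1.leg_exponent_pos hE h3 hm hn
      rw [h3.zpow_mul_zpow, h3.fib_pow.1, ← zpow_mul] at hg
      have hc := IsConj.refl (S.fib N x ^ (α * k))
      nth_rewrite 2 [hg] at hc
      have h5 := h3.eq_of_isConj hE he hc
      have h6 := h3.two_le hE
      rw [← h5] at h4
      exact pos_of_mul_pos_right h4 (by omega)

/-- The coordinates of an arc-generator in a boundary torus of its piece: the coordinate of the
vertex is positive, and that of the arrowhead is smaller in absolute value, or positive; the latter
only for the arc-generators of the cutting edge. -/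
theorem Represents.torus_coordinates (hE : ∀ v, ¬ Γ.IsNode v → Γ.euler v ≤ -2)
    {e : S.Edge N N'} {c : EdgeGroup} (h : S.Represents ⟨N, e.φMinus c⟩ A) :
    0 < c.1.toAdd ∧ 0 < c.1.toAdd + c.2.toAdd ∧ 0 ≤ e.exponent c ∧ (c.2.toAdd ≤ 0 ∨
      ∃ m n : ℕ+, A = .edge e.dart m n ∧ c.1.toAdd = (m : ℕ) ∧ c.2.toAdd = (n : ℕ)) := by
  obtain ⟨e₁, R, R', W, W', h'⟩ := exists_out_of_mem_cut e.src_mem e.mem_cut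
  have he : S.IsTorusDart N e₁ := ⟨_, _, _, _, _, h', e.mem_cut⟩
  rw [Edge.exponent_eq h']
  have hdet := h'.det
  obtain ⟨hb1, hb2, -⟩ := h'.bounds hE
  have hfib : ∀ k : ℤ, e.φMinus c = S.fib N N.1 ^ k → 0 < c.1.toAdd ∧
      0 < c.1.toAdd + c.2.toAdd ∧ 0 ≤ c.1.toAdd * R + c.2.toAdd * R' ∧ c.2.toAdd ≤ 0 := by
    intro k hk
    rw [hk] at h
    have hk0 := h.pos_of_fib hE he
    rw [e.φMinus_apply h', ← one_mul (S.fib N N.1 ^ k), ← zpow_zero (S.head N e₁)] at hk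
    obtain ⟨h1, h2⟩ := torus_injective hE he hk
    have h3 : c.1.toAdd = k * R' := by
      linear_combination -c.1.toAdd * hdet + W' * h1 + R' * h2
    have h4 : c.2.toAdd = -(k * R) := by
      linear_combination -c.2.toAdd * hdet - W * h1 - R * h2
    refine ⟨?_, ?_, h1.ge, ?_⟩
    · rw [h3]; nlinarith
    · rw [h3, h4]; nlinarith
    · rw [h4]; nlinarith
  rcases h.exists_arcData with ⟨m, -, hg⟩ | ⟨d₀, d, P, P', Q, Q', m, n, h1, h2, hg⟩
  · obtain ⟨h3, h4, h5, h6⟩ := hfib _ hg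
    exact ⟨h3, h4, h5, Or.inl h6⟩
  · obtain ⟨hm, hn⟩ := h2.nonneg_pos
    by_cases hd : d₀ = e₁
    · subst hd
      rw [e.φMinus_apply h'] at hg
      obtain ⟨h3, h4⟩ := torus_injective hE he hg
      obtain ⟨hb3, hb4, -⟩ := h1.bounds hE
      have hpos : 0 ≤ c.1.toAdd * R + c.2.toAdd * R' := by
        rw [h3]; nlinarith
      rcases h1.compare hE h' (h1.reflTransGen_terminal h' (Or.inl e.mem_cut)) hm hn h3.symm
        (neg_injective h4.symm) with ⟨rfl, rfl, rfl⟩ | ⟨h5, h6, h7⟩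
      · obtain ⟨m, n, hA, h5, h6⟩ := h2.eq_edge e.mem_cut
        refine ⟨?_, ?_, hpos, Or.inr ⟨m, n, hA, h5, h6⟩⟩
        · rw [h5]; exact_mod_cast m.pos
        · rw [h5, h6]; exact_mod_cast (m + n).pos
      · exact ⟨h5, h7, hpos, Or.inl h6⟩
    · have h3 := mem_zpowers_of_mem_chainSubgroup hE he h1.src_eq h'.src_eq hd ⟨_, _, hg⟩
        (e.φMinus_mem_chainSubgroup h' c)
      obtain ⟨k, hk⟩ := Subgroup.mem_zpowers_iff.1 h3
      obtain ⟨h3, h4, h5, h6⟩ := hfib _ hk.symm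
      exact ⟨h3, h4, h5, Or.inl h6⟩

theorem Represents.exponent_reverse_pos (hE : ∀ v, ¬ Γ.IsNode v → Γ.euler v ≤ -2)
    {e : S.Edge N N'} {c : EdgeGroup} (h : S.Represents ⟨N, e.φMinus c⟩ A) :
    0 < e.reverse.exponent c.swap := by
  obtain ⟨h1, h2, -⟩ := h.torus_coordinates hE
  exact e.exponent_reverse_pos hE h1 h2

/-- Arc-generators that correspond to each other on the two sides of a torus. -/
theorem Represents.oppositeSides (hE : ∀ v, ¬ Γ.IsNode v → Γ.euler v ≤ -2)
    {e : S.Edge N N'} {c : EdgeGroup} (h : S.Represents ⟨N, e.φMinus c⟩ A)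
    (h' : S.Represents ⟨N', e.φPlus c⟩ A') : S.OppositeSides A A' := by
  have h' : S.Represents ⟨N', e.reverse.φMinus c.swap⟩ A' := h'
  obtain ⟨h1, -, -, h2⟩ := h.torus_coordinates hE
  obtain ⟨h3, -, -, h4⟩ := h'.torus_coordinates hE
  simp only [Prod.fst_swap, Prod.snd_swap] at h3 h4
  obtain ⟨m, n, rfl, h5, h6⟩ := h2.resolve_left (not_le.2 h3)
  obtain ⟨n', m', rfl, h7, h8⟩ := h4.resolve_left (not_le.2 h1)
  obtain rfl := PNat.coe_injective (Nat.cast_injective (h6.symm.trans h7))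
  obtain rfl := PNat.coe_injective (Nat.cast_injective (h5.symm.trans h8))
  exact ⟨e.dart, e.mem_cut, m, n, rfl, rfl⟩

/-- An arc-generator as an element of a chain. -/
theorem Represents.exists_chain (hE : ∀ v, ¬ Γ.IsNode v → Γ.euler v ≤ -2)
    (he : S.IsTorusDart N e₀) (h : S.Represents ⟨N, g⟩ A) : ∃ (d : D) (a b : ℤ), Γ.src d = N.1 ∧
      0 ≤ a ∧ g = S.head N d ^ a * S.fib N N.1 ^ b := by
  rcases h.exists_arcData with ⟨m, -, hg⟩ | ⟨d₀, d, P, P', Q, Q', m, n, h1, h2, hg⟩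
  · exact ⟨e₀, 0, (m : ℕ), he.src_eq, le_rfl, by rw [zpow_zero, one_mul, hg]⟩
  · obtain ⟨hm, hn⟩ := h2.nonneg_pos
    obtain ⟨hb3, hb4, -⟩ := h1.bounds hE
    exact ⟨d₀, m * P + n * P', _, h1.src_eq, by nlinarith, hg⟩

theorem Represents.eq_of_isConj (hE : ∀ v, ¬ Γ.IsNode v → Γ.euler v ≤ -2)
    (he : S.IsTorusDart N e₀) (h : S.Represents ⟨N, g⟩ A) {g' : S.G N}
    (h' : S.Represents ⟨N, g'⟩ A') (hc : IsConj g g') : g = g' := by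
  obtain ⟨d, a, b, hd, ha, rfl⟩ := h.exists_chain hE he
  obtain ⟨d', a', b', hd', ha', rfl⟩ := h'.exists_chain hE he
  rcases chain_conj hE he hd hd' hc with h1 | ⟨rfl, -, -, rfl, rfl⟩
  · exact h1.1.symm
  · obtain rfl : a = 0 := by omega
    simp

theorem Represents.eq_of_isConj_torus (hE : ∀ v, ¬ Γ.IsNode v → Γ.euler v ≤ -2)
    (h : S.Represents ⟨N, g⟩ A) {e : S.Edge N N'} {c : EdgeGroup} (hpos : 0 < e.exponent c)
    (hc : IsConj (e.φMinus c) g) : g = e.φMinus c := by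
  obtain ⟨e₁, R, R', W, W', h'⟩ := exists_out_of_mem_cut e.src_mem e.mem_cut
  have he : S.IsTorusDart N e₁ := ⟨_, _, _, _, _, h', e.mem_cut⟩
  obtain ⟨d, a, b, hd, ha, rfl⟩ := h.exists_chain hE he
  rw [Edge.exponent_eq h'] at hpos
  rw [e.φMinus_apply h'] at hc ⊢
  rcases chain_conj hE he he.src_eq hd hc with h1 | ⟨rfl, -, -, rfl, rfl⟩
  · exact h1.1
  · omega

end JSJCut

end PlumbingGraph

/-! ### Conjugate arc-generators -/

namespace PlumbingGraph

namespace JSJCut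

variable {V D : Type*} [Fintype D] [LinearOrder D] {Γ : PlumbingGraph V D} {S : Γ.JSJCut}
  {N N' : Γ.Node} {d d' d₀ e₀ : D} {P P' Q Q' R R' W W' α ω a b m n m' n' k : ℤ} {x : V}
  {g : S.G N} {A A' : ArcGen V D} {w w' : S.Word₀}

theorem Represents.exists_torus (hE : ∀ v, ¬ Γ.IsNode v → Γ.euler v ≤ -2)
    (h : S.Represents ⟨N, g⟩ A) {e : S.Edge N N'} {c : EdgeGroup}
    (hc : IsConj g (e.φMinus c)) : ∃ c₀, g = e.φMinus c₀ := by
  obtain ⟨e₁, R, R', W, W', h'⟩ := exists_out_of_mem_cut e.src_mem e.mem_cut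
  have he : S.IsTorusDart N e₁ := ⟨_, _, _, _, _, h', e.mem_cut⟩
  obtain ⟨d, a, b, hd, ha, hg⟩ := h.exists_chain hE he
  have hc' := hc
  rw [hg, e.φMinus_apply h'] at hc'
  rcases chain_conj hE he hd he.src_eq hc' with h1 | ⟨rfl, -⟩
  · refine ⟨c, ?_⟩
    rw [hg, e.φMinus_apply h', h1.1]
  · have hdet := h'.det
    refine ⟨(Multiplicative.ofAdd (W' * a + R' * b), Multiplicative.ofAdd (-(R * b + W * a))), ?_⟩
    rw [hg, e.φMinus_apply h']
    simp only [toAdd_ofAdd]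
    congr 2
    · linear_combination -a * hdet
    · linear_combination -b * hdet

theorem Edge.dart_eq_of_isConj (hE : ∀ v, ¬ Γ.IsNode v → Γ.euler v ≤ -2) {N'' : Γ.Node}
    (e : S.Edge N N') (e' : S.Edge N N'') {c c' : EdgeGroup}
    (h : IsConj (e.φMinus c) (e'.φMinus c')) (h0 : e.exponent c ≠ 0) : e'.dart = e.dart := by
  obtain ⟨d₁, P, P', Q, Q', h1⟩ := exists_out_of_mem_cut e.src_mem e.mem_cut
  obtain ⟨d₂, R, R', W, W', h2⟩ := exists_out_of_mem_cut e'.src_mem e'.mem_cut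
  by_cases hd : d₁ = d₂
  · subst hd
    exact h2.terminal_unique h1 (Or.inl e'.mem_cut) (Or.inl e.mem_cut)
  · exfalso
    rw [Edge.exponent_eq h1] at h0
    rw [e.φMinus_apply h1, e'.φMinus_apply h2] at h
    rcases chain_conj hE ⟨_, _, _, _, _, h1, e.mem_cut⟩ h1.src_eq h2.src_eq h with h3 | h3
    · have h4 := h3.2 hd
      rw [← e.φMinus_apply h1] at h4
      exact h0 (Edge.exponent_eq_zero hE h1 h4)
    · exact hd h3.1

/-- The elements of boundary tori that are met when a conjugacy starting with an arc-generator is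
followed from piece to piece. As long as the conjugating element is not trivial, the same torus is
crossed back and forth. -/
inductive TorusState (w : S.Word₀) : ∀ {N N' : Γ.Node}, S.Edge N N' → EdgeGroup → Prop
  | first {N' : Γ.Node} (e : S.Edge w.1 N') (c : EdgeGroup) :
      IsConj w.2 (e.φMinus c) → TorusState w e c
  | turn {N N' : Γ.Node} (e : S.Edge N N') (c c' : EdgeGroup) : TorusState w e c → c' ≠ c.swap →
      IsConj (e.φPlus c) (e.reverse.φMinus c') → TorusState w e.reverse c'

/-- The exponent on the far side of the torus stays positive, and the exponent on the near side
becomes negative with the first change of the element within its conjugacy class. -/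
theorem TorusState.exponent (hE : ∀ v, ¬ Γ.IsNode v → Γ.euler v ≤ -2)
    (hK : ∀ (N : Γ.Node) e, S.IsKleinPiece N e → Γ.euler N.1 ≤ -2) (hw : S.Represents w A)
    {e : S.Edge N N'} {c : EdgeGroup} (h : TorusState w e c) :
    0 < e.reverse.exponent c.swap ∧ 0 ≤ e.reverse.exponent c.swap + e.exponent c ∧
      (e.exponent c < 0 ∨ ⟨N, e.φMinus c⟩ = w) := by
  induction h with
  | first e c h =>
    obtain ⟨c₀, hc₀⟩ := hw.exists_torus hE h
    have hw' : S.Represents ⟨w.1, e.φMinus c₀⟩ A := by rw [← hc₀]; exact hw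
    obtain ⟨-, -, h1, -⟩ := hw'.torus_coordinates hE
    have h2 := hw'.exponent_reverse_pos hE
    rw [hc₀] at h
    rcases e.exponent_of_isConj hE hK h with rfl | ⟨h3, h4, h5⟩
    · exact ⟨h2, by omega, Or.inr (by rw [← hc₀])⟩
    · have := h5 h1
      exact ⟨by omega, by omega, Or.inl (by omega)⟩
  | turn e c c' _ hne h ih =>
    obtain ⟨h1, h2, -⟩ := ih
    rcases e.reverse.exponent_of_isConj hE hK (c := c.swap) h with h3 | ⟨h3, h4, h5⟩
    · exact absurd h3 hne
    · have := h5 h1.le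
      rw [e.reverse_reverse, Prod.swap_swap] at this
      rw [e.reverse_reverse]
      exact ⟨by omega, by omega, Or.inl (by omega)⟩

theorem EllConj.exists_torusState (hE : ∀ v, ¬ Γ.IsNode v → Γ.euler v ≤ -2)
    (hK : ∀ (N : Γ.Node) e, S.IsKleinPiece N e → Γ.euler N.1 ≤ -2) (hw : S.Represents w A)
    (h : EllConj w w') : (∃ g, ⟨w'.1, g⟩ = w ∧ IsConj g w'.2) ∨
      ∃ (N : Γ.Node) (e : S.Edge N w'.1) (c : _), TorusState w e c ∧ IsConj (e.φPlus c) w'.2 := by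
  induction h with
  | refl => exact Or.inl ⟨_, rfl, IsConj.refl _⟩
  | conj _ hc ih =>
    rcases ih with ⟨g, h1, h2⟩ | ⟨N, e, c, h1, h2⟩
    · exact Or.inl ⟨g, h1, h2.trans hc⟩
    · exact Or.inr ⟨N, e, c, h1, h2.trans hc⟩
  | edge e' c' _ ih =>
    rcases ih with ⟨g, rfl, h2⟩ | ⟨N, e, c, h1, h2⟩
    · exact Or.inr ⟨_, e', c', TorusState.first (w := ⟨_, g⟩) e' c' h2, IsConj.refl _⟩
    · simp only at e h1 h2
      obtain ⟨h3, -⟩ := h1.exponent hE hK hw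
      have hb := e.reverse.dart_eq_of_isConj hE e' (c := c.swap) h2 h3.ne'
      obtain rfl := eq_of_mem_piece (x := Γ.tgt e'.dart)
            (by rw [hb]; exact e.reverse.tgt_mem) e'.tgt_mem
      obtain rfl : e' = e.reverse := Edge.ext_dart hb
      by_cases hc : c' = c.swap
      · subst hc
        rw [e.φPlus_reverse, Prod.swap_swap]
        cases h1 with
        | first e c h => exact Or.inl ⟨_, rfl, h⟩
        | turn e c c' h _ hc => exact Or.inr ⟨_, e, c, h, hc⟩
      · exact Or.inr ⟨_, _, _, h1.turn e c c' hc h2, IsConj.refl _⟩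

/-- Conjugate arc-generators are equal, or the same arc-generator on the two sides of a torus. -/
theorem Represents.eq_or_oppositeSides (hE : ∀ v, ¬ Γ.IsNode v → Γ.euler v ≤ -2)
    (hK : ∀ (N : Γ.Node) e, S.IsKleinPiece N e → Γ.euler N.1 ≤ -2)
    (hcut : ∀ N : Γ.Node, ∃ e, S.IsTorusDart N e) (hw : S.Represents w A)
    (hw' : S.Represents w' A') (h : EllConj w w') : w = w' ∨ S.OppositeSides A A' := by
  rcases h.exists_torusState hE hK hw with ⟨g, rfl, h1⟩ | ⟨N, e, c, h1, h2⟩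
  · left
    obtain ⟨e, he⟩ := hcut w'.1
    rw [Represents.eq_of_isConj hE he hw hw' h1]
  · right
    obtain ⟨h3, -, h4⟩ := h1.exponent hE hK hw
    have h5 : w'.2 = e.reverse.φMinus c.swap := hw'.eq_of_isConj_torus hE h3 h2
    have h6 : S.Represents ⟨w'.1, e.reverse.φMinus c.swap⟩ A' := by rw [← h5]; exact hw'
    have h7 := h6.exponent_reverse_pos hE
    rw [e.reverse_reverse, Prod.swap_swap] at h7
    obtain rfl := h4.resolve_left h7.not_gt
    exact hw.oppositeSides hE h6

theorem Represents.not_twoStep (hE : ∀ v, ¬ Γ.IsNode v → Γ.euler v ≤ -2)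
    (hw : S.Represents w A) : ¬ S.TwoStep w w' := by
  rintro ⟨M, e₀, e₁, μ, c₀, c₁, hne, h1, h2, h3, -⟩
  have hw' : S.Represents ⟨w.1, e₀.φMinus c₀⟩ A := by rw [h1]; exact hw
  have h4 := hw'.exponent_reverse_pos hE
  obtain ⟨d₁, R, R', W, W', h⟩ := exists_out_of_mem_cut e₀.reverse.src_mem e₀.reverse.mem_cut
  rw [Edge.exponent_eq h] at h4
  exact h4.ne' (Edge.exponent_eq_zero hE h
    (Edge.mem_zpowers_of_eq hE e₀ e₁ hne (h2.trans h3.symm)))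

theorem Represents.not_oneStep (hE : ∀ v, ¬ Γ.IsNode v → Γ.euler v ≤ -2)
    (hw : S.Represents w A) (hw' : S.Represents w' A') (h : ¬ S.OppositeSides A A') :
    ¬ S.OneStep w w' := by
  rintro ⟨e, c, h1, h2, -⟩
  refine h (Represents.oppositeSides hE (e := e) (c := c) ?_ ?_)
  · rw [h1]; exact hw
  · rw [h2]; exact hw'

/-! ### Arc-generators on chains without arrow -/

/-- The consecutive oriented edges of a chain, up to a given one. -/
theorem Out.exists_list (h : S.Out N d₀ d P P' Q Q') : ∃ l : List D, l.IsChain Γ.Step ∧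
    l.head? = some d₀ ∧ l.getLast? = some d ∧
      ∀ d', Relation.ReflTransGen S.PieceStep d' d → Γ.src d₀ = N.1 → d' ∈ l := by
  induction h with
  | start h =>
    refine ⟨[d₀], by simp, rfl, rfl, fun d' hd' _ => ?_⟩
    rcases Relation.ReflTransGen.cases_tail hd' with rfl | ⟨b, -, hb⟩
    · simp
    · refine absurd N.2 ?_
      rw [← h, hb.2.2.1]
      exact hb.2.1
  | @step d d' _ _ _ _ h hs ih =>
    obtain ⟨l, h1, h2, h3, h4⟩ := ih
    refine ⟨l ++ [d'], ?_, ?_, by simp, fun d'' hd'' h0 => ?_⟩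
    · rw [List.isChain_append]
      refine ⟨h1, by simp, ?_⟩
      rw [h3]
      simpa using hs.2
    · rw [List.head?_append, h2]; rfl
    · rcases Relation.ReflTransGen.cases_tail hd'' with rfl | ⟨b, hb, hb'⟩
      · simp
      · obtain rfl := hb'.left_unique hs
        exact List.mem_append_left _ (h4 d'' hb h0)

theorem IsLegDart.exists_isLeg (h : S.IsLegDart N d₀ x α ω) : ∃ l, Γ.IsLeg N.1 l x ∧
    ∀ {d P P' Q Q'}, S.Out N d₀ d P P' Q Q' → d ∈ l := by
  obtain ⟨d, P, P', Q, Q', h, hd, hv, rfl, -, -⟩ := h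
  obtain ⟨l, h1, h2, h3, h4⟩ := h.exists_list
  refine ⟨l, ⟨?_, h1, ?_, ?_, h.not_isNode_tgt hd, hv⟩, fun h' =>
    h4 _ (h'.reflTransGen_terminal h (Or.inr ⟨hd, hv⟩)) h.src_eq⟩
  · rintro rfl; simp at h2
  · rw [h2]; simpa using h.src_eq
  · rw [h3]; simp

theorem ArcData.supported (h : ArcData S A d m n) {v : V} {l : List D} (hd : d ∈ l) :
    Γ.Supported v l A := by
  cases h with
  | edge m n => exact Or.inl hd
  | rev m n => exact Or.inr (by rwa [Γ.rev_rev])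
  | vertex n => exact Or.inr ⟨d, hd, rfl⟩

theorem IsLegDart.mem_piece (h : S.IsLegDart N d₀ x α ω) : x ∈ S.piece N := by
  obtain ⟨d, P, P', Q, Q', h, hd, hv, rfl, -, -⟩ := h
  exact S.tgt_mem hd h.src_mem

/-- An arc-generator on a chain without arrow is a positive power of the fibre of its end vertex. -/
theorem ArcData.exists_leg (hE : ∀ v, ¬ Γ.IsNode v → Γ.euler v ≤ -2)
    (h : S.Out N d₀ d P P' Q Q') (hl : S.IsLegDart N d₀ x α ω) (hA : ArcData S A d m n)
    (hg : g = S.head N d₀ ^ (m * P + n * P') * S.fib N N.1 ^ (-(m * Q + n * Q'))) :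
    ∃ r : ℕ, 0 < r ∧ g = S.γ x hl.mem_piece ^ r := by
  obtain ⟨hm, hn⟩ := hA.nonneg_pos
  have h1 := h.leg_exponent_pos hE hl hm hn
  obtain ⟨r, hr⟩ := Int.eq_ofNat_of_zero_le h1.le
  rw [hl.zpow_mul_zpow, hr, zpow_natCast, fib_eq hl.mem_piece] at hg
  exact ⟨r, by omega, hg⟩

theorem ArcData.isLegDart_of_mem_zpowers (hE : ∀ v, ¬ Γ.IsNode v → Γ.euler v ≤ -2)
    (h : S.Out N d₀ d P P' Q Q') (hA : ArcData S A d m n)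
    (hg : g = S.head N d₀ ^ (m * P + n * P') * S.fib N N.1 ^ (-(m * Q + n * Q')))
    (hz : g ∈ Subgroup.zpowers (S.fib N N.1)) : ∃ x α ω, S.IsLegDart N d₀ x α ω := by
  refine (isTorusDart_or_isLegDart h.src_eq).resolve_left fun ht => ?_
  obtain ⟨k, hk⟩ := Subgroup.mem_zpowers_iff.1 hz
  rw [← hk, ← one_mul (S.fib N N.1 ^ k), ← zpow_zero (S.head N d₀)] at hg
  have h1 := (torus_injective hE ht hg).1
  obtain ⟨hm, hn⟩ := hA.nonneg_pos
  obtain ⟨h2, h3, -⟩ := h.bounds hE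
  nlinarith

/-- The coordinates determine an arc-generator on the chain of a torus. -/
theorem ArcData.sameArc_of_torus (hE : ∀ v, ¬ Γ.IsNode v → Γ.euler v ≤ -2)
    (h : S.Out N d₀ d P P' Q Q') (h' : S.Out N d₀ d' R R' W W') (hA : ArcData S A d m n)
    (hA' : ArcData S A' d' m' n') (h1 : m * P + n * P' = m' * R + n' * R')
    (h2 : m * Q + n * Q' = m' * W + n' * W') : Γ.SameArc A A' := by
  obtain ⟨hm, hn⟩ := hA.nonneg_pos
  obtain ⟨hm', hn'⟩ := hA'.nonneg_pos
  rcases h.total h' with ht | ht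
  · rcases h.compare hE h' ht hm hn h1 h2 with ⟨h3, h4, h5⟩ | h3
    · exact hA.sameArc hA' h3 h4 h5
    · omega
  · rcases h'.compare hE h ht hm' hn' h1.symm h2.symm with ⟨h3, h4, h5⟩ | h3
    · exact hA.sameArc hA' h3.symm h4.symm h5.symm
    · omega

/-- Different arc-generators of a piece which are equal as elements lie on chains without arrow. -/
theorem Represents.exists_legs (hE : ∀ v, ¬ Γ.IsNode v → Γ.euler v ≤ -2)
    (he : S.IsTorusDart N e₀) (h : S.Represents ⟨N, g⟩ A) (h' : S.Represents ⟨N, g⟩ A')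
    (hne : ¬ Γ.SameArc A A') :
    ∃ (l l' : List D) (x x' : V) (hx : x ∈ S.piece N) (hx' : x' ∈ S.piece N),
      Γ.IsLeg N.1 l x ∧ Γ.IsLeg N.1 l' x' ∧ Γ.Supported N.1 l A ∧ Γ.Supported N.1 l' A' ∧
      (∃ r : ℕ, 0 < r ∧ g = S.γ x hx ^ r) ∧ (∃ r : ℕ, 0 < r ∧ g = S.γ x' hx' ^ r) ∧
      (l = l' ∨ ∃ n : ℕ, 0 < n ∧ g = S.γ N.1 (S.node_mem N) ^ n) := by
  have hrep := h
  rcases h.exists_arcData with ⟨m, rfl, hg⟩ | ⟨d₁, d, P, P', Q, Q', m, n, h1, hA, hg⟩ <;>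
  rcases h'.exists_arcData with ⟨m', rfl, hg'⟩ | ⟨d₁', d', R, R', W, W', m', n', h1', hA', hg'⟩
  · refine absurd (Or.inl ?_) hne
    rw [PNat.coe_injective (Nat.cast_injective (fib_zpow_eq_iff hE he (hg.symm.trans hg')))]
  · obtain ⟨x, α, ω, hl⟩ := hA'.isLegDart_of_mem_zpowers hE h1' hg' ⟨_, hg.symm⟩
    obtain ⟨l, hl1, hl2⟩ := hl.exists_isLeg
    have hr := hA'.exists_leg hE h1' hl hg'
    exact ⟨l, l, x, x, _, _, hl1, hl1, Or.inl rfl, hA'.supported (hl2 h1'), hr, hr, Or.inl rfl⟩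
  · obtain ⟨x, α, ω, hl⟩ := hA.isLegDart_of_mem_zpowers hE h1 hg ⟨_, hg'.symm⟩
    obtain ⟨l, hl1, hl2⟩ := hl.exists_isLeg
    have hr := hA.exists_leg hE h1 hl hg
    exact ⟨l, l, x, x, _, _, hl1, hl1, hA.supported (hl2 h1), Or.inl rfl, hr, hr, Or.inl rfl⟩
  · by_cases hd : d₁ = d₁'
    · subst hd
      rcases isTorusDart_or_isLegDart (S := S) h1.src_eq with ht | ⟨x, α, ω, hl⟩
      · obtain ⟨h2, h3⟩ := torus_injective hE ht (hg.symm.trans hg')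
        exact absurd (hA.sameArc_of_torus hE h1 h1' hA' h2 (neg_injective h3)) hne
      · obtain ⟨l, hl1, hl2⟩ := hl.exists_isLeg
        exact ⟨l, l, x, x, _, _, hl1, hl1, hA.supported (hl2 h1), hA'.supported (hl2 h1'),
          hA.exists_leg hE h1 hl hg, hA'.exists_leg hE h1' hl hg', Or.inl rfl⟩
    · have hz := mem_zpowers_of_mem_chainSubgroup hE he h1.src_eq h1'.src_eq hd ⟨_, _, hg⟩
        ⟨_, _, hg'⟩
      obtain ⟨x, α, ω, hl⟩ := hA.isLegDart_of_mem_zpowers hE h1 hg hz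
      obtain ⟨l, hl1, hl2⟩ := hl.exists_isLeg
      obtain ⟨x', α', ω', hl'⟩ := hA'.isLegDart_of_mem_zpowers hE h1' hg' hz
      obtain ⟨l', hl1', hl2'⟩ := hl'.exists_isLeg
      refine ⟨l, l', x, x', _, _, hl1, hl1', hA.supported (hl2 h1), hA'.supported (hl2' h1'),
        hA.exists_leg hE h1 hl hg, hA'.exists_leg hE h1' hl' hg', Or.inr ?_⟩
      obtain ⟨k, hk⟩ := Subgroup.mem_zpowers_iff.1 hz
      subst hk
      have hk := hrep.pos_of_fib hE he
      obtain ⟨r, rfl⟩ := Int.eq_ofNat_of_zero_le hk.le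
      exact ⟨r, by omega, by rw [zpow_natCast, fib_eq]⟩

end JSJCut

end PlumbingGraph

theorem mainTheorem7 {V D : Type*} [Fintype V] [Fintype D] [LinearOrder D]
    (Γ : PlumbingGraph V D) (hconn : Γ.IsConnected)
    (hneg : (-Γ.intersectionMatrix).PosDef) (hmin : Γ.IsMinimal)
    (hchain : ∃ l, Γ.IsNodeChain l)
    (S : Γ.JSJCut) (T : S.MaximalTree) (w w' : S.Word₀)
    (hw : S.IsCyclicallyReduced w)
    (hw' : S.IsCyclicallyReduced w')
    (hconj : IsConj (T.label w) (T.label w')) :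
    ((∀ v, ¬ Γ.IsExceptional v) →
      S.IsMArcGenerator w → S.IsMArcGenerator w' →
        w = w' ∨ S.OneStep w w' ∨ S.TwoStep w w') ∧
    (∀ A A' : PlumbingGraph.ArcGen V D,
      S.Represents w A → S.Represents w' A' →
        ¬ S.TwoStep w w' ∧
        (¬ S.OppositeSides A A' → ¬ S.OneStep w w' ∧ w = w') ∧
        (¬ Γ.SameArc A A' →
          ∃ (l l' : List D) (x x' : V) (hx : x ∈ S.piece w.1) (hx' : x' ∈ S.piece w.1),
            Γ.IsLeg w.1 l x ∧ Γ.IsLeg w.1 l' x' ∧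
            Γ.Supported w.1 l A ∧ Γ.Supported w.1 l' A' ∧
            (∃ r : ℕ, 0 < r ∧ w.2 = S.γ x hx ^ r) ∧
            (∃ r : ℕ, 0 < r ∧ w.2 = S.γ x' hx' ^ r) ∧
            (l = l' ∨ ∃ n : ℕ, 0 < n ∧ w.2 = S.γ w.1.1 (S.node_mem w.1) ^ n))) := by
  have hE : ∀ v, ¬ Γ.IsNode v → Γ.euler v ≤ -2 := fun v => PlumbingGraph.JSJCut.euler_le hneg hmin
  have hK : ∀ (N : Γ.Node) e, S.IsKleinPiece N e → Γ.euler N.1 ≤ -2 :=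
    fun N e h => h.euler_le hneg hE
  have hcut : ∀ N : Γ.Node, ∃ e, S.IsTorusDart N e := fun N =>
    let ⟨_, hd, h⟩ := PlumbingGraph.JSJCut.exists_cut hconn hchain N
    PlumbingGraph.JSJCut.IsTorusDart.of_mem_cut hd h
  have hell := PlumbingGraph.JSJCut.ellConj_of_isConj_label hE T hconj
  refine ⟨fun hexc harc harc' =>
    PlumbingGraph.JSJCut.eq_or_oneStep_or_twoStep hE hcut hexc hw harc harc' hell,
    fun A A' hA hA' => ⟨hA.not_twoStep hE, fun hop => ⟨hA.not_oneStep hE hA' hop,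
      (hA.eq_or_oppositeSides hE hK hcut hA' hell).resolve_right hop⟩, fun hne => ?_⟩⟩
  have hop : ¬ S.OppositeSides A A' := by
    rintro ⟨d, -, m, n, h, h'⟩
    exact hne (Or.inr ⟨d, m, n, h, h'⟩)
  obtain rfl := (hA.eq_or_oppositeSides hE hK hcut hA' hell).resolve_right hop
  obtain ⟨e, he⟩ := hcut w.1
  exact PlumbingGraph.JSJCut.Represents.exists_legs hE he hA hA' hne
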